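/- **Setting.** Let $\theta,b\in\mathbb R$, $C>0$, $\varepsilon>0$, $n\ge 0$ and $0=t_0<t_1<\dots<t_n<t_{n+1}=T$. Let $U_1,\dots,U_n,Z_1,\dots,Z_n$ be independent random variables on a probability space, $U_i$ uniform on $[0,1]$ and $Z_i\sim\mathcal N(0,1)$. For $a\in\mathbb R$ let $\mathcal G(a)f(x)=(-\theta x+a)f'(x)+\tfrac12 b^2f''(x)$. For $s\in[0,T]$ and a probability measure $\mu$ on $\mathbb R$, an admissible controlled system on $[s,T]$ started from $\mu$ consists of a real control process $(\alpha_t)_{t\in[s,T]}$ with integrable paths and a process $(\mu_t)_{t\in[s,T]}$ of probability measures on $\mathbb R$ such that: * $\mu_s=\mu$, and on every time interval $[r,t]\subset[s,T]$ with no observation time in $(r,t]$ the equation $d\mu_q=\mathcal G(\alpha_q)^*\mu_q\,dq$ holds weakly, i.e. $\int f\,d\mu_t=\int f\,d\mu_r+\int_r^t\!\int \mathcal G(\alpha_q)f\,d\mu_q\,dq$ for all $f\in C_c^\infty(\mathbb R)$; * at each observation time $t_i$ with $1\le i\le n$ and $t_i>s$, the weak left limit $\mu_{t_i^-}$ exists,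 one observes $Y_i=\widehat X_i+\varepsilon Z_i$, where $\widehat X_i=F[\mu_{t_i^-}]^{-1}(U_i)$ and $F[\nu]^{-1}$ is the quantile function of $\nu$, and the law is updated by Bayes' rule $$\mu_{t_i}(dx)=\frac{\rho_\varepsilon(Y_i-x)}{\int\rho_\varepsilon(Y_i-x')\,\mu_{t_i^-}(dx')}\,\mu_{t_i^-}(dx),$$ with $\rho_\varepsilon$ the density of $\mathcal N(0,\varepsilon^2)$; * $\alpha$ is progressively measurable with respect to the filtration $\mathcal F_t=\sigma(Y_i: s<t_i\le t)$. The value function is $$V(s,\mu)=\inf\ \mathbb E\Big[\int_s^T\Big(\int x^2\mu_t(dx)+C\alpha_t^2\Big)dt+\int x^2\mu_T(dx)\Big],$$ the infimum being over all admissible controlled systems on $[s,T]$ started from $\mu$. For $t\in[0,T]$, $m\in\mathbb R$ and $z\ge0$ put $\widehat U(t,m,z)=V(t,\mathcal N(m,z))$, where $\mathcal N(m,0)=\delta_m$. **Lemma (HJB, controlled O-U case).** The function $\widehat U$ is finite and satisfies the following. 1. For $t_i\le t<t_{i+1}$, $i=0,\dots,n$, $m\in\mathbb R$ and $z\ge0$,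 the partial derivatives of $\widehat U$ at $(t,m,z)$ exist (as derivatives from the right in $t$ if $t=t_i$, and in $z$ if $z=0$), and $$\frac{\partial\widehat U}{\partial t}+z+m^2-\theta m\frac{\partial\widehat U}{\partial m}+(b^2-2\theta z)\frac{\partial\widehat U}{\partial z}-\frac1{4C}\Big[\frac{\partial\widehat U}{\partial m}\Big]^2=0 .$$ 2. For $i=1,\dots,n$, $m\in\mathbb R$ and $z\ge0$, the left limit $\widehat U(t_i^-,m,z)=\lim_{t\uparrow t_i}\widehat U(t,m,z)$ exists, and $$\widehat U(t_i^-,m,z)=\int_{\mathbb R}\widehat U\Big(t_i,\,m+\frac{z}{\sqrt{z+\varepsilon^2}}\,w,\,\frac{z\varepsilon^2}{z+\varepsilon^2}\Big)\phi(w)\,dw,$$ the integrand being integrable, where $\phi$ is the density of $\mathcal N(0,1)$. 3. For $m\in\mathbb R$ and $z\ge0$, $\widehat U(T,m,z)=m^2+z=\lim_{t\uparrow T}\widehat U(t,m,z)$. -/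

import Mathlib

open MeasureTheory ProbabilityTheory Filter Topology
open scoped ENNReal NNReal

/-- The controlled Ornstein-Uhlenbeck generator
`𝒢(a) f (x) = (-θ x + a) f'(x) + (b² / 2) f''(x)`. -/
noncomputable def ouGenerator (θ b a : ℝ) (f : ℝ → ℝ) (x : ℝ) : ℝ :=
  (-θ * x + a) * deriv f x + b ^ 2 / 2 * deriv (deriv f) x

/-- The likelihood `L_ε(x; y) = ρ_ε(y - x)`, with `ρ_ε` the density of `𝒩(0, ε²)`. -/
noncomputable def obsLikelihood (ε x y : ℝ) : ℝ :=
  gaussianPDFReal 0 (Real.toNNReal (ε ^ 2)) (y - x)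

/-- The Bayes kernel `K_ε(x; ν, y) = L_ε(x; y) / ∫ L_ε(x'; y) ν(dx')`. -/
noncomputable def bayesKernel (ε : ℝ) (x : ℝ) (ν : Measure ℝ) (y : ℝ) : ℝ :=
  obsLikelihood ε x y / ∫ x', obsLikelihood ε x' y ∂ν

/-- The Bayesian update `K_ε(x; ν, y) ν(dx)` of the prior `ν` given the observed value `y`. -/
noncomputable def bayesUpdate (ε : ℝ) (ν : Measure ℝ) (y : ℝ) : Measure ℝ :=
  ν.withDensity fun x => ENNReal.ofReal (bayesKernel ε x ν y)

/-- The generalized inverse (quantile function) of the c.d.f. of `ν`; the value is meaningful for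
`0 < u < 1`. -/
noncomputable def quantile (ν : Measure ℝ) (u : ℝ) : ℝ :=
  sInf {x : ℝ | u ≤ cdf ν x}

/-- The second moment `∫ x² ν(dx)`, with values in `[0, ∞]`. -/
noncomputable def secondMoment (ν : Measure ℝ) : ℝ≥0∞ :=
  ∫⁻ x, ENNReal.ofReal (x ^ 2) ∂ν

/-- The Gaussian law with mean `m` and variance `z ≥ 0` (the Dirac mass at `m` if `z = 0`). -/
noncomputable def gaussianLaw (m z : ℝ) : ProbabilityMeasure ℝ :=
  ⟨gaussianReal m z.toNNReal, inferInstance⟩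

/-- The data of the problem: the coefficients of the dynamics, the weight `C` of the control cost,
the noise level `ε` of the observations, the times `t_0, t_1, …, t_n, t_{n+1}` (the observation
times are `t_1, …, t_n`, while `t_0` is the initial time and `t_{n+1}` the horizon), and the random
variables that drive the observations. -/
structure OUModel (n : ℕ) (Ω : Type*) where
  θ : ℝ
  b : ℝ
  C : ℝ
  ε : ℝ
  time : Fin (n + 2) → ℝ
  U : Fin n → Ω → ℝ
  Z : Fin n → Ω → ℝ

namespace OUModel

variable {n : ℕ} {Ω : Type*}

/-- The time horizon `T = t_{n+1}`. -/
def horizon (M : OUModel n Ω) : ℝ := M.time (Fin.last (n + 1))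

/-- The observation times: `obsTime j` is `t_{j+1}` for `j = 0, …, n - 1`. -/
def obsTime (M : OUModel n Ω) (j : Fin n) : ℝ := M.time j.succ.castSucc

/-- The observation `Y_j = X̂_j + ε Z_j`, where `X̂_j = F[μ_{t_j^-}]⁻¹(U_j)` is sampled from the
conditional law `prior j = μ_{t_j^-}` just before the observation. -/
noncomputable def observation (M : OUModel n Ω) (prior : Fin n → Ω → ProbabilityMeasure ℝ)
    (j : Fin n) (ω : Ω) : ℝ :=
  quantile (prior j ω : Measure ℝ) (M.U j ω) + M.ε * M.Z j ω

/-- The `σ`-algebra generated by the observations made in the time interval `(s, t]`. -/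
noncomputable abbrev obsSigma (M : OUModel n Ω) (prior : Fin n → Ω → ProbabilityMeasure ℝ)
    (s t : ℝ) : MeasurableSpace Ω :=
  ⨆ j : Fin n, ⨆ _ : s < M.obsTime j ∧ M.obsTime j ≤ t,
    MeasurableSpace.comap (M.observation prior j) (borel ℝ)

/-- `α` is an admissible control on `[s, T]` and `μ` is the corresponding conditional law process
on `[s, T]` started from `μ₀` at time `s`, with `prior j` its value `μ_{t_j^-}` just before the
observation time `t_j > s`. -/
structure IsControlledPath (M : OUModel n Ω) (s : ℝ) (μ₀ : ProbabilityMeasure ℝ)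
    (α : ℝ → Ω → ℝ) (μ : ℝ → Ω → ProbabilityMeasure ℝ)
    (prior : Fin n → Ω → ProbabilityMeasure ℝ) : Prop where
  /-- The control is (progressively) adapted to the filtration of the observations. -/
  adapted : ∀ t ∈ Set.Icc s M.horizon,
    Measurable[MeasurableSpace.prod inferInstance (M.obsSigma prior s t)]
      fun p : Set.Icc s t × Ω => α p.1 p.2
  /-- The control is integrable in time, so that the controlled dynamics make sense. -/
  integrable : ∀ ω, IntegrableOn (fun t => α t ω) (Set.Icc s M.horizon)
  initial : ∀ ω, μ s ω = μ₀
  /-- Between observations, `dμ_t = 𝒢(α_t)* μ_t dt` holds in the weak sense. -/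
  fokkerPlanck : ∀ ω, ∀ f : ℝ → ℝ, ContDiff ℝ (⊤ : ℕ∞) f → HasCompactSupport f →
    ∀ r t, s ≤ r → r ≤ t → t ≤ M.horizon → (∀ j, M.obsTime j ∉ Set.Ioc r t) →
      IntervalIntegrable (fun q => ∫ x, ouGenerator M.θ M.b (α q ω) f x ∂(μ q ω : Measure ℝ))
        volume r t ∧
      ∫ x, f x ∂(μ t ω : Measure ℝ) = ∫ x, f x ∂(μ r ω : Measure ℝ) +
        ∫ q in r..t, ∫ x, ouGenerator M.θ M.b (α q ω) f x ∂(μ q ω : Measure ℝ)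
  /-- `prior j` is the left limit of `μ` at the observation time (for weak convergence). -/
  leftLimit : ∀ ω j, s < M.obsTime j →
    Tendsto (fun t => μ t ω) (𝓝[<] M.obsTime j) (𝓝 (prior j ω))
  /-- At an observation time the law is updated by Bayes' rule. -/
  update : ∀ ω j, s < M.obsTime j →
    (μ (M.obsTime j) ω : Measure ℝ) =
      bayesUpdate M.ε (prior j ω : Measure ℝ) (M.observation prior j ω)

/-- The cost on `[s, T]`,
`𝔼 [∫_s^T (∫ x² μ_t(dx) + C α_t²) dt + ∫ x² μ_T(dx)]`, with values in `[0, ∞]`. -/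
noncomputable def cost [MeasurableSpace Ω] (M : OUModel n Ω) (P : Measure Ω) (s : ℝ)
    (α : ℝ → Ω → ℝ) (μ : ℝ → Ω → ProbabilityMeasure ℝ) : ℝ≥0∞ :=
  ∫⁻ ω, ((∫⁻ t in Set.Icc s M.horizon,
      (secondMoment (μ t ω : Measure ℝ) + ENNReal.ofReal (M.C * α t ω ^ 2))) +
    secondMoment (μ M.horizon ω : Measure ℝ)) ∂P

/-- The value function `V(s, μ₀)`: the infimum of the cost over all admissible controls on
`[s, T]`, the conditional law being `μ₀` at time `s`. -/
noncomputable def value [MeasurableSpace Ω] (M : OUModel n Ω) (P : Measure Ω) (s : ℝ)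
    (μ₀ : ProbabilityMeasure ℝ) : ℝ≥0∞ :=
  ⨅ (α : ℝ → Ω → ℝ) (μ : ℝ → Ω → ProbabilityMeasure ℝ)
    (prior : Fin n → Ω → ProbabilityMeasure ℝ) (_ : M.IsControlledPath s μ₀ α μ prior),
    M.cost P s α μ

/-- The value function at Gaussian laws, as a function `Û(t, m, z)` of time, mean and variance. -/
noncomputable def gaussValue [MeasurableSpace Ω] (M : OUModel n Ω) (P : Measure Ω)
    (t m z : ℝ) : ℝ :=
  (M.value P t (gaussianLaw m z)).toReal

end OUModel

/-!
A control only shifts the mean of the law, and the Bayes update changes the variance of a Gaussian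
law by an amount that does not depend on the observed value. Hence, by uniqueness for the
Fokker–Planck equation (the characteristic function of a weak solution solves a linear equation in
time along scaled frequencies), every controlled path started from a Gaussian law stays Gaussian,
with a deterministic variance. Completing the square with the solution `p` of the Riccati equation,
where `p(h)` refers to the time `h` left to the horizon `T`, the expected cost of a path is
`p(T - s) m²` plus a deterministic cost of the variance plus the expected integral of
`C (α + p x / C)²`, where `x` is the conditional mean; each observation adds to `x` an independent
centred increment whose variance is the drop of the variance of the law. The feedback
`α = -p x / C` makes the square vanish, so the value is explicit.
-/

/-! ### The value of uncontrolled variance -/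

/-- The integrated discount `∫_0^h e^{-2θr} dr`, i.e. `(1 - e^{-2θh}) / (2θ)` without a case
distinction at `θ = 0`. -/
noncomputable def discountIntegral (θ h : ℝ) : ℝ := ∫ r in (0 : ℝ)..h, Real.exp (-2 * θ * r)

/-- The variance at time `h` of the Ornstein-Uhlenbeck dynamics started with variance `z`. The
control only shifts the mean, so this does not depend on it. -/
noncomputable def ouVar (θ b h z : ℝ) : ℝ :=
  Real.exp (-2 * θ * h) * z + b ^ 2 * discountIntegral θ h

lemma continuous_exp_const_mul (c : ℝ) : Continuous fun r : ℝ => Real.exp (c * r) := by fun_prop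

lemma hasDerivAt_exp_const_mul (c h : ℝ) :
    HasDerivAt (fun x : ℝ => Real.exp (c * x)) (c * Real.exp (c * h)) h := by
  simpa [mul_comm] using ((hasDerivAt_id h).const_mul c).exp

lemma hasDerivAt_discountIntegral (θ h : ℝ) :
    HasDerivAt (discountIntegral θ) (Real.exp (-2 * θ * h)) h :=
  (continuous_exp_const_mul (-2 * θ)).integral_hasStrictDerivAt 0 h |>.hasDerivAt

lemma continuous_discountIntegral (θ : ℝ) : Continuous (discountIntegral θ) :=
  continuous_iff_continuousAt.2 fun h => (hasDerivAt_discountIntegral θ h).continuousAt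

lemma discountIntegral_zero (θ : ℝ) : discountIntegral θ 0 = 0 := intervalIntegral.integral_same

lemma exp_eq_one_sub_discountIntegral (θ h : ℝ) :
    Real.exp (-2 * θ * h) = 1 - 2 * θ * discountIntegral θ h := by
  have hsum : ∀ x, HasDerivAt (fun x => Real.exp (-2 * θ * x) + 2 * θ * discountIntegral θ x) 0 x :=
    fun x => ((hasDerivAt_exp_const_mul (-2 * θ) x).add
      ((hasDerivAt_discountIntegral θ x).const_mul (2 * θ))).congr_deriv (by ring)
  have hconst := is_const_of_deriv_eq_zero (fun x => (hsum x).differentiableAt)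
    (fun x => (hsum x).deriv) h 0
  simp only [discountIntegral_zero, mul_zero, Real.exp_zero, add_zero] at hconst
  linarith

lemma discountIntegral_pos (θ : ℝ) {h : ℝ} (hh : 0 < h) : 0 < discountIntegral θ h :=
  intervalIntegral.intervalIntegral_pos_of_pos
    ((continuous_exp_const_mul _).intervalIntegrable _ _) (fun _ => Real.exp_pos _) hh

lemma discountIntegral_nonneg (θ : ℝ) {h : ℝ} (hh : 0 ≤ h) : 0 ≤ discountIntegral θ h :=
  intervalIntegral.integral_nonneg hh fun _ _ => (Real.exp_pos _).le

lemma ouVar_zero (θ b z : ℝ) : ouVar θ b 0 z = z := by simp [ouVar, discountIntegral_zero]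

lemma ouVar_nonneg (θ b : ℝ) {h z : ℝ} (hh : 0 ≤ h) (hz : 0 ≤ z) : 0 ≤ ouVar θ b h z := by
  have := discountIntegral_nonneg θ hh
  unfold ouVar; positivity

lemma ouVar_pos_or_eq_zero (θ b : ℝ) {z : ℝ} (hz : 0 ≤ z) :
    (∀ h, 0 < h → 0 < ouVar θ b h z) ∨ (b = 0 ∧ ∀ h, ouVar θ b h z = 0) := by
  rcases hz.eq_or_lt with rfl | hz
  · rcases eq_or_ne b 0 with rfl | hb
    · exact .inr ⟨rfl, by simp [ouVar]⟩
    · refine .inl fun h hh => ?_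
      have := discountIntegral_pos θ hh
      unfold ouVar; positivity
  · refine .inl fun h hh => ?_
    have := discountIntegral_pos θ hh
    unfold ouVar; positivity

lemma hasDerivAt_ouVar (θ b h z : ℝ) :
    HasDerivAt (fun h => ouVar θ b h z) (b ^ 2 - 2 * θ * ouVar θ b h z) h := by
  refine (((hasDerivAt_exp_const_mul (-2 * θ) h).mul_const z).add
    ((hasDerivAt_discountIntegral θ h).const_mul (b ^ 2))).congr_deriv ?_
  unfold ouVar
  linear_combination b ^ 2 * exp_eq_one_sub_discountIntegral θ h

lemma continuous_ouVar_left (θ b z : ℝ) : Continuous fun h => ouVar θ b h z :=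
  continuous_iff_continuousAt.2 fun h => (hasDerivAt_ouVar θ b h z).continuousAt

lemma hasDerivAt_ouVar_right (θ b h z : ℝ) :
    HasDerivAt (fun z => ouVar θ b h z) (Real.exp (-2 * θ * h)) z := by
  simpa [ouVar] using ((hasDerivAt_id z).const_mul (Real.exp (-2 * θ * h))).add_const
    (b ^ 2 * discountIntegral θ h)

lemma integral_ouVar (θ b h z : ℝ) : ∫ r in (0 : ℝ)..h, ouVar θ b r z =
    discountIntegral θ h * z + b ^ 2 * ∫ r in (0 : ℝ)..h, discountIntegral θ r := by
  have hexp : Continuous fun r : ℝ => Real.exp (-2 * θ * r) * z := by fun_prop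
  unfold ouVar
  rw [intervalIntegral.integral_add (hexp.intervalIntegrable _ _)
    (((continuous_discountIntegral θ).const_mul _).intervalIntegrable _ _),
    intervalIntegral.integral_mul_const, intervalIntegral.integral_const_mul]
  rfl

/-- The cost `∫_0^h v_r dr + g(v_h)` along the variance dynamics `v` started from `z`: the part of
the value due to the variance, on a time interval without observations. -/
noncomputable def varCost (θ b : ℝ) (g : ℝ → ℝ) (h z : ℝ) : ℝ :=
  (∫ r in (0 : ℝ)..h, ouVar θ b r z) + g (ouVar θ b h z)

lemma varCost_zero (θ b : ℝ) (g : ℝ → ℝ) (z : ℝ) : varCost θ b g 0 z = g z := by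
  simp [varCost, ouVar_zero]

lemma varCost_nonneg (θ b : ℝ) {g : ℝ → ℝ} (hg : ∀ z, 0 ≤ z → 0 ≤ g z) {h z : ℝ} (hh : 0 ≤ h)
    (hz : 0 ≤ z) : 0 ≤ varCost θ b g h z :=
  add_nonneg (intervalIntegral.integral_nonneg hh fun _ hr => ouVar_nonneg θ b hr.1 hz)
    (hg _ (ouVar_nonneg θ b hh hz))

lemma hasDerivWithinAt_varCost_right (θ b : ℝ) {g : ℝ → ℝ} {g' h z : ℝ} (hh : 0 ≤ h)
    (hg : HasDerivWithinAt g g' (Set.Ici 0) (ouVar θ b h z)) :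
    HasDerivWithinAt (varCost θ b g h)
      (discountIntegral θ h + g' * Real.exp (-2 * θ * h)) (Set.Ici 0) z := by
  have hint : HasDerivWithinAt (fun z => ∫ r in (0 : ℝ)..h, ouVar θ b r z)
      (discountIntegral θ h) (Set.Ici 0) z := by
    simp_rw [integral_ouVar]
    simpa using (((hasDerivAt_id z).const_mul (discountIntegral θ h)).add_const
      (b ^ 2 * ∫ r in (0 : ℝ)..h, discountIntegral θ r)).hasDerivWithinAt
  exact hint.add (hg.comp z (hasDerivAt_ouVar_right θ b h z).hasDerivWithinAt
    fun _ hy => ouVar_nonneg θ b hh hy)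

lemma hasDerivWithinAt_varCost_time (θ b : ℝ) {g : ℝ → ℝ} {g' h z : ℝ} (hz : 0 ≤ z)
    (hg : HasDerivWithinAt g g' (Set.Ici 0) (ouVar θ b h z)) :
    HasDerivWithinAt (fun h => varCost θ b g h z)
      (ouVar θ b h z + g' * (b ^ 2 - 2 * θ * ouVar θ b h z)) (Set.Ici 0) h :=
  ((continuous_ouVar_left θ b z).integral_hasStrictDerivAt 0 h).hasDerivAt.hasDerivWithinAt.add
    (hg.comp h (hasDerivAt_ouVar θ b h z).hasDerivWithinAt fun _ hy => ouVar_nonneg θ b hy hz)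

lemma varCost_transport (θ b g' h z : ℝ) :
    ouVar θ b h z + g' * (b ^ 2 - 2 * θ * ouVar θ b h z) =
      z + (b ^ 2 - 2 * θ * z) * (discountIntegral θ h + g' * Real.exp (-2 * θ * h)) := by
  unfold ouVar
  linear_combination (z - b ^ 2 * g') * exp_eq_one_sub_discountIntegral θ h

/-! ### The Riccati equation -/

/-- The rate `√(θ² + 1/C)` of the linear system behind the Riccati equation. -/
noncomputable def riccatiRate (θ C : ℝ) : ℝ := √(θ ^ 2 + 1 / C)

/-- The component `N` of the solution of the linear system `N' = D - θN`, `D' = θD + N/C`,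
`N(0) = D(0) = 1`, whose quotient `N/D` solves the Riccati equation. -/
noncomputable def riccatiNum (θ C h : ℝ) : ℝ :=
  Real.cosh (riccatiRate θ C * h) + (1 - θ) / riccatiRate θ C * Real.sinh (riccatiRate θ C * h)

/-- The component `D` of the solution of the linear system described at `riccatiNum`. -/
noncomputable def riccatiDen (θ C h : ℝ) : ℝ :=
  Real.cosh (riccatiRate θ C * h) +
    (θ + 1 / C) / riccatiRate θ C * Real.sinh (riccatiRate θ C * h)

/-- The solution of the Riccati equation `p' = 1 - 2θp - p²/C`, `p(0) = 1`, where `h` is the time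
left to the horizon. -/
noncomputable def riccati (θ C h : ℝ) : ℝ := riccatiNum θ C h / riccatiDen θ C h

lemma riccatiRate_sq (θ : ℝ) {C : ℝ} (hC : 0 < C) : riccatiRate θ C ^ 2 = θ ^ 2 + 1 / C :=
  Real.sq_sqrt (by positivity)

lemma abs_lt_riccatiRate (θ : ℝ) {C : ℝ} (hC : 0 < C) : |θ| < riccatiRate θ C := by
  refine Real.lt_sqrt_of_sq_lt ?_
  rw [sq_abs]
  exact lt_add_of_pos_right _ (by positivity)

lemma riccatiRate_pos (θ : ℝ) {C : ℝ} (hC : 0 < C) : 0 < riccatiRate θ C :=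
  (abs_nonneg θ).trans_lt (abs_lt_riccatiRate θ hC)

lemma cosh_add_mul_sinh_pos {c x : ℝ} (hc : -1 < c) (hx : 0 ≤ x) :
    0 < Real.cosh x + c * Real.sinh x := by
  have hsinh : 0 ≤ Real.sinh x := Real.sinh_nonneg_iff.2 hx
  have hexp := Real.exp_pos (-x)
  rw [← Real.cosh_sub_sinh] at hexp
  nlinarith

lemma riccatiNum_pos (θ : ℝ) {C h : ℝ} (hC : 0 < C) (hh : 0 ≤ h) : 0 < riccatiNum θ C h := by
  have hk := riccatiRate_pos θ hC
  refine cosh_add_mul_sinh_pos ?_ (mul_nonneg hk.le hh)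
  rw [lt_div_iff₀ hk]
  linarith [(le_abs_self θ).trans_lt (abs_lt_riccatiRate θ hC)]

lemma riccatiDen_pos (θ : ℝ) {C h : ℝ} (hC : 0 < C) (hh : 0 ≤ h) : 0 < riccatiDen θ C h := by
  have hk := riccatiRate_pos θ hC
  refine cosh_add_mul_sinh_pos ?_ (mul_nonneg hk.le hh)
  rw [lt_div_iff₀ hk]
  have : 0 < 1 / C := by positivity
  linarith [(neg_le_abs θ).trans_lt (abs_lt_riccatiRate θ hC)]

lemma hasDerivAt_cosh_add_sinh (k c h : ℝ) :
    HasDerivAt (fun h => Real.cosh (k * h) + c * Real.sinh (k * h))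
      (k * Real.sinh (k * h) + c * k * Real.cosh (k * h)) h := by
  have hlin : HasDerivAt (fun x : ℝ => k * x) k h := by simpa using (hasDerivAt_id h).const_mul k
  exact (hlin.cosh.add (hlin.sinh.const_mul c)).congr_deriv (by ring)

lemma hasDerivAt_riccatiDen (θ : ℝ) {C : ℝ} (hC : 0 < C) (h : ℝ) :
    HasDerivAt (riccatiDen θ C) (θ * riccatiDen θ C h + riccatiNum θ C h / C) h := by
  have hk := riccatiRate_pos θ hC
  have hsq := riccatiRate_sq θ hC
  refine (hasDerivAt_cosh_add_sinh _ _ h).congr_deriv ?_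
  unfold riccatiDen riccatiNum
  field_simp at hsq ⊢
  linear_combination Real.sinh (riccatiRate θ C * h) * hsq

lemma hasDerivAt_riccatiNum (θ : ℝ) {C : ℝ} (hC : 0 < C) (h : ℝ) :
    HasDerivAt (riccatiNum θ C) (riccatiDen θ C h - θ * riccatiNum θ C h) h := by
  have hk := riccatiRate_pos θ hC
  have hsq := riccatiRate_sq θ hC
  refine (hasDerivAt_cosh_add_sinh _ _ h).congr_deriv ?_
  unfold riccatiDen riccatiNum
  field_simp at hsq ⊢
  linear_combination Real.sinh (riccatiRate θ C * h) * hsq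

lemma hasDerivAt_riccati (θ : ℝ) {C h : ℝ} (hC : 0 < C) (hh : 0 ≤ h) :
    HasDerivAt (riccati θ C) (1 - 2 * θ * riccati θ C h - riccati θ C h ^ 2 / C) h := by
  have hD := riccatiDen_pos θ hC hh
  refine ((hasDerivAt_riccatiNum θ hC h).div (hasDerivAt_riccatiDen θ hC h) hD.ne').congr_deriv ?_
  unfold riccati
  field_simp
  ring

lemma riccati_zero (θ C : ℝ) : riccati θ C 0 = 1 := by
  simp [riccati, riccatiNum, riccatiDen]

lemma riccati_pos (θ : ℝ) {C h : ℝ} (hC : 0 < C) (hh : 0 ≤ h) : 0 < riccati θ C h :=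
  div_pos (riccatiNum_pos θ hC hh) (riccatiDen_pos θ hC hh)

/-! ### Absolutely continuous functions -/

section AbsoluteContinuity

lemma intervalIntegrable_mono_Icc {E : Type*} [NormedAddCommGroup E] {k : ℝ → E}
    {r t x y : ℝ} (hk : IntervalIntegrable k volume r t) (hx : r ≤ x) (hxy : x ≤ y)
    (hy : y ≤ t) : IntervalIntegrable k volume x y := by
  refine hk.mono_set ?_
  rw [Set.uIcc_of_le hxy, Set.uIcc_of_le (by linarith)]
  exact Set.Icc_subset_Icc hx hy

variable {E X Y : Type*} [NormedAddCommGroup E] [NormedSpace ℝ E] [PseudoMetricSpace X]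
  [PseudoMetricSpace Y]

lemma integral_sub_integral_of_mem {k : ℝ → E} {r t x y : ℝ} (hk : IntervalIntegrable k volume r t)
    (hx : r ≤ x) (hxy : x ≤ y) (hy : y ≤ t) :
    (∫ w in r..y, k w) - ∫ w in r..x, k w = ∫ w in x..y, k w :=
  intervalIntegral.integral_interval_sub_left
    (intervalIntegrable_mono_Icc hk le_rfl (hx.trans hxy) hy)
    (intervalIntegrable_mono_Icc hk le_rfl hx (hxy.trans hy))

lemma continuousOn_primitive_Icc {k : ℝ → E} {r t : ℝ} (hrt : r ≤ t)
    (hk : IntervalIntegrable k volume r t) :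
    ContinuousOn (fun x => ∫ w in r..x, k w) (Set.Icc r t) := by
  rw [← Set.uIcc_of_le hrt]
  exact intervalIntegral.continuousOn_primitive_interval
    (by rw [Set.uIcc_of_le hrt]; exact (intervalIntegrable_iff_integrableOn_Icc_of_le hrt).1 hk)

lemma absolutelyContinuousOnInterval_of_dist_le {f : ℝ → X} {g : ℝ → Y} {K r t : ℝ}
    (hg : AbsolutelyContinuousOnInterval g r t)
    (hfg : ∀ x ∈ Set.uIcc r t, ∀ y ∈ Set.uIcc r t, dist (f x) (f y) ≤ K * dist (g x) (g y)) :
    AbsolutelyContinuousOnInterval f r t := by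
  unfold AbsolutelyContinuousOnInterval at hg ⊢
  refine squeeze_zero' (.of_forall fun _ => Finset.sum_nonneg fun _ _ => dist_nonneg) ?_
    (by simpa only [mul_zero] using hg.const_mul K)
  rw [eventually_inf_principal]
  filter_upwards with I hI
  rw [Finset.mul_sum]
  exact Finset.sum_le_sum fun i hi => hfg _ (hI.1 i hi).1 _ (hI.1 i hi).2

lemma absolutelyContinuousOnInterval_of_norm_sub_le_integral {E : Type*} [NormedAddCommGroup E]
    {f : ℝ → E} {k : ℝ → ℝ} {K r t : ℝ} (hrt : r ≤ t) (hk : IntervalIntegrable k volume r t)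
    (hf : ∀ x y, r ≤ x → x ≤ y → y ≤ t → ‖f y - f x‖ ≤ K * ∫ w in x..y, k w) :
    AbsolutelyContinuousOnInterval f r t := by
  refine absolutelyContinuousOnInterval_of_dist_le (K := |K|)
    (hk.absolutelyContinuousOnInterval_intervalIntegral Set.left_mem_uIcc) ?_
  have ordered : ∀ x y, r ≤ x → x ≤ y → y ≤ t →
      dist (f x) (f y) ≤ |K| * dist (∫ w in r..x, k w) (∫ w in r..y, k w) := by
    intro x y hx hxy hy
    rw [dist_comm, dist_comm (∫ w in r..x, k w), dist_eq_norm, Real.dist_eq,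
      integral_sub_integral_of_mem hk hx hxy hy, ← abs_mul]
    exact (hf x y hx hxy hy).trans (le_abs_self _)
  rw [Set.uIcc_of_le hrt]
  intro x hx y hy
  rcases le_total x y with hxy | hyx
  · exact ordered x y hx.1 hxy hy.2
  · rw [dist_comm, dist_comm (∫ w in r..x, k w)]
    exact ordered y x hy.1 hyx hx.2

lemma absolutelyContinuousOnInterval_primitive {k : ℝ → E} {r t : ℝ} (hrt : r ≤ t)
    (hk : IntervalIntegrable k volume r t) :
    AbsolutelyContinuousOnInterval (fun x => ∫ w in r..x, k w) r t := by
  refine absolutelyContinuousOnInterval_of_norm_sub_le_integral (K := 1) hrt hk.norm ?_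
  intro x y hx hxy hy
  rw [integral_sub_integral_of_mem hk hx hxy hy, one_mul]
  exact intervalIntegral.norm_integral_le_integral_norm hxy

lemma absolutelyContinuousOnInterval_comp_of_contDiff {F : Type*} [NormedAddCommGroup F]
    [NormedSpace ℝ F] [ProperSpace E] {φ : E → F} {f : ℝ → E} {r t : ℝ} (hφ : ContDiff ℝ 1 φ)
    (hf : AbsolutelyContinuousOnInterval f r t) :
    AbsolutelyContinuousOnInterval (fun x => φ (f x)) r t := by
  obtain ⟨R, hR⟩ := hf.exists_bound
  obtain ⟨K, hK⟩ := hφ.contDiffOn.exists_lipschitzOnWith one_ne_zero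
    (convex_closedBall (0 : E) R) (isCompact_closedBall 0 R)
  exact absolutelyContinuousOnInterval_of_dist_le hf fun x hx y hy =>
    hK.dist_le_mul _ (mem_closedBall_zero_iff.2 (hR x hx)) _ (mem_closedBall_zero_iff.2 (hR y hy))

lemma integral_eq_sub_of_ae_hasDerivAt {f f' : ℝ → ℝ} {r t : ℝ}
    (hf : AbsolutelyContinuousOnInterval f r t)
    (hf' : ∀ᵐ x, x ∈ Set.uIcc r t → HasDerivAt f (f' x) x) :
    ∫ x in r..t, f' x = f t - f r := by
  rw [← hf.integral_deriv_eq_sub]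
  refine intervalIntegral.integral_congr_ae ?_
  filter_upwards [hf'] with x hx hxI
  exact (hx (Set.uIoc_subset_uIcc hxI)).deriv.symm

lemma ae_mem_Icc_imp_mem_Ioo (r t : ℝ) : ∀ᵐ x : ℝ, x ∈ Set.Icc r t → x ∈ Set.Ioo r t := by
  filter_upwards [(Set.countable_singleton r).ae_notMem volume,
    (Set.countable_singleton t).ae_notMem volume] with x hxr hxt hx
  exact ⟨lt_of_le_of_ne hx.1 (Ne.symm hxr), lt_of_le_of_ne hx.2 hxt⟩

lemma hasDerivAt_zero_of_norm_sub_le_sq {D : ℝ → E} {G : ℝ → ℝ} {G' K x : ℝ}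
    (hG : HasDerivAt G G' x) (hD : ∀ᶠ y in 𝓝 x, ‖D y - D x‖ ≤ K * (G y - G x) ^ 2) :
    HasDerivAt D 0 x := by
  have hGO : (fun y => G y - G x) =O[𝓝 x] fun y => y - x := hG.isBigO_sub
  have hsq : (fun y => (G y - G x) ^ 2) =o[𝓝 x] fun y => y - x :=
    (hGO.pow 2).trans_isLittleO (by
      simpa only [← norm_pow, Asymptotics.isLittleO_norm_left] using
        Asymptotics.isLittleO_pow_sub_sub x one_lt_two)
  rw [hasDerivAt_iff_isLittleO]
  simpa only [smul_zero, sub_zero] using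
    (Asymptotics.IsBigO.of_bound' <| hD.mono fun y hy => hy.trans (le_abs_self _)).trans_isLittleO
      (hsq.const_mul_left K)

lemma eq_of_norm_sub_le_sq_integral {D : ℝ → E} {k : ℝ → ℝ} {K r t : ℝ} (hrt : r ≤ t)
    (hk : IntervalIntegrable k volume r t)
    (hD : ∀ x y, r ≤ x → x ≤ y → y ≤ t → ‖D y - D x‖ ≤ K * (∫ w in x..y, k w) ^ 2) :
    D t = D r := by
  set G : ℝ → ℝ := fun x => ∫ w in r..x, k w
  have hG : ∀ {x y}, r ≤ x → x ≤ y → y ≤ t → G y - G x = ∫ w in x..y, k w :=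
    integral_sub_integral_of_mem hk
  obtain ⟨M, hM⟩ := (absolutelyContinuousOnInterval_primitive hrt hk).exists_bound
  rw [Set.uIcc_of_le hrt] at hM
  have hAC : AbsolutelyContinuousOnInterval D r t := by
    refine absolutelyContinuousOnInterval_of_norm_sub_le_integral (K := |K| * (M + M)) hrt
      hk.norm fun x y hx hxy hy => (hD x y hx hxy hy).trans ?_
    have hG_le : |G y - G x| ≤ M + M := (abs_sub _ _).trans
      (add_le_add (hM y ⟨hx.trans hxy, hy⟩) (hM x ⟨hx, hxy.trans hy⟩))
    have hk_le : |G y - G x| ≤ ∫ w in x..y, ‖k w‖ := by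
      rw [hG hx hxy hy]
      exact intervalIntegral.norm_integral_le_integral_norm (f := k) hxy
    rw [← hG hx hxy hy, ← sq_abs, pow_two, mul_assoc]
    exact mul_le_mul (le_abs_self K)
      (mul_le_mul hG_le hk_le (abs_nonneg _) ((abs_nonneg _).trans hG_le))
      (by positivity) (abs_nonneg K)
  have hD' : ∀ᵐ x, x ∈ Set.uIcc r t → HasDerivAt D 0 x := by
    filter_upwards [hk.ae_hasDerivAt_integral, ae_mem_Icc_imp_mem_Ioo r t] with x hx hxI hxrt
    have hxI' := hxI (by rwa [← Set.uIcc_of_le hrt])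
    refine hasDerivAt_zero_of_norm_sub_le_sq (hx hxrt r Set.left_mem_uIcc) (K := K) ?_
    filter_upwards [Ioo_mem_nhds hxI'.1 hxI'.2] with y hy
    rcases le_total x y with hxy | hyx
    · rw [hG hxI'.1.le hxy hy.2.le]
      exact hD x y hxI'.1.le hxy hy.2.le
    · rw [norm_sub_rev, sub_sq_comm, hG hy.1.le hyx hxI'.2.le]
      exact hD y x hy.1.le hyx hxI'.2.le
  obtain ⟨c, hc⟩ := hAC.const_of_ae_hasDerivAt_zero hD'
  rw [hc t Set.right_mem_uIcc, hc r Set.left_mem_uIcc]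

-- The mixed increments of `H` over `[x, y]` are bounded by the square of the increment of the
-- absolutely continuous function `∫ k`, so they do not contribute to the derivative of `H x x`.
lemma sub_eq_integral_diag {H Hx Hy : ℝ → ℝ → ℝ} {k : ℝ → ℝ} {K r t : ℝ} (hrt : r ≤ t)
    (hk : IntervalIntegrable k volume r t) (hk0 : ∀ w, 0 ≤ k w) (hK : 0 ≤ K)
    (hHx : ∀ x y, r ≤ x → x ≤ y → y ≤ t →
      IntervalIntegrable (fun w => Hx w y) volume x y ∧ H y y - H x y = ∫ w in x..y, Hx w y)
    (hHy : ∀ x y, r ≤ x → x ≤ y → y ≤ t →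
      IntervalIntegrable (Hy x) volume x y ∧ H x y - H x x = ∫ w in x..y, Hy x w)
    (hHx_le : ∀ x y, r ≤ x → x ≤ y → y ≤ t → |Hx x y - Hx x x| ≤ K * (∫ w in x..y, k w) * k x)
    (hHy_le : ∀ x y, r ≤ x → x ≤ y → y ≤ t → |Hy x y - Hy y y| ≤ K * (∫ w in x..y, k w) * k y)
    (hdiag : IntervalIntegrable (fun w => Hx w w + Hy w w) volume r t) :
    H t t - H r r = ∫ w in r..t, (Hx w w + Hy w w) := by
  set D : ℝ → ℝ := fun q => H q q - ∫ w in r..q, (Hx w w + Hy w w) with hD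
  have hconst : D t = D r := by
    refine eq_of_norm_sub_le_sq_integral (K := K + K) hrt hk fun x y hx hxy hy => ?_
    set Δ := ∫ w in x..y, k w
    have hsub : ∀ {u v}, x ≤ u → u ≤ v → v ≤ y → ∫ w in u..v, k w ≤ Δ := fun hu huv hv =>
      intervalIntegral.integral_mono_interval hu huv hv (.of_forall hk0)
        (intervalIntegrable_mono_Icc hk hx hxy hy)
    have hincr : D y - D x = ∫ w in x..y, (Hx w y + Hy x w - (Hx w w + Hy w w)) := by
      rw [intervalIntegral.integral_sub ((hHx x y hx hxy hy).1.add (hHy x y hx hxy hy).1)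
        (intervalIntegrable_mono_Icc hdiag hx hxy hy), intervalIntegral.integral_add
        (hHx x y hx hxy hy).1 (hHy x y hx hxy hy).1, ← (hHx x y hx hxy hy).2,
        ← (hHy x y hx hxy hy).2, ← integral_sub_integral_of_mem hdiag hx hxy hy]
      simp only [hD]
      ring
    have hsq : (K + K) * Δ ^ 2 = ∫ w in x..y, (K + K) * Δ * k w := by
      rw [intervalIntegral.integral_const_mul]
      ring
    rw [hincr, hsq]
    refine intervalIntegral.norm_integral_le_of_norm_le hxy (.of_forall fun w hw => ?_)
      ((intervalIntegrable_mono_Icc hk hx hxy hy).const_mul _)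
    have hxw := hw.1.le
    calc |Hx w y + Hy x w - (Hx w w + Hy w w)|
        ≤ |Hx w y - Hx w w| + |Hy x w - Hy w w| := by rw [add_sub_add_comm]; exact abs_add_le _ _
      _ ≤ K * Δ * k w + K * Δ * k w := by
        refine add_le_add ((hHx_le w y (hx.trans hxw) hw.2 hy).trans ?_)
          ((hHy_le x w hx hxw (hw.2.trans hy)).trans ?_) <;>
        refine mul_le_mul_of_nonneg_right (mul_le_mul_of_nonneg_left ?_ hK) (hk0 w)
        · exact hsub hxw hw.2 le_rfl
        · exact hsub le_rfl hxw hw.2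
      _ = (K + K) * Δ * k w := by ring
  simp only [hD, intervalIntegral.integral_same, sub_zero] at hconst
  linarith

lemma eq_mul_exp_of_integral_eq {Z k : ℝ → ℂ} {r t : ℝ} (hrt : r ≤ t)
    (hk : IntervalIntegrable k volume r t)
    (hkZ : IntervalIntegrable (fun w => k w * Z w) volume r t)
    (hZ : ∀ x, r ≤ x → x ≤ t → Z x = Z r + ∫ w in r..x, k w * Z w) :
    Z t = Z r * Complex.exp (∫ w in r..t, k w) := by
  set Z' : ℝ → ℂ := fun x => Z r + ∫ w in r..x, k w * Z w with hZ'
  set e : ℝ → ℂ := fun x => Complex.exp (-∫ w in r..x, k w) with he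
  have heAC : AbsolutelyContinuousOnInterval e r t :=
    absolutelyContinuousOnInterval_comp_of_contDiff
      (φ := fun z : ℂ => Complex.exp (-z)) (Complex.contDiff_exp.comp contDiff_neg)
      (absolutelyContinuousOnInterval_primitive hrt hk)
  have hZAC : AbsolutelyContinuousOnInterval Z' r t :=
    absolutelyContinuousOnInterval_of_dist_le (K := 1)
      (absolutelyContinuousOnInterval_primitive hrt hkZ) fun x _ y _ => by
        rw [hZ', dist_add_left, one_mul]
  have hderiv : ∀ᵐ x, x ∈ Set.uIcc r t → HasDerivAt (fun x => e x • Z' x) 0 x := by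
    filter_upwards [hk.ae_hasDerivAt_integral, hkZ.ae_hasDerivAt_integral] with x hkx hkZx hx
    have hxI := hx
    rw [Set.uIcc_of_le hrt] at hxI
    have hex : HasDerivAt e (e x * -k x) x := (hkx hx r Set.left_mem_uIcc).neg.cexp
    have hZx : HasDerivAt Z' (k x * Z' x) x := by
      simpa only [hZ', ← hZ x hxI.1 hxI.2] using (hkZx hx r Set.left_mem_uIcc).const_add (Z r)
    simp only [smul_eq_mul]
    exact (hex.mul hZx).congr_deriv (by ring)
  obtain ⟨c, hc⟩ := (heAC.smul hZAC).const_of_ae_hasDerivAt_zero hderiv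
  have hrt_eq : e t * Z' t = e r * Z' r :=
    (hc t Set.right_mem_uIcc).trans (hc r Set.left_mem_uIcc).symm
  simp only [he, hZ', ← hZ t hrt le_rfl, intervalIntegral.integral_same, neg_zero,
    Complex.exp_zero, one_mul, add_zero] at hrt_eq
  rw [← hrt_eq, mul_right_comm, ← Complex.exp_add, neg_add_cancel, Complex.exp_zero, one_mul]

end AbsoluteContinuity

/-! ### Weak solutions of the Fokker–Planck equation -/

/-- The test functions of the weak equation: smooth functions with compact support. -/
structure IsTest (f : ℝ → ℝ) : Prop where
  smooth : ContDiff ℝ (⊤ : ℕ∞) f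
  support : HasCompactSupport f

namespace IsTest

variable {f : ℝ → ℝ}

lemma deriv (hf : IsTest f) : IsTest (deriv f) :=
  ⟨(contDiff_infty_iff_deriv.1 hf.smooth).2, hf.support.deriv⟩

lemma hasDerivAt (hf : IsTest f) (x : ℝ) : HasDerivAt f (_root_.deriv f x) x :=
  (hf.smooth.differentiable (by simp) x).hasDerivAt

lemma continuous (hf : IsTest f) : Continuous f := hf.smooth.continuous

lemma id_mul (hf : IsTest f) : IsTest fun x => x * f x :=
  ⟨contDiff_id.mul hf.smooth, hf.support.mul_left⟩

lemma comp_mul (hf : IsTest f) {c : ℝ} (hc : c ≠ 0) : IsTest fun x => f (c * x) :=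
  ⟨hf.smooth.comp (contDiff_const.mul contDiff_id),
    hf.support.comp_homeomorph (Homeomorph.mulLeft₀ c hc)⟩

lemma bounded (hf : IsTest f) : ∃ B, ∀ x, |f x| ≤ B :=
  hf.continuous.bounded_above_of_compact_support hf.support

lemma integrable (hf : IsTest f) (μ : Measure ℝ) [IsFiniteMeasure μ] : Integrable f μ :=
  hf.continuous.integrable_of_hasCompactSupport hf.support

end IsTest

/-- The weak form of the Fokker–Planck equation on `[r, t]` with control `a`. -/
def SolvesFokkerPlanck (θ b : ℝ) (a : ℝ → ℝ) (ν : ℝ → ProbabilityMeasure ℝ) (r t : ℝ) : Prop :=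
  ∀ f, IsTest f → ∀ x y, r ≤ x → x ≤ y → y ≤ t →
    IntervalIntegrable (fun q => ∫ z, ouGenerator θ b (a q) f z ∂(ν q : Measure ℝ)) volume x y ∧
    ∫ z, f z ∂(ν y : Measure ℝ) = ∫ z, f z ∂(ν x : Measure ℝ) +
      ∫ q in x..y, ∫ z, ouGenerator θ b (a q) f z ∂(ν q : Measure ℝ)

lemma SolvesFokkerPlanck.congr {θ b r t : ℝ} {a a' : ℝ → ℝ} {ν ν' : ℝ → ProbabilityMeasure ℝ}
    (h : SolvesFokkerPlanck θ b a ν r t) (ha : Set.EqOn a a' (Set.Icc r t))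
    (hν : Set.EqOn ν ν' (Set.Icc r t)) : SolvesFokkerPlanck θ b a' ν' r t := by
  intro f hf x y hx hxy hy
  obtain ⟨hint, heq⟩ := h f hf x y hx hxy hy
  have hrate : Set.EqOn (fun q => ∫ z, ouGenerator θ b (a q) f z ∂(ν q : Measure ℝ))
      (fun q => ∫ z, ouGenerator θ b (a' q) f z ∂(ν' q : Measure ℝ)) (Set.uIcc x y) := by
    intro q hq
    rw [Set.uIcc_of_le hxy] at hq
    have hq' : q ∈ Set.Icc r t := ⟨hx.trans hq.1, hq.2.trans hy⟩
    simp only [ha hq', hν hq']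
  refine ⟨hint.congr fun q hq => hrate (Set.uIoc_subset_uIcc hq), ?_⟩
  rw [← hν ⟨hx.trans hxy, hy⟩, ← hν ⟨hx, hxy.trans hy⟩,
    ← intervalIntegral.integral_congr hrate, heq]

/-- The integral against `μ` of `c^k f(c x)` for `c = e^{θu}`: the drift `-θx` is removed from the
Fokker–Planck equation by passing to the coordinate `c x`, and `k` derivatives bring out `c^k`. -/
noncomputable def scaledIntegral (θ : ℝ) (k : ℕ) (f : ℝ → ℝ) (u : ℝ)
    (μ : ProbabilityMeasure ℝ) : ℝ :=
  Real.exp (θ * u) ^ k * ∫ x, f (Real.exp (θ * u) * x) ∂(μ : Measure ℝ)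

/-- What is left of the generator with control `α` in the coordinate `e^{θu} x`. -/
noncomputable def scaledRate (θ b : ℝ) (f : ℝ → ℝ) (α u : ℝ) (μ : ProbabilityMeasure ℝ) : ℝ :=
  α * scaledIntegral θ 1 (deriv f) u μ + b ^ 2 / 2 * scaledIntegral θ 2 (deriv (deriv f)) u μ

lemma abs_scaledIntegral_le {θ H B u : ℝ} (k : ℕ) {g : ℝ → ℝ} (hB : ∀ x, |g x| ≤ B)
    (μ : ProbabilityMeasure ℝ) (hu : 0 ≤ u) (huH : u ≤ H) :
    |scaledIntegral θ k g u μ| ≤ Real.exp (|θ| * H) ^ k * B := by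
  have hint : |∫ x, g (Real.exp (θ * u) * x) ∂(μ : Measure ℝ)| ≤ B := by
    simpa using norm_integral_le_of_norm_le_const (μ := (μ : Measure ℝ)) (C := B)
      (f := fun x => g (Real.exp (θ * u) * x)) (.of_forall fun x => hB _)
  have hexp : θ * u ≤ |θ| * H := mul_le_mul (le_abs_self θ) huH hu (abs_nonneg _)
  rw [scaledIntegral, abs_mul, abs_of_nonneg (by positivity)]
  gcongr

lemma abs_add_mul_add_le {p q s P Q S α : ℝ} (hp : |p| ≤ P) (hq : |q| ≤ Q) (hs : |s| ≤ S) :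
    |p + α * q + s| ≤ (P + Q + S) * (1 + |α|) := by
  have hP := (abs_nonneg p).trans hp
  have hQ := (abs_nonneg q).trans hq
  have hS := (abs_nonneg s).trans hs
  have hαq : |α * q| ≤ |α| * Q :=
    (abs_mul α q).trans_le (mul_le_mul_of_nonneg_left hq (abs_nonneg α))
  calc |p + α * q + s| ≤ |p| + |α * q| + |s| := abs_add_three _ _ _
    _ ≤ P + |α| * Q + S := add_le_add_three hp hαq hs
    _ ≤ (P + Q + S) * (1 + |α|) := by
        linarith [mul_nonneg hP (abs_nonneg α), mul_nonneg hS (abs_nonneg α)]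

lemma abs_scaledRate_le {θ b H B u : ℝ} {f : ℝ → ℝ} (h₁ : ∀ x, |deriv f x| ≤ B)
    (h₂ : ∀ x, |deriv (deriv f) x| ≤ B) (α : ℝ) (μ : ProbabilityMeasure ℝ) (hu : 0 ≤ u)
    (huH : u ≤ H) :
    |scaledRate θ b f α u μ| ≤
      (Real.exp (|θ| * H) ^ 1 * B + b ^ 2 / 2 * (Real.exp (|θ| * H) ^ 2 * B)) *
        (1 + |α|) := by
  have h2 : |b ^ 2 / 2 * scaledIntegral θ 2 (deriv (deriv f)) u μ| ≤
      b ^ 2 / 2 * (Real.exp (|θ| * H) ^ 2 * B) := by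
    rw [abs_mul, abs_of_nonneg (by positivity)]
    gcongr
    exact abs_scaledIntegral_le 2 h₂ μ hu huH
  simpa only [scaledRate, zero_add] using abs_add_mul_add_le (α := α) (abs_zero (α := ℝ)).le
    (abs_scaledIntegral_le 1 h₁ μ hu huH) h2

lemma scaledIntegral_zero (θ : ℝ) (f : ℝ → ℝ) (u : ℝ) (μ : ProbabilityMeasure ℝ) :
    scaledIntegral θ 0 f u μ = ∫ x, f (Real.exp (θ * u) * x) ∂(μ : Measure ℝ) := by
  rw [scaledIntegral, pow_zero, one_mul]

namespace IsTest

variable {f : ℝ → ℝ}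

lemma hasDerivAt_integral_comp_exp_mul (hf : IsTest f) (θ : ℝ) (μ : Measure ℝ) [IsFiniteMeasure μ]
    (u : ℝ) :
    HasDerivAt (fun u => ∫ x, f (Real.exp (θ * u) * x) ∂μ)
      (θ * ∫ x, Real.exp (θ * u) * x * _root_.deriv f (Real.exp (θ * u) * x) ∂μ) u := by
  obtain ⟨B, hB⟩ := hf.deriv.id_mul.bounded
  have htest : ∀ u, IsTest fun x => f (Real.exp (θ * u) * x) := fun u =>
    hf.comp_mul (Real.exp_ne_zero _)
  have hderiv : ∀ x u, HasDerivAt (fun u => f (Real.exp (θ * u) * x))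
      (θ * (Real.exp (θ * u) * x * _root_.deriv f (Real.exp (θ * u) * x))) u := fun x u =>
    ((hf.hasDerivAt _).comp u ((hasDerivAt_exp_const_mul θ u).mul_const x)).congr_deriv (by ring)
  rw [← integral_const_mul]
  refine (hasDerivAt_integral_of_dominated_loc_of_deriv_le (bound := fun _ => |θ| * B)
    univ_mem (.of_forall fun u => (htest u).continuous.aestronglyMeasurable)
    ((htest u).integrable μ) ?_ (.of_forall fun x u _ => ?_) (integrable_const _)
    (.of_forall fun x u _ => hderiv x u)).2
  · exact ((hf.deriv.id_mul.comp_mul (Real.exp_ne_zero (θ * u))).continuous.const_mul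
      θ).aestronglyMeasurable
  · rw [Real.norm_eq_abs, abs_mul]
    exact mul_le_mul_of_nonneg_left (hB _) (abs_nonneg θ)

lemma hasDerivAt_scaledIntegral (hf : IsTest f) (θ : ℝ) (k : ℕ) (μ : ProbabilityMeasure ℝ)
    (u : ℝ) :
    HasDerivAt (fun u => scaledIntegral θ k f u μ)
      (θ * (k * scaledIntegral θ k f u μ +
        scaledIntegral θ k (fun x => x * _root_.deriv f x) u μ)) u := by
  have hpow : HasDerivAt (fun u => Real.exp (θ * u) ^ k) (θ * (k * Real.exp (θ * u) ^ k)) u := by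
    refine ((hasDerivAt_exp_const_mul θ u).pow k).congr_deriv ?_
    rcases k with _ | k
    · simp
    · simp only [Nat.add_sub_cancel]; ring
  refine (hpow.mul (hf.hasDerivAt_integral_comp_exp_mul θ μ u)).congr_deriv ?_
  simp only [scaledIntegral]
  ring

lemma continuous_scaledIntegral (hf : IsTest f) (θ : ℝ) (k : ℕ) (μ : ProbabilityMeasure ℝ) :
    Continuous fun u => scaledIntegral θ k f u μ :=
  continuous_iff_continuousAt.2 fun u => (hf.hasDerivAt_scaledIntegral θ k μ u).continuousAt

lemma scaledIntegral_lipschitz (hf : IsTest f) (θ : ℝ) (k : ℕ) (H : ℝ) :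
    ∃ K, 0 ≤ K ∧ ∀ u v μ, 0 ≤ u → u ≤ v → v ≤ H →
      |scaledIntegral θ k f v μ - scaledIntegral θ k f u μ| ≤ K * (v - u) := by
  obtain ⟨B, hB⟩ := hf.bounded
  obtain ⟨B', hB'⟩ := hf.deriv.id_mul.bounded
  have hB0 : 0 ≤ B := (abs_nonneg _).trans (hB 0)
  have hB'0 : 0 ≤ B' := (abs_nonneg _).trans (hB' 0)
  set Γ := Real.exp (|θ| * H) ^ k
  refine ⟨|θ| * (k * (Γ * B) + Γ * B'), by positivity, fun u v μ hu huv hv => ?_⟩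
  have hbound : ∀ w ∈ Set.Icc u v, ‖θ * (k * scaledIntegral θ k f w μ +
      scaledIntegral θ k (fun x => x * _root_.deriv f x) w μ)‖ ≤
      |θ| * (k * (Γ * B) + Γ * B') := fun w hw => by
    rw [Real.norm_eq_abs, abs_mul]
    gcongr
    refine (abs_add_le _ _).trans (add_le_add ?_ ?_)
    · rw [abs_mul, Nat.abs_cast]
      gcongr
      exact abs_scaledIntegral_le k hB μ (hu.trans hw.1) (hw.2.trans hv)
    · exact abs_scaledIntegral_le k hB' μ (hu.trans hw.1) (hw.2.trans hv)
  simpa only [Real.norm_eq_abs, abs_of_nonneg (sub_nonneg.2 huv)] using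
    (convex_Icc u v).norm_image_sub_le_of_norm_hasDerivWithin_le
      (fun w _ => (hf.hasDerivAt_scaledIntegral θ k μ w).hasDerivWithinAt) hbound
      (Set.left_mem_Icc.2 huv) (Set.right_mem_Icc.2 huv)

lemma integral_ouGenerator_comp_exp_mul (hf : IsTest f) (θ b α u : ℝ)
    (μ : ProbabilityMeasure ℝ) :
    ∫ x, ouGenerator θ b α (fun x => f (Real.exp (θ * u) * x)) x ∂(μ : Measure ℝ) =
      scaledRate θ b f α u μ - θ * scaledIntegral θ 0 (fun x => x * _root_.deriv f x) u μ := by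
  set c := Real.exp (θ * u) with hc
  have hderiv : ∀ g : ℝ → ℝ, _root_.deriv (fun x => g (c * x)) =
      fun x => c * _root_.deriv g (c * x) := fun g => by
    ext x; simpa using deriv_comp_mul_left c g x
  have hgen : ∀ x, ouGenerator θ b α (fun x => f (c * x)) x =
      α * c * _root_.deriv f (c * x) +
        b ^ 2 / 2 * c ^ 2 * _root_.deriv (_root_.deriv f) (c * x) -
        θ * (c * x * _root_.deriv f (c * x)) := fun x => by
    simp only [ouGenerator, hderiv, deriv_const_mul_field]
    ring
  have hint : ∀ {g : ℝ → ℝ}, IsTest g → ∀ κ : ℝ,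
      Integrable (fun x => κ * g (c * x)) (μ : Measure ℝ) := fun hg κ =>
    ((hg.comp_mul (Real.exp_ne_zero _)).integrable _).const_mul κ
  have hdrift := hint hf.deriv (α * c)
  have hdiff := hint hf.deriv.deriv (b ^ 2 / 2 * c ^ 2)
  simp_rw [hgen]
  rw [integral_sub (hdrift.fun_add hdiff) (hint hf.deriv.id_mul θ), integral_add hdrift hdiff]
  simp only [integral_const_mul, scaledRate, scaledIntegral, ← hc]
  ring

end IsTest

lemma tendsto_scaledIntegral {θ B u : ℝ} (k : ℕ) {g : ℕ → ℝ → ℝ} {g₀ : ℝ → ℝ}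
    (hg : ∀ n, Continuous (g n)) (hB : ∀ n x, |g n x| ≤ B)
    (hlim : ∀ x, Tendsto (fun n => g n x) atTop (𝓝 (g₀ x))) (μ : ProbabilityMeasure ℝ) :
    Tendsto (fun n => scaledIntegral θ k (g n) u μ) atTop (𝓝 (scaledIntegral θ k g₀ u μ)) :=
  (tendsto_integral_of_dominated_convergence (fun _ => B)
    (fun n => ((hg n).comp (continuous_const_mul _)).aestronglyMeasurable) (integrable_const _)
    (fun n => .of_forall fun _ => hB n _) (.of_forall fun _ => hlim _)).const_mul _

lemma intervalIntegrable_one_add_abs {a : ℝ → ℝ} {r t : ℝ} (ha : IntervalIntegrable a volume r t) :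
    IntervalIntegrable (fun w => 1 + |a w|) volume r t :=
  intervalIntegrable_const.add ha.norm

lemma sub_le_integral_one_add_abs {a : ℝ → ℝ} {x y : ℝ} (ha : IntervalIntegrable a volume x y)
    (hxy : x ≤ y) : y - x ≤ ∫ w in x..y, (1 + |a w|) := by
  simpa using intervalIntegral.integral_mono_on hxy intervalIntegrable_const
    (intervalIntegrable_one_add_abs ha) fun w _ => le_add_of_nonneg_right (abs_nonneg (a w))

namespace SolvesFokkerPlanck

variable {θ b r t : ℝ} {a : ℝ → ℝ} {ν : ℝ → ProbabilityMeasure ℝ} {f : ℝ → ℝ}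

lemma mono (h : SolvesFokkerPlanck θ b a ν r t) {q : ℝ} (hq : q ≤ t) :
    SolvesFokkerPlanck θ b a ν r q :=
  fun f hf x y hx hxy hy => h f hf x y hx hxy (hy.trans hq)

lemma scaledIntegral_sub (h : SolvesFokkerPlanck θ b a ν r t) (hf : IsTest f) (u : ℝ) {x y : ℝ}
    (hx : r ≤ x) (hxy : x ≤ y) (hy : y ≤ t) :
    IntervalIntegrable (fun w => scaledRate θ b f (a w) u (ν w) -
      θ * scaledIntegral θ 0 (fun x => x * deriv f x) u (ν w)) volume x y ∧
    scaledIntegral θ 0 f u (ν y) - scaledIntegral θ 0 f u (ν x) =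
      ∫ w in x..y, (scaledRate θ b f (a w) u (ν w) -
        θ * scaledIntegral θ 0 (fun x => x * deriv f x) u (ν w)) := by
  have hweak := h _ (hf.comp_mul (Real.exp_ne_zero (θ * u))) x y hx hxy hy
  simp only [hf.integral_ouGenerator_comp_exp_mul] at hweak
  exact ⟨hweak.1, by rw [scaledIntegral_zero, scaledIntegral_zero, hweak.2, add_sub_cancel_left]⟩

lemma exists_scaledIntegral_sub_le (h : SolvesFokkerPlanck θ b a ν r t)
    (ha : IntervalIntegrable a volume r t) (hf : IsTest f) (k : ℕ) (H : ℝ) :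
    ∃ K, 0 ≤ K ∧ ∀ u x y, 0 ≤ u → u ≤ H → r ≤ x → x ≤ y → y ≤ t →
      |scaledIntegral θ k f u (ν y) - scaledIntegral θ k f u (ν x)| ≤
        K * ∫ w in x..y, (1 + |a w|) := by
  obtain ⟨B₁, hB₁⟩ := hf.deriv.bounded
  obtain ⟨B₂, hB₂⟩ := hf.deriv.deriv.bounded
  obtain ⟨B₃, hB₃⟩ := hf.deriv.id_mul.bounded
  have hB₁0 := (abs_nonneg _).trans (hB₁ 0)
  have hB₂0 := (abs_nonneg _).trans (hB₂ 0)
  have hB₃0 := (abs_nonneg _).trans (hB₃ 0)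
  set Γ := Real.exp (|θ| * H)
  set L := |θ| * (Γ ^ 0 * B₃) + Γ ^ 1 * B₁ + b ^ 2 / 2 * (Γ ^ 2 * B₂)
  refine ⟨Γ ^ k * L, by positivity, fun u x y hu huH hx hxy hy => ?_⟩
  have hfactor : ∀ μ, scaledIntegral θ k f u μ = Real.exp (θ * u) ^ k * scaledIntegral θ 0 f u μ :=
    fun μ => by rw [scaledIntegral_zero, scaledIntegral]
  have hrate : ∀ w, ‖scaledRate θ b f (a w) u (ν w) -
      θ * scaledIntegral θ 0 (fun x => x * deriv f x) u (ν w)‖ ≤ L * (1 + |a w|) := fun w => by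
    have hdrift : |-θ * scaledIntegral θ 0 (fun x => x * deriv f x) u (ν w)| ≤
        |θ| * (Γ ^ 0 * B₃) := by
      rw [abs_mul, abs_neg]
      exact mul_le_mul_of_nonneg_left (abs_scaledIntegral_le 0 hB₃ _ hu huH) (abs_nonneg θ)
    have hdiffusion : |b ^ 2 / 2 * scaledIntegral θ 2 (deriv (deriv f)) u (ν w)| ≤
        b ^ 2 / 2 * (Γ ^ 2 * B₂) := by
      rw [abs_mul, abs_of_nonneg (by positivity)]
      exact mul_le_mul_of_nonneg_left (abs_scaledIntegral_le 2 hB₂ _ hu huH) (by positivity)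
    convert abs_add_mul_add_le (α := a w) hdrift (abs_scaledIntegral_le 1 hB₁ (ν w) hu huH)
      hdiffusion using 1
    rw [Real.norm_eq_abs, scaledRate]
    ring_nf
  have hexp : θ * u ≤ |θ| * H := mul_le_mul (le_abs_self θ) huH hu (abs_nonneg _)
  rw [hfactor, hfactor, ← mul_sub, abs_mul, abs_of_nonneg (by positivity), mul_assoc,
    (h.scaledIntegral_sub hf u hx hxy hy).2, ← intervalIntegral.integral_const_mul]
  refine mul_le_mul (pow_le_pow_left₀ (Real.exp_pos _).le (Real.exp_le_exp.2 hexp) k) ?_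
    (abs_nonneg _) (by positivity)
  exact intervalIntegral.norm_integral_le_of_norm_le hxy (.of_forall fun w _ => hrate w)
    ((intervalIntegrable_one_add_abs (intervalIntegrable_mono_Icc ha hx hxy hy)).const_mul L)

lemma continuousOn_scaledIntegral (h : SolvesFokkerPlanck θ b a ν r t) (hrt : r ≤ t)
    (ha : IntervalIntegrable a volume r t) (hf : IsTest f) (k : ℕ) :
    ContinuousOn (fun w => scaledIntegral θ k f (w - r) (ν w)) (Set.uIcc r t) := by
  obtain ⟨K, -, hspace⟩ := h.exists_scaledIntegral_sub_le ha hf k (t - r)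
  obtain ⟨L, hL, htime⟩ := hf.scaledIntegral_lipschitz θ k (t - r)
  refine (absolutelyContinuousOnInterval_of_norm_sub_le_integral (K := L + K) hrt
    (intervalIntegrable_one_add_abs ha) fun x y hx hxy hy => ?_).continuousOn
  have hclock := sub_le_integral_one_add_abs (intervalIntegrable_mono_Icc ha hx hxy hy) hxy
  calc |scaledIntegral θ k f (y - r) (ν y) - scaledIntegral θ k f (x - r) (ν x)|
      ≤ |scaledIntegral θ k f (y - r) (ν y) - scaledIntegral θ k f (x - r) (ν y)| +
        |scaledIntegral θ k f (x - r) (ν y) - scaledIntegral θ k f (x - r) (ν x)| :=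
        abs_sub_le _ _ _
    _ ≤ L * (y - r - (x - r)) + K * ∫ w in x..y, (1 + |a w|) := add_le_add
        (htime _ _ _ (by linarith) (by linarith) (by linarith))
        (hspace _ _ _ (by linarith) (by linarith) hx hxy hy)
    _ ≤ (L + K) * ∫ w in x..y, (1 + |a w|) := by
        rw [sub_sub_sub_cancel_right, add_mul]
        gcongr

lemma intervalIntegrable_scaledRate (h : SolvesFokkerPlanck θ b a ν r t) (hrt : r ≤ t)
    (ha : IntervalIntegrable a volume r t) (hf : IsTest f) :
    IntervalIntegrable (fun w => scaledRate θ b f (a w) (w - r) (ν w)) volume r t :=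
  (ha.mul_continuousOn (h.continuousOn_scaledIntegral hrt ha hf.deriv 1)).add
    ((h.continuousOn_scaledIntegral hrt ha hf.deriv.deriv 2).const_mul _).intervalIntegrable

lemma exists_scaledRate_sub_le (hf : IsTest f) (θ b H : ℝ) :
    ∃ L, 0 ≤ L ∧ ∀ α u v μ, 0 ≤ u → u ≤ v → v ≤ H →
      |(scaledRate θ b f α u μ - θ * scaledIntegral θ 0 (fun x => x * deriv f x) u μ) -
        (scaledRate θ b f α v μ - θ * scaledIntegral θ 0 (fun x => x * deriv f x) v μ)| ≤
        L * (v - u) * (1 + |α|) := by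
  obtain ⟨K₀, hK₀, hlip₀⟩ := hf.deriv.id_mul.scaledIntegral_lipschitz θ 0 H
  obtain ⟨K₁, hK₁, hlip₁⟩ := hf.deriv.scaledIntegral_lipschitz θ 1 H
  obtain ⟨K₂, hK₂, hlip₂⟩ := hf.deriv.deriv.scaledIntegral_lipschitz θ 2 H
  refine ⟨|θ| * K₀ + K₁ + b ^ 2 / 2 * K₂, by positivity, fun α u v μ hu huv hv => ?_⟩
  have hdrift : |θ * (scaledIntegral θ 0 (fun x => x * deriv f x) v μ -
      scaledIntegral θ 0 (fun x => x * deriv f x) u μ)| ≤ |θ| * (K₀ * (v - u)) := by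
    rw [abs_mul]
    exact mul_le_mul_of_nonneg_left (hlip₀ u v μ hu huv hv) (abs_nonneg θ)
  have hdiffusion : |b ^ 2 / 2 * (scaledIntegral θ 2 (deriv (deriv f)) u μ -
      scaledIntegral θ 2 (deriv (deriv f)) v μ)| ≤ b ^ 2 / 2 * (K₂ * (v - u)) := by
    rw [abs_mul, abs_of_nonneg (by positivity), abs_sub_comm]
    exact mul_le_mul_of_nonneg_left (hlip₂ u v μ hu huv hv) (by positivity)
  convert abs_add_mul_add_le (α := α) hdrift ((abs_sub_comm _ _).trans_le (hlip₁ u v μ hu huv hv))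
    hdiffusion using 1
  · simp only [scaledRate]
    ring_nf
  · ring

lemma scaled_equation (h : SolvesFokkerPlanck θ b a ν r t) (hrt : r ≤ t)
    (ha : IntervalIntegrable a volume r t) (hf : IsTest f) :
    scaledIntegral θ 0 f (t - r) (ν t) - scaledIntegral θ 0 f 0 (ν r) =
      ∫ w in r..t, scaledRate θ b f (a w) (w - r) (ν w) := by
  obtain ⟨K, hK, hspace⟩ := h.exists_scaledIntegral_sub_le ha hf.deriv.id_mul 0 (t - r)
  obtain ⟨L, hL, htime⟩ := exists_scaledRate_sub_le hf θ b (t - r)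
  set E := fun u μ => θ * scaledIntegral θ 0 (fun x => x * deriv f x) u μ with hE
  have hderiv : ∀ μ w, HasDerivAt (fun w => scaledIntegral θ 0 f (w - r) μ) (E (w - r) μ) w :=
    fun μ w => ((hf.hasDerivAt_scaledIntegral θ 0 μ (w - r)).comp_sub_const w r).congr_deriv
      (by simp [hE])
  have hEc : ∀ μ, Continuous fun w => E (w - r) μ := fun μ =>
    ((hf.deriv.id_mul.continuous_scaledIntegral θ 0 μ).comp (continuous_sub_right r)).const_mul θ
  have hclock : ∀ x y, r ≤ x → x ≤ y → y ≤ t → y - x ≤ ∫ w in x..y, (1 + |a w|) :=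
    fun x y hx hxy hy =>
      sub_le_integral_one_add_abs (intervalIntegrable_mono_Icc ha hx hxy hy) hxy
  have hdiag := sub_eq_integral_diag (H := fun x y => scaledIntegral θ 0 f (x - r) (ν y))
    (Hx := fun w y => E (w - r) (ν y))
    (Hy := fun x w => scaledRate θ b f (a w) (x - r) (ν w) - E (x - r) (ν w))
    (K := |θ| * K + L) hrt (intervalIntegrable_one_add_abs ha) (fun w => by positivity)
    (by positivity)
    (fun x y _ _ _ => ⟨(hEc _).intervalIntegrable _ _,
      (intervalIntegral.integral_eq_sub_of_hasDerivAt (fun w _ => hderiv _ w)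
        ((hEc _).intervalIntegrable _ _)).symm⟩)
    (fun x y hx hxy hy => h.scaledIntegral_sub hf (x - r) hx hxy hy) ?_ ?_ ?_
  · simpa using hdiag
  · intro x y hx hxy hy
    have hclock0 := (sub_nonneg.2 hxy).trans (hclock x y hx hxy hy)
    calc |E (x - r) (ν y) - E (x - r) (ν x)|
        ≤ |θ| * (K * ∫ w in x..y, (1 + |a w|)) * 1 := by
          rw [hE, ← mul_sub, abs_mul, mul_one]
          exact mul_le_mul_of_nonneg_left (hspace _ _ _ (by linarith) (by linarith) hx hxy hy)
            (abs_nonneg θ)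
      _ ≤ (|θ| * K + L) * (∫ w in x..y, (1 + |a w|)) * (1 + |a x|) := by
          rw [← mul_assoc]
          gcongr <;> linarith [abs_nonneg (a x)]
  · intro x y hx hxy hy
    refine (htime (a y) (x - r) (y - r) (ν y) (by linarith) (by linarith) (by linarith)).trans ?_
    rw [sub_sub_sub_cancel_right]
    gcongr
    · exact le_add_of_nonneg_left (by positivity)
    · exact hclock x y hx hxy hy
  · simpa using h.intervalIntegrable_scaledRate hrt ha hf

end SolvesFokkerPlanck

section Cutoff

variable {χ f : ℝ → ℝ} {A₀ A₁ A₂ B c : ℝ}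

lemma deriv_cutoff (hχ : IsTest χ) (hf : ContDiff ℝ (⊤ : ℕ∞) f) (c : ℝ) :
    deriv (fun x => χ (c * x) * f x) =
      fun x => c * deriv χ (c * x) * f x + χ (c * x) * deriv f x := by
  ext x
  have hχc : HasDerivAt (fun x => χ (c * x)) (deriv χ (c * x) * (c * 1)) x :=
    (hχ.hasDerivAt _).comp x ((hasDerivAt_id x).const_mul c)
  rw [(hχc.fun_mul (hf.differentiable (by simp) x).hasDerivAt).deriv]
  ring

lemma deriv_deriv_cutoff (hχ : IsTest χ) (hf : ContDiff ℝ (⊤ : ℕ∞) f) (c : ℝ) :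
    deriv (deriv fun x => χ (c * x) * f x) =
      fun x => c * (c * deriv (deriv χ) (c * x)) * f x +
        2 * (c * deriv χ (c * x) * deriv f x) + χ (c * x) * deriv (deriv f) x := by
  have hf' : ContDiff ℝ (⊤ : ℕ∞) (deriv f) := (contDiff_infty_iff_deriv.1 hf).2
  have hterm : ∀ {g h : ℝ → ℝ}, IsTest g → ContDiff ℝ (⊤ : ℕ∞) h →
      Differentiable ℝ fun x => g (c * x) * h x := fun hg hh =>
    ((hg.smooth.comp (contDiff_const.mul contDiff_id)).mul hh).differentiable (by simp)
  ext x
  simp only [deriv_cutoff hχ hf, mul_assoc c]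
  rw [deriv_fun_add ((hterm hχ.deriv hf x).const_mul c) (hterm hχ hf' x), deriv_const_mul_field,
    deriv_cutoff hχ.deriv hf, deriv_cutoff hχ hf']
  ring

lemma abs_cutoff_le (h₀ : ∀ x, |χ x| ≤ A₀) (hf₀ : ∀ x, |f x| ≤ B) (x : ℝ) :
    |χ (c * x) * f x| ≤ A₀ * B := by
  rw [abs_mul]
  exact mul_le_mul (h₀ _) (hf₀ x) (abs_nonneg _) ((abs_nonneg _).trans (h₀ 0))

lemma abs_deriv_cutoff_le (hχ : IsTest χ) (hf : ContDiff ℝ (⊤ : ℕ∞) f) (hc : |c| ≤ 1)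
    (h₀ : ∀ x, |χ x| ≤ A₀) (h₁ : ∀ x, |deriv χ x| ≤ A₁)
    (hf₀ : ∀ x, |f x| ≤ B) (hf₁ : ∀ x, |deriv f x| ≤ B) (x : ℝ) :
    |deriv (fun x => χ (c * x) * f x) x| ≤ (A₀ + A₁) * B := by
  have hA₁B : |c * deriv χ (c * x) * f x| ≤ A₁ * B := by
    rw [mul_assoc, abs_mul]
    exact (mul_le_of_le_one_left (abs_nonneg _) hc).trans (abs_cutoff_le h₁ hf₀ x)
  rw [deriv_cutoff hχ hf]
  linarith [abs_add_le (c * deriv χ (c * x) * f x) (χ (c * x) * deriv f x),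
    abs_cutoff_le (c := c) h₀ hf₁ x]

lemma abs_deriv_deriv_cutoff_le (hχ : IsTest χ) (hf : ContDiff ℝ (⊤ : ℕ∞) f) (hc : |c| ≤ 1)
    (h₀ : ∀ x, |χ x| ≤ A₀) (h₁ : ∀ x, |deriv χ x| ≤ A₁) (h₂ : ∀ x, |deriv (deriv χ) x| ≤ A₂)
    (hf₀ : ∀ x, |f x| ≤ B) (hf₁ : ∀ x, |deriv f x| ≤ B) (hf₂ : ∀ x, |deriv (deriv f) x| ≤ B)
    (x : ℝ) :
    |deriv (deriv fun x => χ (c * x) * f x) x| ≤ (A₀ + 2 * A₁ + A₂) * B := by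
  have hA₁B : |c * deriv χ (c * x) * deriv f x| ≤ A₁ * B := by
    rw [mul_assoc, abs_mul]
    exact (mul_le_of_le_one_left (abs_nonneg _) hc).trans (abs_cutoff_le h₁ hf₁ x)
  have hA₂B : |c * (c * deriv (deriv χ) (c * x)) * f x| ≤ A₂ * B := by
    rw [← mul_assoc, mul_assoc, abs_mul, abs_mul]
    exact (mul_le_of_le_one_left (abs_nonneg _) (mul_le_one₀ hc (abs_nonneg _) hc)).trans
      (abs_cutoff_le h₂ hf₀ x)
  rw [deriv_deriv_cutoff hχ hf]
  refine (abs_add_three _ _ _).trans ?_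
  rw [abs_mul 2, abs_two]
  linarith [abs_cutoff_le (c := c) h₀ hf₂ x]

lemma eventually_cutoff_eventuallyEq (χ : ContDiffBump (0 : ℝ)) (f : ℝ → ℝ) (x : ℝ) :
    ∀ᶠ n : ℕ in atTop, (fun x => χ (1 / ((n : ℝ) + 1) * x) * f x) =ᶠ[𝓝 x] f := by
  have hscale : Tendsto (fun p : ℕ × ℝ => 1 / ((p.1 : ℝ) + 1) * p.2) (atTop ×ˢ 𝓝 x) (𝓝 0) := by
    simpa using (tendsto_one_div_add_atTop_nhds_zero_nat.comp tendsto_fst).mul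
      (tendsto_snd (f := (atTop : Filter ℕ)) (g := 𝓝 x))
  exact (hscale.eventually χ.eventuallyEq_one).curry.mono fun n hn =>
    hn.mono fun y hy => by simp only [hy, Pi.one_apply, one_mul]

lemma exists_isTest_seq (hf : ContDiff ℝ (⊤ : ℕ∞) f)
    (hf₀ : ∀ x, |f x| ≤ B) (hf₁ : ∀ x, |deriv f x| ≤ B) (hf₂ : ∀ x, |deriv (deriv f) x| ≤ B) :
    ∃ (g : ℕ → ℝ → ℝ) (B' : ℝ), (∀ n, IsTest (g n)) ∧
      (∀ n x, |g n x| ≤ B' ∧ |deriv (g n) x| ≤ B' ∧ |deriv (deriv (g n)) x| ≤ B') ∧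
      (∀ x, Tendsto (fun n => g n x) atTop (𝓝 (f x)) ∧
        Tendsto (fun n => deriv (g n) x) atTop (𝓝 (deriv f x)) ∧
        Tendsto (fun n => deriv (deriv (g n)) x) atTop (𝓝 (deriv (deriv f) x))) := by
  let χ : ContDiffBump (0 : ℝ) := ⟨1, 2, one_pos, one_lt_two⟩
  have hχ : IsTest χ := ⟨χ.contDiff, χ.hasCompactSupport⟩
  obtain ⟨A₀, h₀⟩ := hχ.bounded
  obtain ⟨A₁, h₁⟩ := hχ.deriv.bounded
  obtain ⟨A₂, h₂⟩ := hχ.deriv.deriv.bounded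
  have hB0 := (abs_nonneg _).trans (hf₀ 0)
  have hA₁ := (abs_nonneg _).trans (h₁ 0)
  have hA₂ := (abs_nonneg _).trans (h₂ 0)
  have hc : ∀ n : ℕ, |1 / ((n : ℝ) + 1)| ≤ 1 := fun n => by
    rw [abs_of_pos (by positivity)]
    exact div_le_one_of_le₀ (by linarith [n.cast_nonneg (α := ℝ)]) (by positivity)
  refine ⟨fun n x => χ (1 / ((n : ℝ) + 1) * x) * f x, (A₀ + 2 * A₁ + A₂) * B, fun n => ?_,
    fun n x => ⟨(abs_cutoff_le h₀ hf₀ x).trans ?_,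
      (abs_deriv_cutoff_le hχ hf (hc n) h₀ h₁ hf₀ hf₁ x).trans ?_,
      abs_deriv_deriv_cutoff_le hχ hf (hc n) h₀ h₁ h₂ hf₀ hf₁ hf₂ x⟩, fun x => ?_⟩
  · have htest := hχ.comp_mul (c := 1 / ((n : ℝ) + 1)) (by positivity)
    exact ⟨htest.smooth.mul hf, htest.support.mul_right⟩
  · exact mul_le_mul_of_nonneg_right (by linarith) hB0
  · exact mul_le_mul_of_nonneg_right (by linarith) hB0
  · have heq := eventually_cutoff_eventuallyEq χ f x
    exact ⟨tendsto_const_nhds.congr' (heq.mono fun n hn => hn.eq_of_nhds.symm),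
      tendsto_const_nhds.congr' (heq.mono fun n hn => hn.deriv_eq.symm),
      tendsto_const_nhds.congr' (heq.mono fun n hn => hn.deriv.deriv_eq.symm)⟩

end Cutoff

section CharFun

variable {θ b r t : ℝ} {a : ℝ → ℝ} {ν : ℝ → ProbabilityMeasure ℝ}

lemma SolvesFokkerPlanck.scaled_equation_of_bounded {f : ℝ → ℝ} {B : ℝ}
    (h : SolvesFokkerPlanck θ b a ν r t) (hrt : r ≤ t) (ha : IntervalIntegrable a volume r t)
    (hf : ContDiff ℝ (⊤ : ℕ∞) f) (hf₀ : ∀ x, |f x| ≤ B) (hf₁ : ∀ x, |deriv f x| ≤ B)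
    (hf₂ : ∀ x, |deriv (deriv f) x| ≤ B) :
    IntervalIntegrable (fun w => scaledRate θ b f (a w) (w - r) (ν w)) volume r t ∧
      scaledIntegral θ 0 f (t - r) (ν t) - scaledIntegral θ 0 f 0 (ν r) =
        ∫ w in r..t, scaledRate θ b f (a w) (w - r) (ν w) := by
  obtain ⟨g, B', hg, hB, hlim⟩ := exists_isTest_seq hf hf₀ hf₁ hf₂
  set L := Real.exp (|θ| * (t - r)) ^ 1 * B' + b ^ 2 / 2 * (Real.exp (|θ| * (t - r)) ^ 2 * B')
  have hdom : IntervalIntegrable (fun w => L * (1 + |a w|)) volume r t :=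
    (intervalIntegrable_one_add_abs ha).const_mul L
  have hbound : ∀ n, ∀ w ∈ Set.uIoc r t,
      ‖scaledRate θ b (g n) (a w) (w - r) (ν w)‖ ≤ L * (1 + |a w|) := fun n w hw => by
    rw [Set.uIoc_of_le hrt] at hw
    exact abs_scaledRate_le (fun x => (hB n x).2.1) (fun x => (hB n x).2.2) _ _
      (sub_nonneg.2 hw.1.le) (sub_le_sub_right hw.2 r)
  have hrate : ∀ w, Tendsto (fun n => scaledRate θ b (g n) (a w) (w - r) (ν w)) atTop
      (𝓝 (scaledRate θ b f (a w) (w - r) (ν w))) := fun w =>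
    ((tendsto_scaledIntegral 1 (fun n => (hg n).deriv.continuous) (fun n x => (hB n x).2.1)
      (fun x => (hlim x).2.1) (ν w)).const_mul _).add
    ((tendsto_scaledIntegral 2 (fun n => (hg n).deriv.deriv.continuous)
      (fun n x => (hB n x).2.2) (fun x => (hlim x).2.2) (ν w)).const_mul _)
  have hvalue : ∀ u μ, Tendsto (fun n => scaledIntegral θ 0 (g n) u μ) atTop
      (𝓝 (scaledIntegral θ 0 f u μ)) := fun u μ =>
    tendsto_scaledIntegral 0 (fun n => (hg n).continuous) (fun n x => (hB n x).1)
      (fun x => (hlim x).1) μ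
  have hmeas : ∀ n, AEStronglyMeasurable (fun w => scaledRate θ b (g n) (a w) (w - r) (ν w))
      (volume.restrict (Set.uIoc r t)) := fun n =>
    (h.intervalIntegrable_scaledRate hrt ha (hg n)).def'.aestronglyMeasurable
  refine ⟨hdom.mono_fun' (aestronglyMeasurable_of_tendsto_ae atTop hmeas (.of_forall hrate)) ?_,
    tendsto_nhds_unique ((hvalue _ _).sub (hvalue _ _)) ?_⟩
  · filter_upwards [ae_restrict_mem measurableSet_uIoc] with w hw
    exact le_of_tendsto (hrate w).norm (.of_forall fun n => hbound n w hw)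
  · refine (intervalIntegral.tendsto_integral_filter_of_dominated_convergence _
      (.of_forall hmeas) (.of_forall fun n => .of_forall (hbound n)) hdom
      (.of_forall fun w _ => hrate w)).congr fun n => (h.scaled_equation hrt ha (hg n)).symm

lemma deriv_cos_const_mul (ξ : ℝ) :
    deriv (fun x => Real.cos (ξ * x)) = fun x => -ξ * Real.sin (ξ * x) := by
  ext x
  simpa using deriv_comp_mul_left ξ Real.cos x

lemma deriv_sin_const_mul (ξ : ℝ) :
    deriv (fun x => Real.sin (ξ * x)) = fun x => ξ * Real.cos (ξ * x) := by
  ext x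
  simpa using deriv_comp_mul_left ξ Real.sin x

lemma deriv_deriv_cos_const_mul (ξ : ℝ) :
    deriv (deriv fun x => Real.cos (ξ * x)) = fun x => -ξ ^ 2 * Real.cos (ξ * x) := by
  ext x
  rw [deriv_cos_const_mul, deriv_const_mul_field, deriv_sin_const_mul]
  ring

lemma deriv_deriv_sin_const_mul (ξ : ℝ) :
    deriv (deriv fun x => Real.sin (ξ * x)) = fun x => -ξ ^ 2 * Real.sin (ξ * x) := by
  ext x
  rw [deriv_sin_const_mul, deriv_const_mul_field, deriv_cos_const_mul]
  ring

lemma scaledIntegral_const_mul (θ κ u : ℝ) (k : ℕ) (g : ℝ → ℝ) (μ : ProbabilityMeasure ℝ) :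
    scaledIntegral θ k (fun x => κ * g x) u μ =
      κ * (Real.exp (θ * u) ^ k * scaledIntegral θ 0 g u μ) := by
  rw [scaledIntegral_zero, scaledIntegral, integral_const_mul]
  ring

lemma charFun_mul_exp (μ : ProbabilityMeasure ℝ) (θ ξ u : ℝ) :
    charFun (μ : Measure ℝ) (ξ * Real.exp (θ * u)) =
      (scaledIntegral θ 0 (fun x => Real.cos (ξ * x)) u μ : ℂ) +
        Complex.I * scaledIntegral θ 0 (fun x => Real.sin (ξ * x)) u μ := by
  set e := Real.exp (θ * u) with he
  have heuler : ∀ x : ℝ, Complex.exp ((ξ * e : ℝ) * x * Complex.I) =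
      (Real.cos (ξ * (e * x)) : ℂ) + Complex.I * (Real.sin (ξ * (e * x)) : ℂ) := fun x => by
    rw [Complex.exp_mul_I]
    push_cast
    rw [mul_assoc (ξ : ℂ), mul_comm Complex.I]
  have hcos : Integrable (fun x => Real.cos (ξ * (e * x))) (μ : Measure ℝ) :=
    .of_bound (by fun_prop) 1 (.of_forall fun _ => Real.abs_cos_le_one _)
  have hsin : Integrable (fun x => Real.sin (ξ * (e * x))) (μ : Measure ℝ) :=
    .of_bound (by fun_prop) 1 (.of_forall fun _ => Real.abs_sin_le_one _)
  simp_rw [charFun_apply_real, heuler]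
  rw [integral_add hcos.ofReal (hsin.ofReal.const_mul _), integral_const_mul,
    integral_complex_ofReal, integral_complex_ofReal, scaledIntegral_zero, scaledIntegral_zero,
    ← he]

lemma scaledRate_cos_add_I_mul_scaledRate_sin (θ b ξ α u : ℝ) (μ : ProbabilityMeasure ℝ) :
    (scaledRate θ b (fun x => Real.cos (ξ * x)) α u μ : ℂ) +
        Complex.I * scaledRate θ b (fun x => Real.sin (ξ * x)) α u μ =
      (Complex.I * ξ * (α * Real.exp (θ * u) : ℝ) -
          ξ ^ 2 * (b ^ 2 / 2 * Real.exp (θ * u) ^ 2 : ℝ)) *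
        charFun (μ : Measure ℝ) (ξ * Real.exp (θ * u)) := by
  rw [scaledRate, scaledRate, deriv_deriv_cos_const_mul, deriv_deriv_sin_const_mul,
    deriv_cos_const_mul, deriv_sin_const_mul, charFun_mul_exp]
  simp only [scaledIntegral_const_mul]
  push_cast
  linear_combination (-(ξ * α * Complex.exp (θ * u) *
    scaledIntegral θ 0 (fun x => Real.sin (ξ * x)) u μ)) * Complex.I_sq

lemma intervalIntegrable_ofReal {g : ℝ → ℝ} (hg : IntervalIntegrable g volume r t) :
    IntervalIntegrable (fun w => (g w : ℂ)) volume r t :=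
  ⟨hg.1.ofReal, hg.2.ofReal⟩

lemma abs_mul_le_of_abs_le_one {κ y : ℝ} (hy : |y| ≤ 1) : |κ * y| ≤ |κ| :=
  (abs_mul κ y).trans_le (mul_le_of_le_one_right (abs_nonneg κ) hy)

lemma SolvesFokkerPlanck.charFun_integral_eq (h : SolvesFokkerPlanck θ b a ν r t) (hrt : r ≤ t)
    (ha : IntervalIntegrable a volume r t) (ξ : ℝ) :
    IntervalIntegrable (fun w => (Complex.I * ξ * (a w * Real.exp (θ * (w - r)) : ℝ) -
        ξ ^ 2 * (b ^ 2 / 2 * Real.exp (θ * (w - r)) ^ 2 : ℝ)) *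
        charFun (ν w : Measure ℝ) (ξ * Real.exp (θ * (w - r)))) volume r t ∧
      charFun (ν t : Measure ℝ) (ξ * Real.exp (θ * (t - r))) = charFun (ν r : Measure ℝ) ξ +
        ∫ w in r..t, (Complex.I * ξ * (a w * Real.exp (θ * (w - r)) : ℝ) -
          ξ ^ 2 * (b ^ 2 / 2 * Real.exp (θ * (w - r)) ^ 2 : ℝ)) *
          charFun (ν w : Measure ℝ) (ξ * Real.exp (θ * (w - r))) := by
  set B := 1 + |ξ| + |ξ ^ 2|
  have hcos : ∀ x, |Real.cos (ξ * x)| ≤ 1 := fun x => Real.abs_cos_le_one _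
  have hsin : ∀ x, |Real.sin (ξ * x)| ≤ 1 := fun x => Real.abs_sin_le_one _
  have hB₀ : 1 ≤ B := by linarith [abs_nonneg ξ, abs_nonneg (ξ ^ 2)]
  have hB₁ : |ξ| ≤ B := by linarith [abs_nonneg (ξ ^ 2)]
  have hB₂ : |ξ ^ 2| ≤ B := by linarith [abs_nonneg ξ]
  obtain ⟨hcosint, hcoseq⟩ := h.scaled_equation_of_bounded hrt ha
    (f := fun x => Real.cos (ξ * x)) (B := B) (by fun_prop) (fun x => (hcos x).trans hB₀)
    (fun x => by
      rw [deriv_cos_const_mul]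
      exact (abs_mul_le_of_abs_le_one (hsin x)).trans ((abs_neg ξ).trans_le hB₁))
    (fun x => by
      rw [deriv_deriv_cos_const_mul]
      exact (abs_mul_le_of_abs_le_one (hcos x)).trans ((abs_neg _).trans_le hB₂))
  obtain ⟨hsinint, hsineq⟩ := h.scaled_equation_of_bounded hrt ha
    (f := fun x => Real.sin (ξ * x)) (B := B) (by fun_prop) (fun x => (hsin x).trans hB₀)
    (fun x => by
      rw [deriv_sin_const_mul]
      exact (abs_mul_le_of_abs_le_one (hcos x)).trans hB₁)
    (fun x => by
      rw [deriv_deriv_sin_const_mul]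
      exact (abs_mul_le_of_abs_le_one (hsin x)).trans ((abs_neg _).trans_le hB₂))
  have hcosC := intervalIntegrable_ofReal hcosint
  have hsinC := (intervalIntegrable_ofReal hsinint).const_mul Complex.I
  simp only [← scaledRate_cos_add_I_mul_scaledRate_sin]
  refine ⟨hcosC.add hsinC, ?_⟩
  have hstart : charFun (ν r : Measure ℝ) ξ = charFun (ν r : Measure ℝ) (ξ * Real.exp (θ * 0)) := by
    rw [mul_zero, Real.exp_zero, mul_one]
  rw [hstart, charFun_mul_exp, charFun_mul_exp, intervalIntegral.integral_add hcosC hsinC,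
    intervalIntegral.integral_const_mul, intervalIntegral.integral_ofReal,
    intervalIntegral.integral_ofReal, ← hcoseq, ← hsineq]
  push_cast
  ring

lemma SolvesFokkerPlanck.charFun_eq (hrt : r ≤ t) (h : SolvesFokkerPlanck θ b a ν r t)
    (ha : IntervalIntegrable a volume r t) (ξ : ℝ) :
    charFun (ν t : Measure ℝ) (ξ * Real.exp (θ * (t - r))) = charFun (ν r : Measure ℝ) ξ *
      Complex.exp (∫ w in r..t, (Complex.I * ξ * (a w * Real.exp (θ * (w - r)) : ℝ) -
        ξ ^ 2 * (b ^ 2 / 2 * Real.exp (θ * (w - r)) ^ 2 : ℝ))) := by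
  have hdrift : IntervalIntegrable (fun w => a w * Real.exp (θ * (w - r))) volume r t :=
    ha.mul_continuousOn (by fun_prop)
  have hk : IntervalIntegrable (fun w => Complex.I * ξ * (a w * Real.exp (θ * (w - r)) : ℝ) -
      ξ ^ 2 * (b ^ 2 / 2 * Real.exp (θ * (w - r)) ^ 2 : ℝ)) volume r t :=
    ((intervalIntegrable_ofReal hdrift).const_mul _).sub
      (Continuous.intervalIntegrable (by fun_prop) _ _)
  have hstart : charFun (ν r : Measure ℝ) ξ =
      charFun (ν r : Measure ℝ) (ξ * Real.exp (θ * (r - r))) := by simp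
  rw [hstart]
  refine eq_mul_exp_of_integral_eq hrt hk (h.charFun_integral_eq hrt ha ξ).1 fun x hx hxt => ?_
  rw [← hstart]
  exact ((h.mono hxt).charFun_integral_eq hx (intervalIntegrable_mono_Icc ha le_rfl hx hxt) ξ).2

end CharFun

/-! ### Gaussian solutions of the Fokker–Planck equation -/

/-- The mean at time `q` of the dynamics under the control `a`, started with mean `m` at time
`r`. -/
noncomputable def meanFlow (θ : ℝ) (a : ℝ → ℝ) (r q m : ℝ) : ℝ :=
  Real.exp (-(θ * (q - r))) * (m + ∫ w in r..q, a w * Real.exp (θ * (w - r)))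

lemma meanFlow_self (θ : ℝ) (a : ℝ → ℝ) (r m : ℝ) : meanFlow θ a r r m = m := by
  simp [meanFlow]

lemma intervalIntegrable_mul_exp {θ r t : ℝ} {a : ℝ → ℝ} (ha : IntervalIntegrable a volume r t) :
    IntervalIntegrable (fun w => a w * Real.exp (θ * (w - r))) volume r t :=
  ha.mul_continuousOn (Continuous.continuousOn (by fun_prop))

lemma continuousOn_meanFlow {θ r t m : ℝ} {a : ℝ → ℝ} (hrt : r ≤ t)
    (ha : IntervalIntegrable a volume r t) :
    ContinuousOn (fun q => meanFlow θ a r q m) (Set.Icc r t) :=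
  ContinuousOn.mul (Continuous.continuousOn (by fun_prop))
    (continuousOn_const.add (continuousOn_primitive_Icc hrt (intervalIntegrable_mul_exp ha)))

lemma charFun_gaussianLaw (m ξ : ℝ) {z : ℝ} (hz : 0 ≤ z) :
    charFun (gaussianLaw m z : Measure ℝ) ξ =
      Complex.exp (ξ * m * Complex.I - z * ξ ^ 2 / 2) := by
  have := charFun_gaussianReal (μ := m) (v := z.toNNReal) ξ
  rw [Real.coe_toNNReal z hz] at this
  exact this

lemma tendsto_gaussianLaw {ι : Type*} {l : Filter ι} [l.IsCountablyGenerated] {m z : ι → ℝ}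
    {m₀ z₀ : ℝ} (hm : Tendsto m l (𝓝 m₀)) (hz : Tendsto z l (𝓝 z₀)) :
    Tendsto (fun i => gaussianLaw (m i) (z i)) l (𝓝 (gaussianLaw m₀ z₀)) := by
  refine tendsto_of_seq_tendsto fun x hx => ProbabilityMeasure.tendsto_of_tendsto_charFun ?_
  have hvar : Tendsto (fun n => (z (x n)).toNNReal) atTop (𝓝 z₀.toNNReal) :=
    (continuous_real_toNNReal.tendsto _).comp (hz.comp hx)
  have hvar' : Tendsto (fun n => (((z (x n)).toNNReal : ℝ) : ℂ)) atTop (𝓝 (z₀.toNNReal : ℝ)) :=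
    (Complex.continuous_ofReal.tendsto _).comp ((NNReal.continuous_coe.tendsto _).comp hvar)
  have hmean : Tendsto (fun n => ((m (x n) : ℝ) : ℂ)) atTop (𝓝 (m₀ : ℂ)) :=
    (Complex.continuous_ofReal.tendsto _).comp (hm.comp hx)
  intro ξ
  have hchar : ∀ m z, charFun (gaussianLaw m z : Measure ℝ) ξ =
      Complex.exp (ξ * m * Complex.I - (z.toNNReal : ℝ) * ξ ^ 2 / 2) :=
    fun m z => charFun_gaussianReal ξ
  rw [hchar]
  refine Tendsto.congr (fun n => (hchar _ _).symm) ?_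
  refine (Complex.continuous_exp.tendsto _).comp ?_
  exact ((hmean.const_mul _).mul_const _).sub ((hvar'.mul_const _).div_const _)

lemma integral_exp_sq (θ r t : ℝ) : ∫ w in r..t, Real.exp (θ * (w - r)) ^ 2 =
    Real.exp (θ * (t - r)) ^ 2 * discountIntegral θ (t - r) := by
  have := intervalIntegral.integral_comp_sub_left (a := r) (b := t)
    (fun u => Real.exp (-2 * θ * u)) t
  rw [sub_self] at this
  rw [discountIntegral, ← this, ← intervalIntegral.integral_const_mul]
  congr 1
  ext w
  rw [← Real.exp_nat_mul, ← Real.exp_nat_mul, ← Real.exp_add]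
  congr 1
  push_cast
  ring

lemma integral_charFun_exponent {θ b r t : ℝ} {a : ℝ → ℝ}
    (ha : IntervalIntegrable a volume r t) (ζ : ℝ) :
    (∫ w in r..t, (Complex.I * (ζ : ℂ) * (a w * Real.exp (θ * (w - r)) : ℝ) -
      (ζ : ℂ) ^ 2 * (b ^ 2 / 2 * Real.exp (θ * (w - r)) ^ 2 : ℝ))) =
    Complex.I * (ζ : ℂ) * ((∫ w in r..t, a w * Real.exp (θ * (w - r)) : ℝ) : ℂ) -
      (ζ : ℂ) ^ 2 * ((b ^ 2 / 2 * (Real.exp (θ * (t - r)) ^ 2 *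
        discountIntegral θ (t - r)) : ℝ) : ℂ) := by
  have hdrift : IntervalIntegrable (fun w => ((a w * Real.exp (θ * (w - r)) : ℝ) : ℂ))
      volume r t := intervalIntegrable_ofReal (intervalIntegrable_mul_exp ha)
  rw [intervalIntegral.integral_sub (hdrift.const_mul _)
    (Continuous.intervalIntegrable (by fun_prop) _ _), intervalIntegral.integral_const_mul,
    intervalIntegral.integral_const_mul, intervalIntegral.integral_ofReal,
    intervalIntegral.integral_ofReal, intervalIntegral.integral_const_mul, integral_exp_sq]

lemma SolvesFokkerPlanck.eq_gaussianLaw {θ b r t : ℝ} {a : ℝ → ℝ} {ν : ℝ → ProbabilityMeasure ℝ}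
    (hrt : r ≤ t) (h : SolvesFokkerPlanck θ b a ν r t) (ha : IntervalIntegrable a volume r t)
    {m z : ℝ} (hz : 0 ≤ z) (h0 : ν r = gaussianLaw m z) :
    ν t = gaussianLaw (meanFlow θ a r t m) (ouVar θ b (t - r) z) := by
  suffices hchar : charFun (ν t : Measure ℝ) =
      charFun (gaussianLaw (meanFlow θ a r t m) (ouVar θ b (t - r) z) : Measure ℝ) from
    ProbabilityMeasure.toMeasure_injective (Measure.ext_of_charFun hchar)
  ext η
  set e := Real.exp (θ * (t - r)) with he
  have he0 : e ≠ 0 := (Real.exp_pos _).ne'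
  have he0' : (e : ℂ) ≠ 0 := Complex.ofReal_ne_zero.2 he0
  have hν := h.charFun_eq hrt ha (η / e)
  rw [div_mul_cancel₀ _ he0, integral_charFun_exponent ha, ← he, h0,
    charFun_gaussianLaw _ _ hz, ← Complex.exp_add] at hν
  rw [charFun_gaussianLaw _ _ (ouVar_nonneg θ b (sub_nonneg.2 hrt) hz), hν]
  have hinv : Real.exp (-(θ * (t - r))) = e⁻¹ := by rw [he, Real.exp_neg]
  have hinv_sq : Real.exp (-2 * θ * (t - r)) = e⁻¹ ^ 2 := by
    rw [← hinv, ← Real.exp_nat_mul]; congr 1; push_cast; ring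
  rw [meanFlow, ouVar, hinv, hinv_sq]
  push_cast
  congr 1
  field_simp
  ring

/-- The standard Gaussian average of `f(m + σ x)`. -/
noncomputable def gaussAvg (f : ℝ → ℝ) (m σ : ℝ) : ℝ := ∫ x, f (m + σ * x) ∂(gaussianReal 0 1)

lemma gaussianReal_eq_map (m : ℝ) {z : ℝ} (hz : 0 ≤ z) :
    gaussianReal m z.toNNReal = (gaussianReal 0 1).map fun x => m + √z * x := by
  have hscale : (gaussianReal 0 1).map (fun x => √z * x) = gaussianReal 0 z.toNNReal := by
    rw [gaussianReal_map_const_mul, mul_zero, mul_one]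
    congr 1
    ext
    simp [Real.sq_sqrt hz, Real.coe_toNNReal z hz]
  rw [← Function.comp_def (fun y => m + y) fun x => √z * x,
    ← Measure.map_map (by fun_prop) (by fun_prop), hscale, gaussianReal_map_const_add, zero_add]

lemma integral_gaussianLaw {f : ℝ → ℝ} (hf : Continuous f) (m : ℝ) {z : ℝ} (hz : 0 ≤ z) :
    ∫ x, f x ∂(gaussianLaw m z : Measure ℝ) = gaussAvg f m √z := by
  change ∫ x, f x ∂(gaussianReal m z.toNNReal) = _
  rw [gaussianReal_eq_map m hz, integral_map (by fun_prop) hf.aestronglyMeasurable]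
  rfl

lemma integrable_id_gaussianReal : Integrable (fun x : ℝ => x) (gaussianReal 0 1) :=
  (memLp_id_gaussianReal 1).integrable (by simp)

lemma hasDerivAt_neg_gaussianPDFReal (x : ℝ) :
    HasDerivAt (fun x => -gaussianPDFReal 0 1 x) (x * gaussianPDFReal 0 1 x) x := by
  have hexp : HasDerivAt (fun x : ℝ => -(x - 0) ^ 2 / (2 * ((1 : ℝ≥0) : ℝ))) (-x) x :=
    (((hasDerivAt_id x).sub_const 0).pow 2).neg.div_const (2 * ((1 : ℝ≥0) : ℝ)) |>.congr_deriv
      (by simp; ring)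
  refine (hexp.exp.const_mul ((√(2 * Real.pi * ((1 : ℝ≥0) : ℝ)))⁻¹)).neg.congr_deriv ?_
  simp only [gaussianPDFReal]; ring

lemma integrable_gaussianPDFReal_mul {g : ℝ → ℝ} (hg : Integrable g (gaussianReal 0 1)) :
    Integrable fun x => gaussianPDFReal 0 1 x * g x := by
  rw [gaussianReal_of_var_ne_zero _ one_ne_zero] at hg
  simpa using (integrable_withDensity_iff_integrable_smul' (measurable_gaussianPDF 0 1)
    (Eventually.of_forall fun x => gaussianPDF_lt_top)).1 hg

namespace IsTest

variable {f : ℝ → ℝ}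

lemma integrable_comp_affine (hf : IsTest f) (m σ : ℝ) :
    Integrable (fun x => f (m + σ * x)) (gaussianReal 0 1) := by
  obtain ⟨K, hK⟩ := hf.bounded
  have := hf.continuous
  exact Integrable.of_bound (Continuous.aestronglyMeasurable (by fun_prop)) K
    (Eventually.of_forall fun x => hK _)

lemma integrable_comp_affine_mul (hf : IsTest f) (m σ : ℝ) :
    Integrable (fun x => f (m + σ * x) * x) (gaussianReal 0 1) := by
  obtain ⟨K, hK⟩ := hf.bounded
  have := hf.continuous
  exact integrable_id_gaussianReal.bdd_mul (c := K)
    (Continuous.aestronglyMeasurable (by fun_prop)) (Eventually.of_forall fun x => hK _)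

lemma continuous_gaussAvg (hf : IsTest f) : Continuous fun p : ℝ × ℝ => gaussAvg f p.1 p.2 := by
  obtain ⟨K, hK⟩ := hf.bounded
  have := hf.continuous
  exact continuous_of_dominated (bound := fun _ => K)
    (fun p => Continuous.aestronglyMeasurable (by fun_prop))
    (fun p => Eventually.of_forall fun x => hK _) (integrable_const _)
    (Eventually.of_forall fun x => by fun_prop)

lemma hasFDerivAt_gaussAvg (hf : IsTest f) (m σ : ℝ) :
    HasFDerivAt (fun p : ℝ × ℝ => gaussAvg f p.1 p.2)
      (gaussAvg (_root_.deriv f) m σ • ContinuousLinearMap.fst ℝ ℝ ℝ +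
        (∫ x, _root_.deriv f (m + σ * x) * x ∂(gaussianReal 0 1)) •
          ContinuousLinearMap.snd ℝ ℝ ℝ) (m, σ) := by
  obtain ⟨K, hK⟩ := hf.deriv.bounded
  have hc := hf.continuous
  have hc' := hf.deriv.continuous
  let F' : ℝ × ℝ → ℝ → (ℝ × ℝ →L[ℝ] ℝ) := fun p x => _root_.deriv f (p.1 + p.2 * x) •
    (ContinuousLinearMap.fst ℝ ℝ ℝ + x • ContinuousLinearMap.snd ℝ ℝ ℝ)
  have hbound : ∀ p x, ‖F' p x‖ ≤ K * (1 + |x|) := fun p x => by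
    rw [norm_smul]
    refine mul_le_mul (hK _) ((norm_add_le _ _).trans (add_le_add
      (ContinuousLinearMap.norm_fst_le ..) ?_)) (norm_nonneg _) ((abs_nonneg _).trans (hK 0))
    rw [norm_smul, Real.norm_eq_abs]
    exact mul_le_of_le_one_right (abs_nonneg x) (ContinuousLinearMap.norm_snd_le ..)
  have hderiv : HasFDerivAt (fun p : ℝ × ℝ => gaussAvg f p.1 p.2)
      (∫ x, F' (m, σ) x ∂(gaussianReal 0 1)) (m, σ) :=
    hasFDerivAt_integral_of_dominated_of_fderiv_le (F' := F')
      (bound := fun x => K * (1 + |x|)) univ_mem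
      (Eventually.of_forall fun p => Continuous.aestronglyMeasurable (by fun_prop))
      (hf.integrable_comp_affine _ _) (Continuous.aestronglyMeasurable (by fun_prop))
      (Eventually.of_forall fun x p _ => hbound p x)
      (((integrable_const _).add integrable_id_gaussianReal.abs).const_mul K)
      (Eventually.of_forall fun x p _ => (hf.hasDerivAt (p.1 + p.2 * x)).comp_hasFDerivAt p
        (hasFDerivAt_fst.add (hasFDerivAt_snd.mul_const x)))
  refine hderiv.congr_fderiv ?_
  simp only [F', smul_add, smul_smul]
  rw [integral_add ((hf.deriv.integrable_comp_affine _ _).smul_const _)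
    ((hf.deriv.integrable_comp_affine_mul _ _).smul_const _), integral_smul_const,
    integral_smul_const, gaussAvg]

lemma hasDerivAt_gaussAvg (hf : IsTest f) {m σ : ℝ → ℝ} {m' σ' q : ℝ} (hm : HasDerivAt m m' q)
    (hσ : HasDerivAt σ σ' q) :
    HasDerivAt (fun q => gaussAvg f (m q) (σ q)) (m' * gaussAvg (_root_.deriv f) (m q) (σ q) +
      σ' * ∫ x, _root_.deriv f (m q + σ q * x) * x ∂(gaussianReal 0 1)) q := by
  refine ((hf.hasFDerivAt_gaussAvg (m q) (σ q)).comp_hasDerivAt q (hm.prodMk hσ)).congr_deriv ?_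
  simp [mul_comm]

lemma gaussian_integration_by_parts (hf : IsTest f) (m σ : ℝ) :
    ∫ x, f (m + σ * x) * x ∂(gaussianReal 0 1) = σ * gaussAvg (_root_.deriv f) m σ := by
  have hu : ∀ x, HasDerivAt (fun x => f (m + σ * x)) (σ * _root_.deriv f (m + σ * x)) x :=
    fun x => ((hf.hasDerivAt _).comp x (((hasDerivAt_id x).const_mul σ).const_add m)).congr_deriv
      (by simp [mul_comm])
  rw [gaussAvg, integral_gaussianReal_eq_integral_smul one_ne_zero,
    integral_gaussianReal_eq_integral_smul one_ne_zero]
  have hparts := integral_mul_deriv_eq_deriv_mul_of_integrable (fun x _ => hu x)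
    (fun x _ => hasDerivAt_neg_gaussianPDFReal x)
    ((integrable_gaussianPDFReal_mul (hf.integrable_comp_affine_mul m σ)).congr
      (Eventually.of_forall fun x => by simp only [Pi.mul_apply]; ring))
    ((integrable_gaussianPDFReal_mul ((hf.deriv.integrable_comp_affine m σ).const_mul (-σ))).congr
      (Eventually.of_forall fun x => by simp only [Pi.mul_apply]; ring))
    ((integrable_gaussianPDFReal_mul ((hf.integrable_comp_affine m σ).const_mul (-1))).congr
      (Eventually.of_forall fun x => by simp only [Pi.mul_apply]; ring))
  calc ∫ x, gaussianPDFReal 0 1 x • (f (m + σ * x) * x)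
      = ∫ x, f (m + σ * x) * (x * gaussianPDFReal 0 1 x) := by
        congr 1; ext x; simp only [smul_eq_mul]; ring
    _ = -∫ x, σ * _root_.deriv f (m + σ * x) * -gaussianPDFReal 0 1 x := hparts
    _ = σ * ∫ x, gaussianPDFReal 0 1 x • _root_.deriv f (m + σ * x) := by
        rw [← integral_neg, ← integral_const_mul]
        congr 1; ext x; simp only [smul_eq_mul]; ring

lemma integral_ouGenerator_gaussianLaw (hf : IsTest f) (θ b a m : ℝ) {z : ℝ} (hz : 0 ≤ z) :
    ∫ x, ouGenerator θ b a f x ∂(gaussianLaw m z : Measure ℝ) =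
      (-θ * m + a) * gaussAvg (_root_.deriv f) m √z +
      (b ^ 2 / 2 - θ * z) * gaussAvg (_root_.deriv (_root_.deriv f)) m √z := by
  have hc1 := hf.deriv.continuous
  have hc2 := hf.deriv.deriv.continuous
  rw [integral_gaussianLaw (by unfold ouGenerator; fun_prop) m hz]
  have hz2 : θ * z = θ * √z * √z := by rw [mul_assoc, Real.mul_self_sqrt hz]
  have i1 := (hf.deriv.integrable_comp_affine m √z).const_mul (-θ * m + a)
  have i2 := (hf.deriv.integrable_comp_affine_mul m √z).const_mul (-θ * √z)
  have i3 := (hf.deriv.deriv.integrable_comp_affine m √z).const_mul (b ^ 2 / 2)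
  have : gaussAvg (ouGenerator θ b a f) m √z =
      (-θ * m + a) * gaussAvg (_root_.deriv f) m √z +
      -θ * √z * ∫ x, _root_.deriv f (m + √z * x) * x ∂(gaussianReal 0 1) +
      b ^ 2 / 2 * gaussAvg (_root_.deriv (_root_.deriv f)) m √z := by
    unfold gaussAvg
    rw [← integral_const_mul, ← integral_const_mul, ← integral_const_mul, ← integral_add i1 i2,
      ← integral_add (i1.fun_add i2) i3]
    congr 1
    ext x
    simp only [ouGenerator]
    ring
  rw [this, hf.deriv.gaussian_integration_by_parts, hz2]
  ring

end IsTest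

section GaussianFlow

variable {θ b r z : ℝ} {a m : ℝ → ℝ}

lemma continuousOn_gaussAvg_ouVar {f : ℝ → ℝ} {s : Set ℝ} (hf : IsTest f)
    (hm : ContinuousOn m s) :
    ContinuousOn (fun q => gaussAvg f (m q) √(ouVar θ b (q - r) z)) s :=
  hf.continuous_gaussAvg.comp_continuousOn (hm.prodMk (((continuous_ouVar_left θ b z).comp
    (continuous_id.sub continuous_const)).sqrt.continuousOn))

lemma continuousOn_integral_ouGenerator {f : ℝ → ℝ} {s : Set ℝ} (hf : IsTest f) (hz : 0 ≤ z)
    (hs : ∀ q ∈ s, r ≤ q) (ha : ContinuousOn a s) (hm : ContinuousOn m s) :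
    ContinuousOn (fun q => ∫ x, ouGenerator θ b (a q) f x
      ∂(gaussianLaw (m q) (ouVar θ b (q - r) z) : Measure ℝ)) s := by
  have hvar : Continuous fun q => ouVar θ b (q - r) z :=
    (continuous_ouVar_left θ b z).comp (continuous_id.sub continuous_const)
  refine ContinuousOn.congr ?_ fun q hq =>
    hf.integral_ouGenerator_gaussianLaw θ b (a q) (m q)
      (ouVar_nonneg θ b (sub_nonneg.2 (hs q hq)) hz)
  exact (((hm.const_mul _).add ha).mul (continuousOn_gaussAvg_ouVar hf.deriv hm)).add
    (ContinuousOn.mul (Continuous.continuousOn (by fun_prop))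
      (continuousOn_gaussAvg_ouVar hf.deriv.deriv hm))

lemma hasDerivAt_gaussAvg_ouVar {f : ℝ → ℝ} {q : ℝ} (hf : IsTest f) (hz : 0 ≤ z)
    (hq : r < q) (hm : HasDerivAt m (-θ * m q + a q) q) :
    HasDerivAt (fun q => gaussAvg f (m q) √(ouVar θ b (q - r) z))
      (∫ x, ouGenerator θ b (a q) f x
        ∂(gaussianLaw (m q) (ouVar θ b (q - r) z) : Measure ℝ)) q := by
  rw [hf.integral_ouGenerator_gaussianLaw θ b (a q) (m q)
    (ouVar_nonneg θ b (sub_nonneg.2 hq.le) hz)]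
  -- The square root is differentiable only where the variance does not vanish.
  rcases ouVar_pos_or_eq_zero θ b hz with hpos | ⟨hb, hzero⟩
  · have hv := hpos (q - r) (sub_pos.2 hq)
    have hσ := ((hasDerivAt_ouVar θ b (q - r) z).comp_sub_const q r).sqrt hv.ne'
    refine (hf.hasDerivAt_gaussAvg hm hσ).congr_deriv ?_
    rw [hf.deriv.gaussian_integration_by_parts]
    have : √(ouVar θ b (q - r) z) ≠ 0 := (Real.sqrt_pos.2 hv).ne'
    field_simp
  · simp only [hzero, Real.sqrt_zero]
    exact (hf.hasDerivAt_gaussAvg hm (hasDerivAt_const q 0)).congr_deriv (by simp [hb])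

lemma gaussianLaw_solvesFokkerPlanck {t : ℝ} (hz : 0 ≤ z)
    (ha : ContinuousOn a (Set.Icc r t)) (hm : ContinuousOn m (Set.Icc r t))
    (hm' : ∀ q ∈ Set.Ioo r t, HasDerivAt m (-θ * m q + a q) q) :
    SolvesFokkerPlanck θ b a (fun q => gaussianLaw (m q) (ouVar θ b (q - r) z)) r t := by
  intro f hf x y hx hxy hy
  have hsub : Set.Icc x y ⊆ Set.Icc r t := Set.Icc_subset_Icc hx hy
  have hint : IntervalIntegrable (fun q => ∫ x, ouGenerator θ b (a q) f x
      ∂(gaussianLaw (m q) (ouVar θ b (q - r) z) : Measure ℝ)) volume x y := by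
    refine ContinuousOn.intervalIntegrable ?_
    rw [Set.uIcc_of_le hxy]
    exact continuousOn_integral_ouGenerator hf hz (fun q hq => hx.trans hq.1) (ha.mono hsub)
      (hm.mono hsub)
  have hvar : ∀ q, r ≤ q → 0 ≤ ouVar θ b (q - r) z := fun q hq =>
    ouVar_nonneg θ b (sub_nonneg.2 hq) hz
  refine ⟨hint, ?_⟩
  rw [integral_gaussianLaw hf.continuous _ (hvar y (hx.trans hxy)),
    integral_gaussianLaw hf.continuous _ (hvar x hx),
    intervalIntegral.integral_eq_sub_of_hasDerivAt_of_le hxy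
      (continuousOn_gaussAvg_ouVar hf (hm.mono hsub)) (fun q hq =>
        hasDerivAt_gaussAvg_ouVar hf hz (hx.trans_lt hq.1)
          (hm' q ⟨hx.trans_lt hq.1, hq.2.trans_le hy⟩)) hint]
  ring

end GaussianFlow

/-! ### The cost on a time interval without observations -/

section IntervalCost

variable {θ b C T r t m z : ℝ} {a g : ℝ → ℝ}

lemma ae_hasDerivAt_meanFlow (ha : IntervalIntegrable a volume r t) :
    ∀ᵐ q, q ∈ Set.uIcc r t →
      HasDerivAt (fun q => meanFlow θ a r q m) (-θ * meanFlow θ a r q m + a q) q := by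
  filter_upwards [(intervalIntegrable_mul_exp (θ := θ) ha).ae_hasDerivAt_integral] with q hq hqI
  have hexp : HasDerivAt (fun q => Real.exp (-(θ * (q - r))))
      (Real.exp (-(θ * (q - r))) * -(θ * 1)) q :=
    (((hasDerivAt_id q).sub_const r).const_mul θ).neg.exp
  refine (hexp.mul ((hq hqI r Set.left_mem_uIcc).const_add m)).congr_deriv ?_
  rw [meanFlow]
  have hcancel : Real.exp (-(θ * (q - r))) * Real.exp (θ * (q - r)) = 1 := by
    rw [← Real.exp_add, neg_add_cancel, Real.exp_zero]
  linear_combination a q * hcancel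

lemma absolutelyContinuousOnInterval_meanFlow (hrt : r ≤ t)
    (ha : IntervalIntegrable a volume r t) :
    AbsolutelyContinuousOnInterval (fun q => meanFlow θ a r q m) r t := by
  have hexp : AbsolutelyContinuousOnInterval (fun q => Real.exp (-(θ * (q - r)))) r t :=
    ContDiffOn.absolutelyContinuousOnInterval (ContDiff.contDiffOn (by fun_prop))
  have hint : AbsolutelyContinuousOnInterval
      (fun q => m + ∫ w in r..q, a w * Real.exp (θ * (w - r))) r t :=
    absolutelyContinuousOnInterval_of_dist_le (K := 1)
      (absolutelyContinuousOnInterval_primitive hrt (intervalIntegrable_mul_exp ha))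
      fun x _ y _ => by rw [dist_add_left, one_mul]
  exact hexp.mul hint

lemma hasDerivAt_riccati_sub (hC : 0 < C) {q : ℝ} (hq : q ≤ T) :
    HasDerivAt (fun q => riccati θ C (T - q))
      (-(1 - 2 * θ * riccati θ C (T - q) - riccati θ C (T - q) ^ 2 / C)) q :=
  (hasDerivAt_riccati θ hC (sub_nonneg.2 hq)).comp_const_sub T q

lemma absolutelyContinuousOnInterval_riccati_sub (hC : 0 < C) (hrt : r ≤ t) (htT : t ≤ T) :
    AbsolutelyContinuousOnInterval (fun q => riccati θ C (T - q)) r t := by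
  refine ContDiffOn.absolutelyContinuousOnInterval (ContDiffOn.div ?_ ?_ fun q hq => ?_)
  · exact ContDiff.contDiffOn (by unfold riccatiNum; fun_prop)
  · exact ContDiff.contDiffOn (by unfold riccatiDen; fun_prop)
  · rw [Set.uIcc_of_le hrt] at hq
    exact (riccatiDen_pos θ hC (sub_nonneg.2 (hq.2.trans htT))).ne'

lemma continuousOn_riccati_sub (hC : 0 < C) :
    ContinuousOn (fun q => riccati θ C (T - q)) (Set.Iic T) := fun _ hq =>
  (hasDerivAt_riccati_sub hC hq).continuousAt.continuousWithinAt

lemma riccati_mul_sq_sub (hC : 0 < C) (hrt : r ≤ t) (htT : t ≤ T)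
    (ha : IntervalIntegrable a volume r t) :
    riccati θ C (T - t) * meanFlow θ a r t m ^ 2 - riccati θ C (T - r) * m ^ 2 =
      ∫ w in r..t, ((riccati θ C (T - w) ^ 2 / C - 1) * meanFlow θ a r w m ^ 2 +
        2 * riccati θ C (T - w) * meanFlow θ a r w m * a w) := by
  have hmAC := absolutelyContinuousOnInterval_meanFlow (θ := θ) (m := m) hrt ha
  have hAC : AbsolutelyContinuousOnInterval
      (fun q => riccati θ C (T - q) * (meanFlow θ a r q m * meanFlow θ a r q m)) r t :=
    (absolutelyContinuousOnInterval_riccati_sub hC hrt htT).mul (hmAC.mul hmAC)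
  rw [integral_eq_sub_of_ae_hasDerivAt hAC, meanFlow_self, ← sq, ← sq]
  filter_upwards [ae_hasDerivAt_meanFlow (θ := θ) (m := m) ha] with q hm hqI
  have hqT : q ≤ T := by rw [Set.uIcc_of_le hrt] at hqI; exact hqI.2.trans htT
  exact ((hasDerivAt_riccati_sub hC hqT).mul ((hm hqI).mul (hm hqI))).congr_deriv
    (by simp only [Pi.mul_apply]; ring)

lemma intervalIntegrable_sq_meanFlow (hrt : r ≤ t) (ha : IntervalIntegrable a volume r t) :
    IntervalIntegrable (fun q => meanFlow θ a r q m ^ 2) volume r t :=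
  ContinuousOn.intervalIntegrable
    (by rw [Set.uIcc_of_le hrt]; exact (continuousOn_meanFlow hrt ha).pow 2)

lemma intervalIntegrable_ouVar_sub :
    IntervalIntegrable (fun q => ouVar θ b (q - r) z) volume r t :=
  ((continuous_ouVar_left θ b z).comp (continuous_id.sub continuous_const)).intervalIntegrable _ _

/-- The running cost at time `q` of the Gaussian solution with mean `m` and variance `z` at
time `r` under the control `a`. -/
noncomputable def gaussRunningCost (θ b C : ℝ) (a : ℝ → ℝ) (r m z q : ℝ) : ℝ :=
  meanFlow θ a r q m ^ 2 + ouVar θ b (q - r) z + C * a q ^ 2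

lemma gaussRunningCost_nonneg (hC : 0 < C) (hz : 0 ≤ z) {q : ℝ} (hq : r ≤ q) :
    0 ≤ gaussRunningCost θ b C a r m z q := by
  have := ouVar_nonneg θ b (sub_nonneg.2 hq) hz
  unfold gaussRunningCost
  positivity

lemma intervalIntegrable_gaussRunningCost (hrt : r ≤ t) (ha : IntervalIntegrable a volume r t)
    (ha2 : IntervalIntegrable (fun q => a q ^ 2) volume r t) :
    IntervalIntegrable (gaussRunningCost θ b C a r m z) volume r t :=
  ((intervalIntegrable_sq_meanFlow hrt ha).add intervalIntegrable_ouVar_sub).add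
    (ha2.const_mul C)

lemma integral_sq_add_feedback (hC : 0 < C) (hrt : r ≤ t) (htT : t ≤ T)
    (ha : IntervalIntegrable a volume r t)
    (ha2 : IntervalIntegrable (fun q => a q ^ 2) volume r t) :
    ∫ q in r..t, C * (a q + riccati θ C (T - q) * meanFlow θ a r q m / C) ^ 2 =
      riccati θ C (T - t) * meanFlow θ a r t m ^ 2 - riccati θ C (T - r) * m ^ 2 +
        ((∫ q in r..t, meanFlow θ a r q m ^ 2) + ∫ q in r..t, C * a q ^ 2) := by
  have hflow := continuousOn_meanFlow (θ := θ) (m := m) hrt ha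
  have hric : ContinuousOn (fun q => riccati θ C (T - q)) (Set.Icc r t) :=
    (continuousOn_riccati_sub hC).mono fun q hq => hq.2.trans htT
  rw [← Set.uIcc_of_le hrt] at hflow hric
  have hquad : IntervalIntegrable (fun q => (riccati θ C (T - q) ^ 2 / C - 1) *
      meanFlow θ a r q m ^ 2) volume r t :=
    (((hric.pow 2).div_const C).sub continuousOn_const |>.mul (hflow.pow 2)).intervalIntegrable
  have hcross : IntervalIntegrable (fun q => 2 * riccati θ C (T - q) * meanFlow θ a r q m * a q)
      volume r t := ha.continuousOn_mul ((hric.const_mul 2).mul hflow)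
  have hmean := intervalIntegrable_sq_meanFlow (θ := θ) (m := m) hrt ha
  rw [riccati_mul_sq_sub hC hrt htT ha, ← intervalIntegral.integral_add hmean (ha2.const_mul C),
    ← intervalIntegral.integral_add (hquad.add hcross) (hmean.add (ha2.const_mul C))]
  congr 1
  ext q
  field_simp
  ring

lemma integral_gaussRunningCost_add (hC : 0 < C) (hrt : r ≤ t) (htT : t ≤ T)
    (ha : IntervalIntegrable a volume r t)
    (ha2 : IntervalIntegrable (fun q => a q ^ 2) volume r t) :
    (∫ q in r..t, gaussRunningCost θ b C a r m z q) +
        (riccati θ C (T - t) * meanFlow θ a r t m ^ 2 + g (ouVar θ b (t - r) z)) =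
      riccati θ C (T - r) * m ^ 2 + varCost θ b g (t - r) z +
        ∫ q in r..t, C * (a q + riccati θ C (T - q) * meanFlow θ a r q m / C) ^ 2 := by
  have hmean := intervalIntegrable_sq_meanFlow (θ := θ) (m := m) hrt ha
  have hvar : ∫ q in r..t, ouVar θ b (q - r) z = ∫ q in (0 : ℝ)..(t - r), ouVar θ b q z := by
    rw [intervalIntegral.integral_comp_sub_right (fun q => ouVar θ b q z) r, sub_self]
  unfold gaussRunningCost
  rw [integral_sq_add_feedback hC hrt htT ha ha2, varCost,
    intervalIntegral.integral_add (hmean.add intervalIntegrable_ouVar_sub) (ha2.const_mul C),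
    intervalIntegral.integral_add hmean intervalIntegrable_ouVar_sub, hvar]
  ring

lemma lintegral_gaussRunningCost_add (hC : 0 < C) (hrt : r ≤ t) (htT : t ≤ T) (hz : 0 ≤ z)
    (hg : ∀ z, 0 ≤ z → 0 ≤ g z) (ha : IntervalIntegrable a volume r t)
    (ha2 : IntervalIntegrable (fun q => a q ^ 2) volume r t) :
    (∫⁻ q in Set.Ioc r t, ENNReal.ofReal (gaussRunningCost θ b C a r m z q)) +
      ENNReal.ofReal (riccati θ C (T - t) * meanFlow θ a r t m ^ 2 +
        g (ouVar θ b (t - r) z)) =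
    ENNReal.ofReal (riccati θ C (T - r) * m ^ 2 + varCost θ b g (t - r) z +
      ∫ q in r..t, C * (a q + riccati θ C (T - q) * meanFlow θ a r q m / C) ^ 2) := by
  have hric := (riccati_pos θ hC (sub_nonneg.2 htT)).le
  have hgv := hg _ (ouVar_nonneg θ b (sub_nonneg.2 hrt) hz)
  rw [← integral_gaussRunningCost_add hC hrt htT ha ha2,
    ENNReal.ofReal_add (intervalIntegral.integral_nonneg hrt fun q hq =>
      gaussRunningCost_nonneg hC hz hq.1) (by positivity),
    intervalIntegral.integral_of_le hrt, ofReal_integral_eq_lintegral_ofReal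
      (intervalIntegrable_gaussRunningCost hrt ha ha2).1
      ((ae_restrict_mem measurableSet_Ioc).mono fun q hq =>
        gaussRunningCost_nonneg hC hz hq.1.le)]

lemma intervalIntegrable_sq_of_lintegral_ne_top (hC : 0 < C) (hrt : r ≤ t) (hz : 0 ≤ z)
    (ha : IntervalIntegrable a volume r t)
    (hfin : ∫⁻ q in Set.Ioc r t, ENNReal.ofReal (gaussRunningCost θ b C a r m z q) ≠ ⊤) :
    IntervalIntegrable (fun q => a q ^ 2) volume r t := by
  rw [intervalIntegrable_iff_integrableOn_Ioc_of_le hrt]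
  suffices hCa : IntegrableOn (fun q => C * a q ^ 2) (Set.Ioc r t) from
    (hCa.const_mul C⁻¹).congr (Eventually.of_forall fun q => inv_mul_cancel_left₀ hC.ne' _)
  refine ⟨(ha.1.aestronglyMeasurable.pow 2).const_mul C, ?_⟩
  rw [hasFiniteIntegral_iff_ofReal (Eventually.of_forall fun q => by positivity)]
  refine lt_of_le_of_lt ?_ hfin.lt_top
  refine setLIntegral_mono' measurableSet_Ioc fun q hq => ENNReal.ofReal_le_ofReal ?_
  have hvar := ouVar_nonneg θ b (sub_nonneg.2 hq.1.le) hz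
  exact le_add_of_nonneg_left (by positivity)

lemma le_lintegral_gaussRunningCost_add (hC : 0 < C) (hrt : r ≤ t) (htT : t ≤ T) (hz : 0 ≤ z)
    (hg : ∀ z, 0 ≤ z → 0 ≤ g z) (ha : IntervalIntegrable a volume r t) :
    ENNReal.ofReal (riccati θ C (T - r) * m ^ 2 + varCost θ b g (t - r) z) ≤
    (∫⁻ q in Set.Ioc r t, ENNReal.ofReal (gaussRunningCost θ b C a r m z q)) +
      ENNReal.ofReal (riccati θ C (T - t) * meanFlow θ a r t m ^ 2 +
        g (ouVar θ b (t - r) z)) := by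
  by_cases hfin : ∫⁻ q in Set.Ioc r t, ENNReal.ofReal (gaussRunningCost θ b C a r m z q) = ⊤
  · rw [hfin, top_add]
    exact le_top
  rw [lintegral_gaussRunningCost_add hC hrt htT hz hg ha
    (intervalIntegrable_sq_of_lintegral_ne_top hC hrt hz ha hfin)]
  exact ENNReal.ofReal_le_ofReal <| le_add_of_nonneg_right <|
    intervalIntegral.integral_nonneg hrt fun q _ => by positivity

lemma lintegral_gaussRunningCost_add_of_feedback (hC : 0 < C) (hrt : r ≤ t) (htT : t ≤ T)
    (hz : 0 ≤ z) (hg : ∀ z, 0 ≤ z → 0 ≤ g z) (ha : IntervalIntegrable a volume r t)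
    (hfb : ∀ q ∈ Set.Ioo r t, a q = -(riccati θ C (T - q) * meanFlow θ a r q m / C)) :
    (∫⁻ q in Set.Ioc r t, ENNReal.ofReal (gaussRunningCost θ b C a r m z q)) +
      ENNReal.ofReal (riccati θ C (T - t) * meanFlow θ a r t m ^ 2 +
        g (ouVar θ b (t - r) z)) =
    ENNReal.ofReal (riccati θ C (T - r) * m ^ 2 + varCost θ b g (t - r) z) := by
  have hae : ∀ᵐ q, q ∈ Set.uIoc r t →
      a q = -(riccati θ C (T - q) * meanFlow θ a r q m / C) := by
    filter_upwards [ae_mem_Icc_imp_mem_Ioo r t] with q hq hqI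
    rw [Set.uIoc_of_le hrt] at hqI
    exact hfb q (hq (Set.Ioc_subset_Icc_self hqI))
  have hcont : ContinuousOn (fun q => -(riccati θ C (T - q) * meanFlow θ a r q m / C))
      (Set.uIcc r t) := by
    rw [Set.uIcc_of_le hrt]
    exact ((((continuousOn_riccati_sub hC).mono fun q hq => hq.2.trans htT).mul
      (continuousOn_meanFlow hrt ha)).div_const C).neg
  have ha2 : IntervalIntegrable (fun q => a q ^ 2) volume r t := by
    refine (hcont.pow 2).intervalIntegrable.congr_ae ?_
    rw [Filter.EventuallyEq, ae_restrict_iff' measurableSet_uIoc]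
    filter_upwards [hae] with q hq hqI
    rw [hq hqI, Pi.pow_apply]
  have hzero : ∫ q in r..t, C * (a q + riccati θ C (T - q) * meanFlow θ a r q m / C) ^ 2 = 0 := by
    rw [intervalIntegral.integral_congr_ae (g := fun _ => 0), intervalIntegral.integral_zero]
    filter_upwards [hae] with q hq hqI
    rw [add_eq_zero_iff_eq_neg.2 (hq hqI), zero_pow two_ne_zero, mul_zero]
  rw [lintegral_gaussRunningCost_add hC hrt htT hz hg ha ha2, hzero, add_zero]

end IntervalCost

/-! ### Bayes' rule for Gaussian laws -/

/-- The variance of a Gaussian law of variance `z` after the Bayesian update by an observation with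
noise level `ε`; it does not depend on the observed value. -/
noncomputable def posteriorVar (ε z : ℝ) : ℝ := z * ε ^ 2 / (z + ε ^ 2)

lemma posteriorVar_nonneg (ε : ℝ) {z : ℝ} (hz : 0 ≤ z) : 0 ≤ posteriorVar ε z := by
  unfold posteriorVar
  positivity

section Bayes

variable {ε v : ℝ}

lemma obsLikelihood_pos (hε : 0 < ε) (x y : ℝ) : 0 < obsLikelihood ε x y :=
  gaussianPDFReal_pos _ _ _ (by simpa using hε.ne')

lemma posteriorVar_pos (hε : 0 < ε) (hv : 0 < v) : 0 < posteriorVar ε v := by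
  unfold posteriorVar
  positivity

lemma measurable_bayesKernel (ν : Measure ℝ) (y : ℝ) : Measurable fun x => bayesKernel ε x ν y :=
  ((measurable_gaussianPDFReal _ _).comp (measurable_const.sub measurable_id)).div_const _

lemma gaussianPDFReal_mul_obsLikelihood (hε : 0 < ε) (hv : 0 < v) (m x y : ℝ) :
    gaussianPDFReal m v.toNNReal x * obsLikelihood ε x y =
      gaussianPDFReal m (v + ε ^ 2).toNNReal y *
        gaussianPDFReal (m + v / (v + ε ^ 2) * (y - m)) (posteriorVar ε v).toNNReal x := by
  have := Real.pi_pos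
  simp only [obsLikelihood, gaussianPDFReal, posteriorVar]
  rw [Real.coe_toNNReal _ hv.le, Real.coe_toNNReal (ε ^ 2) (by positivity),
    Real.coe_toNNReal _ (by positivity), Real.coe_toNNReal _ (by positivity), mul_mul_mul_comm,
    mul_mul_mul_comm (√(2 * Real.pi * (v + ε ^ 2)))⁻¹, ← Real.exp_add, ← Real.exp_add,
    ← mul_inv, ← mul_inv, ← Real.sqrt_mul (by positivity), ← Real.sqrt_mul (by positivity)]
  congr 1
  · congr 2
    field_simp
  · congr 1
    field_simp
    ring

lemma integral_obsLikelihood_gaussianReal (hε : 0 < ε) (hv : 0 < v) (m y : ℝ) :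
    ∫ x, obsLikelihood ε x y ∂(gaussianReal m v.toNNReal) =
      gaussianPDFReal m (v + ε ^ 2).toNNReal y := by
  have hpost := posteriorVar_pos hε hv
  rw [integral_gaussianReal_eq_integral_smul (Real.toNNReal_pos.2 hv).ne']
  simp_rw [smul_eq_mul, gaussianPDFReal_mul_obsLikelihood hε hv]
  rw [integral_const_mul, integral_gaussianPDFReal_eq_one _ (Real.toNNReal_pos.2 hpost).ne',
    mul_one]

lemma bayesUpdate_dirac (hε : 0 < ε) (m y : ℝ) :
    bayesUpdate ε (Measure.dirac m) y = Measure.dirac m := by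
  have hone : bayesKernel ε m (Measure.dirac m) y = 1 := by
    rw [bayesKernel, integral_dirac, div_self (obsLikelihood_pos hε m y).ne']
  rw [bayesUpdate, withDensity_congr_ae (ae_eq_dirac _), hone, ENNReal.ofReal_one]
  exact withDensity_one

lemma bayesUpdate_gaussianReal (hε : 0 < ε) (hv : 0 < v) (m y : ℝ) :
    bayesUpdate ε (gaussianReal m v.toNNReal) y =
      gaussianReal (m + v / (v + ε ^ 2) * (y - m)) (posteriorVar ε v).toNNReal := by
  have hpost := posteriorVar_pos hε hv
  have hsum : 0 < v + ε ^ 2 := by positivity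
  conv_lhs =>
    rw [bayesUpdate, gaussianReal_of_var_ne_zero _ (Real.toNNReal_pos.2 hv).ne',
      ← withDensity_mul _ (measurable_gaussianPDF _ _) (measurable_bayesKernel _ y).ennreal_ofReal,
      ← gaussianReal_of_var_ne_zero _ (Real.toNNReal_pos.2 hv).ne']
  rw [gaussianReal_of_var_ne_zero _ (Real.toNNReal_pos.2 hpost).ne']
  congr 1
  ext x
  rw [Pi.mul_apply, gaussianPDF, gaussianPDF, ← ENNReal.ofReal_mul (gaussianPDFReal_nonneg _ _ _),
    bayesKernel, integral_obsLikelihood_gaussianReal hε hv, ← mul_div_assoc,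
    gaussianPDFReal_mul_obsLikelihood hε hv, mul_div_cancel_left₀]
  exact (gaussianPDFReal_pos _ _ _ (Real.toNNReal_pos.2 hsum).ne').ne'

lemma bayesUpdate_gaussianLaw (hε : 0 < ε) (hv : 0 ≤ v) (m y : ℝ) :
    bayesUpdate ε (gaussianLaw m v : Measure ℝ) y =
      (gaussianLaw (m + v / (v + ε ^ 2) * (y - m)) (posteriorVar ε v) : Measure ℝ) := by
  rcases hv.eq_or_lt with rfl | hv
  · simpa [gaussianLaw, posteriorVar] using bayesUpdate_dirac hε m y
  · exact bayesUpdate_gaussianReal hε hv m y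

end Bayes

lemma secondMoment_gaussianReal (m : ℝ) (v : ℝ≥0) :
    secondMoment (gaussianReal m v) = ENNReal.ofReal (m ^ 2 + v) := by
  have hL2 : MemLp (fun x => x) 2 (gaussianReal m v) := memLp_id_gaussianReal 2
  rw [secondMoment, ← ofReal_integral_eq_lintegral_ofReal hL2.integrable_sq
    (Eventually.of_forall fun x => sq_nonneg x)]
  congr 1
  have hvar := variance_eq_sub hL2
  simp only [variance_fun_id_gaussianReal, Pi.pow_apply, integral_id_gaussianReal] at hvar
  exact eq_add_of_sub_eq' hvar.symm

lemma secondMoment_gaussianLaw (m : ℝ) {z : ℝ} (hz : 0 ≤ z) :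
    secondMoment (gaussianLaw m z : Measure ℝ) = ENNReal.ofReal (m ^ 2 + z) := by
  simpa only [gaussianLaw, ProbabilityMeasure.coe_mk, Real.coe_toNNReal z hz]
    using secondMoment_gaussianReal m z.toNNReal

lemma lintegral_affine_sq_gaussianReal (c k : ℝ) (v : ℝ≥0) :
    ∫⁻ w, ENNReal.ofReal ((c + k * w) ^ 2) ∂(gaussianReal 0 v) =
      ENNReal.ofReal (c ^ 2 + k ^ 2 * v) := by
  have hmap : (gaussianReal 0 v).map (fun w => c + k * w) =
      gaussianReal c (NNReal.mk (k ^ 2) (sq_nonneg k) * v) := by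
    have hadd := gaussianReal_map_const_add (μ := k * 0)
      (v := NNReal.mk (k ^ 2) (sq_nonneg k) * v) c
    rwa [← gaussianReal_map_const_mul, Measure.map_map (by fun_prop) (by fun_prop), mul_zero,
      zero_add] at hadd
  have hmoment := secondMoment_gaussianReal c (NNReal.mk (k ^ 2) (sq_nonneg k) * v)
  rwa [← hmap, secondMoment, lintegral_map (by fun_prop) (by fun_prop)] at hmoment

/-! ### Quantile functions -/

/-- The levels `u` at which `quantile ν u`, a real infimum, is not a junk value; besides the levels
in `(0, 1)` only `1` can be one of them. -/
def quantileDomain (ν : Measure ℝ) : Set ℝ :=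
  {u | {x : ℝ | u ≤ cdf ν x}.Nonempty ∧ BddBelow {x : ℝ | u ≤ cdf ν x}}

section Quantile

variable (ν : Measure ℝ)

lemma Ioo_subset_quantileDomain : Set.Ioo 0 1 ⊆ quantileDomain ν := by
  intro u hu
  obtain ⟨x, hx⟩ := ((tendsto_cdf_atTop ν).eventually (lt_mem_nhds hu.2)).exists
  obtain ⟨l, hl⟩ := ((tendsto_cdf_atBot ν).eventually (gt_mem_nhds hu.1)).exists
  refine ⟨⟨x, hx.le⟩, l, fun y hy => ?_⟩
  by_contra! h
  exact hl.not_ge (hy.trans (monotone_cdf ν h.le))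

lemma ordConnected_quantileDomain : (quantileDomain ν).OrdConnected :=
  ⟨fun _ hu _ hv _ hw =>
    ⟨hv.1.mono fun _ hx => hw.2.trans hx, hu.2.mono fun _ hx => hw.1.trans hx⟩⟩

variable {ν} in
lemma quantile_of_notMem_quantileDomain {u : ℝ} (hu : u ∉ quantileDomain ν) :
    quantile ν u = 0 := by
  by_cases hne : {x : ℝ | u ≤ cdf ν x}.Nonempty
  · exact Real.sInf_of_not_bddBelow fun hbdd => hu ⟨hne, hbdd⟩
  · rw [quantile, Set.not_nonempty_iff_eq_empty.1 hne, Real.sInf_empty]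

lemma monotoneOn_quantile : MonotoneOn (quantile ν) (quantileDomain ν) := fun _ hu _ hv huv =>
  csInf_le_csInf hu.2 hv.1 fun _ hx => huv.trans hx

lemma measurable_quantile : Measurable (quantile ν) := by
  have := ordConnected_quantileDomain ν
  refine measurable_of_restrict_of_restrict_compl this.measurableSet
    (Set.monotoneOn_iff_monotone.1 (monotoneOn_quantile ν)).measurable ?_
  have hzero : (quantileDomain ν)ᶜ.domRestrict (quantile ν) = fun _ => 0 :=
    funext fun u => quantile_of_notMem_quantileDomain u.2
  rw [hzero]
  exact measurable_const

variable {ν} in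
lemma quantile_le_iff {u x : ℝ} (hu : u ∈ Set.Ioo (0 : ℝ) 1) :
    quantile ν u ≤ x ↔ u ≤ cdf ν x := by
  obtain ⟨hne, hbdd⟩ := Ioo_subset_quantileDomain ν hu
  refine ⟨fun h => ?_, fun h => csInf_le hbdd h⟩
  have hright : Tendsto (cdf ν) (𝓝[>] x) (𝓝 (cdf ν x)) :=
    ((cdf ν).right_continuous x).mono Set.Ioi_subset_Ici_self
  refine ge_of_tendsto hright ?_
  filter_upwards [self_mem_nhdsWithin] with y hy
  obtain ⟨w, hw, hwy⟩ := exists_lt_of_csInf_lt hne (h.trans_lt hy)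
  exact le_trans hw (monotone_cdf ν hwy.le)

lemma map_quantile [IsProbabilityMeasure ν] :
    (volume.restrict (Set.Icc (0 : ℝ) 1)).map (quantile ν) = ν := by
  have : IsProbabilityMeasure (volume.restrict (Set.Icc (0 : ℝ) 1)) := ⟨by simp⟩
  have := Measure.isProbabilityMeasure_map (μ := volume.restrict (Set.Icc (0 : ℝ) 1))
    (measurable_quantile ν).aemeasurable
  refine Measure.ext_of_Iic _ _ fun x => ?_
  have hpre : quantile ν ⁻¹' Set.Iic x ∩ Set.Ioo 0 1 = Set.Iic (cdf ν x) ∩ Set.Ioo 0 1 :=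
    Set.ext fun _ => and_congr_left quantile_le_iff
  have hIoc : Set.Iic (cdf ν x) ∩ Set.Ioc 0 1 = Set.Ioc 0 (cdf ν x) := by
    rw [Set.inter_comm, Set.Ioc_inter_Iic, min_eq_right (cdf_le_one ν x)]
  rw [Measure.map_apply (measurable_quantile ν) measurableSet_Iic,
    restrict_Ioo_eq_restrict_Icc.symm, Measure.restrict_apply
      (measurable_quantile ν measurableSet_Iic), hpre, ← Measure.restrict_apply measurableSet_Iic,
    restrict_Ioo_eq_restrict_Ioc, Measure.restrict_apply measurableSet_Iic, hIoc,
    Real.volume_Ioc, sub_zero, ofReal_cdf]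

end Quantile

section QuantileGaussian

variable (m z : ℝ)

lemma cdf_gaussianLaw (x : ℝ) :
    cdf (gaussianLaw m z : Measure ℝ) x = cdf (gaussianLaw 0 z : Measure ℝ) (x - m) := by
  have hmap := gaussianReal_map_const_add (μ := 0) (v := z.toNNReal) m
  rw [zero_add] at hmap
  simp only [gaussianLaw, ProbabilityMeasure.coe_mk]
  rw [cdf_eq_real, cdf_eq_real, ← hmap, map_measureReal_apply (by fun_prop) measurableSet_Iic,
    Set.preimage_const_add_Iic]

lemma setOf_le_cdf_gaussianLaw (u : ℝ) : {x : ℝ | u ≤ cdf (gaussianLaw m z : Measure ℝ) x} =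
    OrderIso.addLeft m '' {x : ℝ | u ≤ cdf (gaussianLaw 0 z : Measure ℝ) x} := by
  ext x
  rw [OrderIso.image_eq_preimage_symm, Set.mem_preimage, Set.mem_ofPred_eq, Set.mem_ofPred_eq,
    cdf_gaussianLaw m z, OrderIso.addLeft_symm, OrderIso.addLeft_apply, neg_add_eq_sub]

lemma quantileDomain_gaussianLaw :
    quantileDomain (gaussianLaw m z : Measure ℝ) = quantileDomain (gaussianLaw 0 z) := by
  ext u
  simp only [quantileDomain, Set.mem_ofPred_eq, setOf_le_cdf_gaussianLaw m z, Set.image_nonempty,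
    OrderIso.bddBelow_image]

variable {u : ℝ}

lemma quantile_gaussianLaw (hu : u ∈ quantileDomain (gaussianLaw 0 z : Measure ℝ)) :
    quantile (gaussianLaw m z : Measure ℝ) u = m + quantile (gaussianLaw 0 z : Measure ℝ) u := by
  rw [quantile, setOf_le_cdf_gaussianLaw]
  exact ((OrderIso.addLeft m).map_csInf' hu.1 hu.2).symm

lemma measurable_quantile_gaussianLaw :
    Measurable fun p : ℝ × ℝ => quantile (gaussianLaw p.1 z : Measure ℝ) p.2 := by
  classical
  have hpiecewise : (fun p : ℝ × ℝ => quantile (gaussianLaw p.1 z : Measure ℝ) p.2) = fun p =>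
      if p.2 ∈ quantileDomain (gaussianLaw 0 z : Measure ℝ) then
        p.1 + quantile (gaussianLaw 0 z : Measure ℝ) p.2 else 0 := by
    ext p
    split_ifs with hp
    · exact quantile_gaussianLaw p.1 z hp
    · exact quantile_of_notMem_quantileDomain (by rwa [quantileDomain_gaussianLaw])
  rw [hpiecewise]
  exact Measurable.ite (measurable_snd (ordConnected_quantileDomain _).measurableSet)
    (measurable_fst.add ((measurable_quantile _).comp measurable_snd)) measurable_const

end QuantileGaussian

lemma integrable_affine_sq (m κ : ℝ) :
    Integrable (fun w => (m + κ * w) ^ 2) (gaussianReal 0 1) :=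
  ((memLp_const m).add ((memLp_id_gaussianReal 2).const_mul κ)).integrable_sq

lemma integral_affine_sq (m κ : ℝ) :
    ∫ w, (m + κ * w) ^ 2 ∂(gaussianReal 0 1) = m ^ 2 + κ ^ 2 := by
  have hlintegral := lintegral_affine_sq_gaussianReal m κ 1
  rw [← ofReal_integral_eq_lintegral_ofReal (integrable_affine_sq m κ)
    (Eventually.of_forall fun w => sq_nonneg _), ENNReal.ofReal_eq_ofReal_iff
    (integral_nonneg fun w => sq_nonneg _) (by positivity)] at hlintegral
  simpa using hlintegral

/-! ### The value function in closed form -/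

namespace OUModel

variable {n : ℕ} {Ω : Type*} (M : OUModel n Ω)

/-- The times `t_k` of the model, indexed by natural numbers; indices beyond `n + 1` stand for the
horizon. -/
def timeNat (k : ℕ) : ℝ := M.time ⟨min k (n + 1), by omega⟩

lemma time_eq_timeNat (i : Fin (n + 2)) : M.time i = M.timeNat i := by
  unfold timeNat
  congr 1
  ext
  exact (min_eq_left (Nat.lt_succ_iff.1 i.2)).symm

lemma obsTime_eq (j : Fin n) : M.obsTime j = M.timeNat (j + 1) := M.time_eq_timeNat _

lemma horizon_eq : M.horizon = M.timeNat (n + 1) := M.time_eq_timeNat _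

/-- The number of observation times up to time `t ≥ t_0`, i.e. the `k ≤ n` such that
`t_k ≤ t < t_{k+1}` if `t` is before the horizon. -/
noncomputable def obsIndex (t : ℝ) : ℕ := Nat.findGreatest (fun k => M.timeNat k ≤ t) n

section Times

variable {M}

lemma timeNat_lt (hmono : StrictMono M.time) {k l : ℕ} (hkl : k < l) (hl : l ≤ n + 1) :
    M.timeNat k < M.timeNat l :=
  hmono (by simp only [Fin.mk_lt_mk]; omega)

lemma timeNat_lt_succ (hmono : StrictMono M.time) {k : ℕ} (hk : k ≤ n) :
    M.timeNat k < M.timeNat (k + 1) :=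
  timeNat_lt hmono k.lt_succ_self (Nat.succ_le_succ hk)

lemma timeNat_mono (hmono : StrictMono M.time) : Monotone M.timeNat := fun k l hkl =>
  hmono.monotone (by simp only [Fin.mk_le_mk]; omega)

lemma timeNat_le_horizon (hmono : StrictMono M.time) (k : ℕ) : M.timeNat k ≤ M.horizon :=
  hmono.monotone (Fin.le_last _)

variable (M) in
lemma obsIndex_le (t : ℝ) : M.obsIndex t ≤ n := Nat.findGreatest_le n

variable (M) in
lemma obsIndex_mono : Monotone M.obsIndex := fun _ _ h =>
  Nat.findGreatest_mono (fun _ hk => le_trans hk h) le_rfl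

lemma timeNat_obsIndex_le {t : ℝ} (ht : M.timeNat 0 ≤ t) : M.timeNat (M.obsIndex t) ≤ t :=
  Nat.findGreatest_spec (P := fun k => M.timeNat k ≤ t) (Nat.zero_le n) ht

lemma lt_timeNat_obsIndex_succ_of_lt {t : ℝ} (ht : M.obsIndex t < n) :
    t < M.timeNat (M.obsIndex t + 1) :=
  not_le.1 <| Nat.findGreatest_is_greatest (P := fun k => M.timeNat k ≤ t) (Nat.lt_succ_self _) ht

lemma lt_timeNat_obsIndex_succ {t : ℝ} (ht : t < M.horizon) :
    t < M.timeNat (M.obsIndex t + 1) := by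
  rcases (M.obsIndex_le t).lt_or_eq with hlt | heq
  · exact lt_timeNat_obsIndex_succ_of_lt hlt
  · rwa [heq, ← horizon_eq]

lemma obsIndex_eq (hmono : StrictMono M.time) {k : ℕ} {t : ℝ} (hk : k ≤ n)
    (ht : t ∈ Set.Ico (M.timeNat k) (M.timeNat (k + 1))) : M.obsIndex t = k := by
  refine le_antisymm ?_ (Nat.le_findGreatest hk ht.1)
  by_contra! hlt
  have h0 : M.timeNat 0 ≤ t := (timeNat_mono hmono k.zero_le).trans ht.1
  exact ht.2.not_ge ((timeNat_mono hmono hlt).trans (timeNat_obsIndex_le h0))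

lemma mem_Ico_obsIndex {t : ℝ} (ht : t ∈ Set.Ico (M.time 0) M.horizon) :
    t ∈ Set.Ico (M.timeNat (M.obsIndex t)) (M.timeNat (M.obsIndex t + 1)) :=
  ⟨timeNat_obsIndex_le ((M.time_eq_timeNat 0).symm.trans_le ht.1), lt_timeNat_obsIndex_succ ht.2⟩

end Times

/-- The cost-to-go due to the variance just before an observation, as a function of the number of
the remaining observations (that one included). -/
noncomputable def varCostToGo : ℕ → ℝ → ℝ
  | 0, z => z
  | d + 1, z => riccati M.θ M.C (M.horizon - M.timeNat (n - d)) * (z ^ 2 / (z + M.ε ^ 2)) +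
      varCost M.θ M.b (varCostToGo d) (M.timeNat (n + 1 - d) - M.timeNat (n - d))
        (posteriorVar M.ε z)

/-- The cost-to-go due to the variance just before the time `t_k`. -/
noncomputable def priorCost (k : ℕ) : ℝ → ℝ := M.varCostToGo (n + 1 - k)

lemma priorCost_last (z : ℝ) : M.priorCost (n + 1) z = z := by
  simp [priorCost, varCostToGo]

lemma priorCost_eq {k : ℕ} (hk : k ≤ n) (z : ℝ) : M.priorCost k z =
    riccati M.θ M.C (M.horizon - M.timeNat k) * (z ^ 2 / (z + M.ε ^ 2)) +
      varCost M.θ M.b (M.priorCost (k + 1)) (M.timeNat (k + 1) - M.timeNat k)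
        (posteriorVar M.ε z) := by
  obtain ⟨d, rfl⟩ := Nat.exists_eq_add_of_le hk
  simp only [priorCost, show k + d + 1 - k = d + 1 by omega, show k + d + 1 - (k + 1) = d by omega,
    varCostToGo, show k + d - d = k by omega, show k + d + 1 - d = k + 1 by omega]

/-- The value at Gaussian laws at the times `t ∈ [t_k, t_{k+1}]`. -/
noncomputable def gaussCost (k : ℕ) (t m z : ℝ) : ℝ :=
  riccati M.θ M.C (M.horizon - t) * m ^ 2 +
    varCost M.θ M.b (M.priorCost (k + 1)) (M.timeNat (k + 1) - t) z

variable {M}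

lemma varCostToGo_nonneg (hC : 0 < M.C) (hmono : StrictMono M.time) (d : ℕ) :
    ∀ z, 0 ≤ z → 0 ≤ M.varCostToGo d z := by
  induction d with
  | zero => exact fun z hz => by rwa [varCostToGo]
  | succ d ih =>
    intro z hz
    have hric := riccati_pos M.θ hC (sub_nonneg.2 (timeNat_le_horizon hmono (n - d)))
    have hvar := varCost_nonneg M.θ M.b ih (h := M.timeNat (n + 1 - d) - M.timeNat (n - d))
      (sub_nonneg.2 (timeNat_mono hmono (by omega))) (posteriorVar_nonneg M.ε hz)
    rw [varCostToGo]
    positivity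

lemma priorCost_nonneg (hC : 0 < M.C) (hmono : StrictMono M.time) (k : ℕ) :
    ∀ z, 0 ≤ z → 0 ≤ M.priorCost k z := varCostToGo_nonneg hC hmono _

lemma gaussCost_nonneg (hC : 0 < M.C) (hmono : StrictMono M.time) {k : ℕ} {t : ℝ}
    (ht : t ≤ M.timeNat (k + 1)) (m : ℝ) {z : ℝ} (hz : 0 ≤ z) : 0 ≤ M.gaussCost k t m z := by
  have hric := riccati_pos M.θ hC (sub_nonneg.2 (ht.trans (timeNat_le_horizon hmono (k + 1))))
  have hvar := varCost_nonneg M.θ M.b (priorCost_nonneg hC hmono (k + 1)) (sub_nonneg.2 ht) hz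
  unfold gaussCost
  positivity

lemma differentiableWithinAt_varCostToGo (hε : 0 < M.ε) (hmono : StrictMono M.time) (d : ℕ) :
    ∀ z, 0 ≤ z → DifferentiableWithinAt ℝ (M.varCostToGo d) (Set.Ici 0) z := by
  induction d with
  | zero => exact fun z _ => differentiableWithinAt_id
  | succ d ih =>
    intro z hz
    have hne : z + M.ε ^ 2 ≠ 0 := by positivity
    have hh : 0 ≤ M.timeNat (n + 1 - d) - M.timeNat (n - d) :=
      sub_nonneg.2 (timeNat_mono hmono (by omega))
    have hvarCost := hasDerivWithinAt_varCost_right M.θ M.b hh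
      (ih _ (ouVar_nonneg M.θ M.b hh (posteriorVar_nonneg M.ε hz))).hasDerivWithinAt
    have hposterior : DifferentiableAt ℝ (posteriorVar M.ε) z := by
      unfold posteriorVar
      fun_prop (disch := assumption)
    have hmean : DifferentiableAt ℝ (fun z => riccati M.θ M.C (M.horizon - M.timeNat (n - d)) *
        (z ^ 2 / (z + M.ε ^ 2))) z := by
      fun_prop (disch := assumption)
    exact hmean.differentiableWithinAt.add <| hvarCost.differentiableWithinAt.comp z
      hposterior.differentiableWithinAt fun y hy => posteriorVar_nonneg M.ε hy

lemma differentiableWithinAt_priorCost (hε : 0 < M.ε) (hmono : StrictMono M.time) (k : ℕ) {z : ℝ}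
    (hz : 0 ≤ z) : DifferentiableWithinAt ℝ (M.priorCost k) (Set.Ici 0) z :=
  differentiableWithinAt_varCostToGo hε hmono _ z hz

lemma hasDerivWithinAt_varCost_sub (θ b : ℝ) {g : ℝ → ℝ} {g' T t z : ℝ} (hz : 0 ≤ z)
    (hg : HasDerivWithinAt g g' (Set.Ici 0) (ouVar θ b (T - t) z)) :
    HasDerivWithinAt (fun r => varCost θ b g (T - r) z)
      (-(ouVar θ b (T - t) z + g' * (b ^ 2 - 2 * θ * ouVar θ b (T - t) z))) (Set.Iic T) t := by
  refine ((hasDerivWithinAt_varCost_time θ b hz hg).comp t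
    ((hasDerivAt_id t).const_sub T).hasDerivWithinAt fun r hr => ?_).congr_deriv (mul_neg_one _)
  exact Set.mem_Ici.2 (sub_nonneg.2 (Set.mem_Iic.1 hr))

lemma gaussCost_hjb (hC : 0 < M.C) (hε : 0 < M.ε) (hmono : StrictMono M.time) {k : ℕ} {t : ℝ}
    (ht : t ∈ Set.Ico (M.timeNat k) (M.timeNat (k + 1))) (m : ℝ) {z : ℝ} (hz : 0 ≤ z) :
    ∃ Ut Um Uz : ℝ,
      HasDerivWithinAt (fun r => M.gaussCost k r m z) Ut
        (Set.Ico (M.timeNat k) (M.timeNat (k + 1))) t ∧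
      HasDerivAt (fun x => M.gaussCost k t x z) Um m ∧
      HasDerivWithinAt (fun y => M.gaussCost k t m y) Uz (Set.Ici 0) z ∧
      Ut + z + m ^ 2 - M.θ * m * Um + (M.b ^ 2 - 2 * M.θ * z) * Uz
          - 1 / (4 * M.C) * Um ^ 2 = 0 := by
  have htk : 0 ≤ M.timeNat (k + 1) - t := sub_nonneg.2 ht.2.le
  have hg := (differentiableWithinAt_priorCost hε hmono (k + 1)
    (ouVar_nonneg M.θ M.b htk hz)).hasDerivWithinAt
  have htime := ((hasDerivAt_riccati_sub (θ := M.θ) hC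
      (ht.2.le.trans (timeNat_le_horizon hmono (k + 1)))).mul_const (m ^ 2)).hasDerivWithinAt.add
    ((hasDerivWithinAt_varCost_sub M.θ M.b hz hg).mono
      ((Set.Ico_subset_Icc_self (b := M.timeNat k)).trans Set.Icc_subset_Iic_self))
  have hmean := ((hasDerivAt_pow 2 m).const_mul (riccati M.θ M.C (M.horizon - t))).add_const
    (varCost M.θ M.b (M.priorCost (k + 1)) (M.timeNat (k + 1) - t) z)
  refine ⟨_, _, _, htime, hmean, (hasDerivWithinAt_varCost_right M.θ M.b htk hg).const_add _, ?_⟩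
  rw [varCost_transport M.θ M.b _ (M.timeNat (k + 1) - t) z]
  field_simp
  ring

lemma tendsto_gaussCost (hC : 0 < M.C) (hε : 0 < M.ε) (hmono : StrictMono M.time) (k : ℕ) (m : ℝ)
    {z : ℝ} (hz : 0 ≤ z) : Tendsto (fun t => M.gaussCost k t m z) (𝓝[<] M.timeNat (k + 1))
      (𝓝 (riccati M.θ M.C (M.horizon - M.timeNat (k + 1)) * m ^ 2 + M.priorCost (k + 1) z)) := by
  have hg := (differentiableWithinAt_priorCost hε hmono (k + 1)
    (ouVar_nonneg M.θ M.b (sub_self (M.timeNat (k + 1))).ge hz)).hasDerivWithinAt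
  have hvar := (hasDerivWithinAt_varCost_sub M.θ M.b hz hg).continuousWithinAt.mono
    Set.Iio_subset_Iic_self
  have hmean := ((hasDerivAt_riccati_sub (θ := M.θ) hC
    (timeNat_le_horizon hmono (k + 1))).mul_const (m ^ 2)).continuousAt.continuousWithinAt
    (s := Set.Iio (M.timeNat (k + 1)))
  simpa only [gaussCost, sub_self, varCost_zero] using hmean.tendsto.add hvar.tendsto

section ObservationStep

variable {k : ℕ} {z : ℝ}

lemma gaussCost_timeNat_affine (m κ w : ℝ) :
    M.gaussCost k (M.timeNat k) (m + κ * w) (posteriorVar M.ε z) * gaussianPDFReal 0 1 w =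
      gaussianPDFReal 0 1 w * (riccati M.θ M.C (M.horizon - M.timeNat k) * (m + κ * w) ^ 2 +
        varCost M.θ M.b (M.priorCost (k + 1)) (M.timeNat (k + 1) - M.timeNat k)
          (posteriorVar M.ε z)) :=
  mul_comm _ _

lemma integrable_gaussCost (m κ : ℝ) :
    Integrable fun w => M.gaussCost k (M.timeNat k) (m + κ * w) (posteriorVar M.ε z) *
      gaussianPDFReal 0 1 w := by
  simp_rw [gaussCost_timeNat_affine]
  exact integrable_gaussianPDFReal_mul
    (((integrable_affine_sq m κ).const_mul _).add (integrable_const _))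

lemma integral_gaussCost (hk : k ≤ n) (m : ℝ) (hz : 0 ≤ z) :
    ∫ w, M.gaussCost k (M.timeNat k) (m + z / √(z + M.ε ^ 2) * w) (posteriorVar M.ε z) *
        gaussianPDFReal 0 1 w =
      riccati M.θ M.C (M.horizon - M.timeNat k) * m ^ 2 + M.priorCost k z := by
  have hgain : (z / √(z + M.ε ^ 2)) ^ 2 = z ^ 2 / (z + M.ε ^ 2) := by
    rw [div_pow, Real.sq_sqrt (by positivity)]
  simp_rw [gaussCost_timeNat_affine, ← smul_eq_mul (gaussianPDFReal 0 1 _),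
    ← integral_gaussianReal_eq_integral_smul one_ne_zero]
  rw [integral_add ((integrable_affine_sq m _).const_mul _) (integrable_const _),
    integral_const_mul, integral_affine_sq, integral_const, probReal_univ, one_smul, hgain,
    priorCost_eq M hk]
  ring

end ObservationStep

end OUModel

/-! ### Measurability and independence -/

section

variable {Ω : Type*} [MeasurableSpace Ω]

lemma measurable_integral_mul_of_progressive {α : ℝ → Ω → ℝ} {s r q : ℝ} (hsr : s ≤ r)
    (hrq : r ≤ q) (hα : Measurable fun p : Set.Icc s q × Ω => α p.1 p.2) {g : ℝ → ℝ}
    (hg : Measurable g) : Measurable fun ω => ∫ w in r..q, α w ω * g w := by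
  have hproj : Measurable (Function.uncurry fun (w : ℝ) (ω : Ω) =>
      α (Set.projIcc s q (hsr.trans hrq) w) ω * g w) :=
    (hα.comp (((continuous_projIcc (h := hsr.trans hrq)).measurable.comp measurable_fst).prodMk
      measurable_snd)).mul (hg.comp measurable_fst)
  convert (hproj.stronglyMeasurable.integral_prod_left
    (μ := volume.restrict (Set.Ioc r q))).measurable using 2 with ω
  rw [intervalIntegral.integral_of_le hrq]
  refine setIntegral_congr_fun measurableSet_Ioc fun w hw => ?_
  rw [Set.projIcc_of_mem _ (⟨hsr.trans hw.1.le, hw.2⟩ : w ∈ Set.Icc s q)]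

-- The control need not be measurable up to and including `t`, as it may react to the observation
-- made at time `t`; the integral up to `t` is a limit of integrals up to earlier times.
lemma measurable_meanFlow {α : ℝ → Ω → ℝ} {θ s r t : ℝ} (hsr : s ≤ r) (hrt : r < t)
    (hα : ∀ q ∈ Set.Ico r t, Measurable fun p : Set.Icc s q × Ω => α p.1 p.2)
    (hint : ∀ ω, IntervalIntegrable (fun q => α q ω) volume r t) {m : Ω → ℝ} (hm : Measurable m) :
    Measurable fun ω => meanFlow θ (fun q => α q ω) r t (m ω) := by
  have hweight : Measurable fun w : ℝ => Real.exp (θ * (w - r)) := by fun_prop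
  have hlim : Measurable fun ω => ∫ w in r..t, α w ω * Real.exp (θ * (w - r)) := by
    obtain ⟨q, -, hq, hqt⟩ := exists_seq_strictMono_tendsto' hrt
    refine measurable_of_tendsto_metrizable (fun k => measurable_integral_mul_of_progressive hsr
      (hq k).1.le (hα (q k) ⟨(hq k).1.le, (hq k).2⟩) hweight) (tendsto_pi_nhds.2 fun ω => ?_)
    have hprimitive :=
      continuousOn_primitive_Icc hrt.le (intervalIntegrable_mul_exp (θ := θ) (hint ω))
    exact (hprimitive t ⟨hrt.le, le_rfl⟩).tendsto.comp (tendsto_nhdsWithin_iff.2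
      ⟨hqt, Eventually.of_forall fun k => ⟨(hq k).1.le, (hq k).2.le⟩⟩)
  exact (hm.add hlim).const_mul _

lemma measurable_comp_monotone {κ : ℝ → ℕ} (hκ : Monotone κ) {s t : ℝ} {f : ℕ → Ω → ℝ}
    (hf : ∀ k ≤ κ t, Measurable (f k)) :
    Measurable fun p : Set.Icc s t × Ω => f (κ p.1) p.2 := by
  have htrunc : Measurable fun p : ℕ × Ω => f (min p.1 (κ t)) p.2 :=
    measurable_from_prod_countable_right fun k => hf _ (min_le_right _ _)
  have hindex : Measurable fun p : Set.Icc s t × Ω => (κ p.1, p.2) :=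
    (hκ.measurable.comp (measurable_subtype_coe.comp measurable_fst)).prodMk measurable_snd
  convert htrunc.comp hindex using 2 with p
  simp [min_eq_left (hκ p.1.2.2)]

variable {p c : ℝ}

lemma lintegral_quadratic_gaussianReal (hp : 0 ≤ p) (hc : 0 ≤ c) (x κ : ℝ) (v : ℝ≥0) :
    ∫⁻ w, ENNReal.ofReal (p * (x + κ * w) ^ 2 + c) ∂(gaussianReal 0 v) =
      ENNReal.ofReal (p * x ^ 2 + (p * (κ ^ 2 * v) + c)) := by
  have hsplit : ∀ w, ENNReal.ofReal (p * (x + κ * w) ^ 2 + c) =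
      ENNReal.ofReal p * ENNReal.ofReal ((x + κ * w) ^ 2) + ENNReal.ofReal c := fun w => by
    rw [ENNReal.ofReal_add (by positivity) hc, ENNReal.ofReal_mul hp]
  simp_rw [hsplit]
  rw [lintegral_add_right _ measurable_const, lintegral_const_mul _ (by fun_prop),
    lintegral_affine_sq_gaussianReal, lintegral_const, measure_univ, mul_one,
    ← ENNReal.ofReal_mul hp, ← ENNReal.ofReal_add (by positivity) hc]
  congr 1
  ring

lemma lintegral_quadratic_of_indepFun {P : Measure Ω} [IsProbabilityMeasure P] {m W : Ω → ℝ}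
    (hm : Measurable m) (hW : Measurable W) (hind : IndepFun m W P) {v : ℝ≥0}
    (hlaw : P.map W = gaussianReal 0 v) (hp : 0 ≤ p) (hc : 0 ≤ c) (κ : ℝ) :
    ∫⁻ ω, ENNReal.ofReal (p * (m ω + κ * W ω) ^ 2 + c) ∂P =
      ∫⁻ ω, ENNReal.ofReal (p * m ω ^ 2 + (p * (κ ^ 2 * v) + c)) ∂P := by
  have hprod := (indepFun_iff_map_prod_eq_prod_map_map hm.aemeasurable hW.aemeasurable).1 hind
  have hmeas : Measurable fun x : ℝ × ℝ => ENNReal.ofReal (p * (x.1 + κ * x.2) ^ 2 + c) := by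
    fun_prop
  calc ∫⁻ ω, ENNReal.ofReal (p * (m ω + κ * W ω) ^ 2 + c) ∂P
    _ = ∫⁻ x, ENNReal.ofReal (p * (x.1 + κ * x.2) ^ 2 + c) ∂(P.map fun ω => (m ω, W ω)) := by
        rw [lintegral_map hmeas (hm.prodMk hW)]
    _ = ∫⁻ x, ENNReal.ofReal (p * x ^ 2 + (p * (κ ^ 2 * v) + c)) ∂(P.map m) := by
        rw [hprod, hlaw, lintegral_prod _ hmeas.aemeasurable]
        simp_rw [lintegral_quadratic_gaussianReal hp hc]
    _ = ∫⁻ ω, ENNReal.ofReal (p * m ω ^ 2 + (p * (κ ^ 2 * v) + c)) ∂P :=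
        lintegral_map (by fun_prop) hm

end

namespace OUModel

variable {n : ℕ} {Ω : Type*} (M : OUModel n Ω)

/-- The variables `U_1, …, U_n, Z_1, …, Z_n` that drive the observations. -/
def driving : Fin n ⊕ Fin n → Ω → ℝ := Sum.elim M.U M.Z

/-- The `σ`-algebra generated by the variables that drive the first `k` observations. -/
abbrev drivingSigma (k : ℕ) : MeasurableSpace Ω :=
  ⨆ l ∈ {l : Fin n ⊕ Fin n | Sum.elim Fin.val Fin.val l < k},
    MeasurableSpace.comap (M.driving l) inferInstance

/-- The observation error `F[𝒩(0, v)]⁻¹(U_j) + ε Z_j` when the law before the `j`-th observation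
is Gaussian with variance `v`, centred at the mean of that law. -/
noncomputable def innovation (v : ℝ) (j : Fin n) (ω : Ω) : ℝ :=
  quantile (gaussianLaw 0 v : Measure ℝ) (M.U j ω) + M.ε * M.Z j ω

lemma drivingSigma_mono : Monotone M.drivingSigma :=
  fun _ _ h => biSup_mono fun _ hl => lt_of_lt_of_le hl h

lemma measurable_driving_iSup {S : Set (Fin n ⊕ Fin n)} {l : Fin n ⊕ Fin n} (hl : l ∈ S) :
    Measurable[⨆ l ∈ S, MeasurableSpace.comap (M.driving l) inferInstance] (M.driving l) :=
  (comap_measurable (M.driving l)).mono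
    (le_biSup (fun l => MeasurableSpace.comap (M.driving l) inferInstance) hl) le_rfl

lemma measurable_innovation [MeasurableSpace Ω] {j : Fin n} (hU : Measurable (M.U j))
    (hZ : Measurable (M.Z j)) (v : ℝ) : Measurable (M.innovation v j) :=
  ((measurable_quantile _).comp hU).add (hZ.const_mul _)

lemma measurable_innovation_iSup (v : ℝ) (j : Fin n) :
    Measurable[⨆ l ∈ ({Sum.inl j, Sum.inr j} : Set (Fin n ⊕ Fin n)),
      MeasurableSpace.comap (M.driving l) inferInstance] (M.innovation v j) := by
  set 𝒜 : MeasurableSpace Ω := ⨆ l ∈ ({Sum.inl j, Sum.inr j} : Set (Fin n ⊕ Fin n)),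
    MeasurableSpace.comap (M.driving l) inferInstance
  have hU : Measurable[𝒜] (M.U j) := M.measurable_driving_iSup (l := Sum.inl j) (by simp)
  have hZ : Measurable[𝒜] (M.Z j) := M.measurable_driving_iSup (l := Sum.inr j) (by simp)
  exact M.measurable_innovation hU hZ v

variable {M}

lemma obsSigma_le {prior : Fin n → Ω → ProbabilityMeasure ℝ} {s t : ℝ} {𝒜 : MeasurableSpace Ω}
    (h : ∀ j, s < M.obsTime j → M.obsTime j ≤ t → Measurable[𝒜] (M.observation prior j)) :
    M.obsSigma prior s t ≤ 𝒜 := by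
  refine iSup₂_le fun j hj => ?_
  rw [← BorelSpace.measurable_eq (α := ℝ)]
  exact (h j hj.1 hj.2).comap_le

lemma measurable_observation_obsSigma (prior : Fin n → Ω → ProbabilityMeasure ℝ) {s t : ℝ}
    {j : Fin n} (hs : s < M.obsTime j) (ht : M.obsTime j ≤ t) :
    Measurable[M.obsSigma prior s t] (M.observation prior j) := by
  rw [BorelSpace.measurable_eq (α := ℝ)]
  exact (comap_measurable _).mono
    (le_iSup₂_of_le (f := fun (j : Fin n) (_ : s < M.obsTime j ∧ M.obsTime j ≤ t) =>
      MeasurableSpace.comap (M.observation prior j) (borel ℝ)) j ⟨hs, ht⟩ le_rfl) le_rfl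

/-- The standing assumptions on the variables that drive the observations: they are independent,
the `U_j` uniform on `[0, 1]` and the `Z_j` standard normal. -/
structure IsDriven [MeasurableSpace Ω] (M : OUModel n Ω) (P : Measure Ω) : Prop where
  measurable_U : ∀ j, Measurable (M.U j)
  measurable_Z : ∀ j, Measurable (M.Z j)
  map_U : ∀ j, P.map (M.U j) = volume.restrict (Set.Icc (0 : ℝ) 1)
  map_Z : ∀ j, P.map (M.Z j) = gaussianReal 0 1
  indep : iIndepFun M.driving P

namespace IsDriven

variable [mΩ : MeasurableSpace Ω] {P : Measure Ω}

lemma measurable_driving (hP : M.IsDriven P) : ∀ l, Measurable (M.driving l)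
  | Sum.inl j => hP.measurable_U j
  | Sum.inr j => hP.measurable_Z j

lemma drivingSigma_le (hP : M.IsDriven P) (k : ℕ) : M.drivingSigma k ≤ mΩ :=
  iSup₂_le fun l _ => (hP.measurable_driving l).comap_le

lemma indepFun_innovation (hP : M.IsDriven P) (v : ℝ) (j : Fin n) {m : Ω → ℝ}
    (hm : Measurable[M.drivingSigma j] m) : IndepFun m (M.innovation v j) P := by
  have hdisj : Disjoint {l : Fin n ⊕ Fin n | Sum.elim Fin.val Fin.val l < (j : ℕ)}
      {Sum.inl j, Sum.inr j} := by
    rw [Set.disjoint_left]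
    rintro l hl (rfl | rfl) <;> exact lt_irrefl (j : ℕ) hl
  have hindep := indep_iSup_of_disjoint (fun l => (hP.measurable_driving l).comap_le)
    hP.indep.iIndep hdisj
  rw [IndepFun_iff_Indep]
  exact indep_of_indep_of_le_right (indep_of_indep_of_le_left hindep hm.comap_le)
    (M.measurable_innovation_iSup v j).comap_le

lemma map_innovation (hP : M.IsDriven P) {v : ℝ} (hv : 0 ≤ v) (j : Fin n) :
    P.map (M.innovation v j) = gaussianReal 0 (v + M.ε ^ 2).toNNReal := by
  have hUZ : IndepFun (M.U j) (M.Z j) P :=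
    hP.indep.indepFun (i := Sum.inl j) (j := Sum.inr j) (by simp)
  have hind := hUZ.comp (measurable_quantile (gaussianLaw 0 v : Measure ℝ))
    (measurable_const_mul M.ε)
  have hsample : P.map (quantile (gaussianLaw 0 v : Measure ℝ) ∘ M.U j) =
      gaussianReal 0 v.toNNReal := by
    rw [← Measure.map_map (measurable_quantile _) (hP.measurable_U j), hP.map_U, map_quantile]
    rfl
  have hnoise : P.map ((fun x => M.ε * x) ∘ M.Z j) = gaussianReal 0 (M.ε ^ 2).toNNReal := by
    rw [← Measure.map_map (measurable_const_mul M.ε) (hP.measurable_Z j), hP.map_Z,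
      gaussianReal_map_const_mul, mul_zero, mul_one]
    congr 1
    ext
    simp [Real.coe_toNNReal _ (sq_nonneg M.ε)]
  have hsum := gaussianReal_add_gaussianReal_of_indepFun hind hsample hnoise
  rwa [add_zero, ← Real.toNNReal_add hv (sq_nonneg _)] at hsum

lemma ae_U_mem_Ioo (hP : M.IsDriven P) (j : Fin n) : ∀ᵐ ω ∂P, M.U j ω ∈ Set.Ioo (0 : ℝ) 1 := by
  refine ae_of_ae_map (hP.measurable_U j).aemeasurable ?_
  rw [hP.map_U, ← restrict_Ioo_eq_restrict_Icc]
  exact ae_restrict_mem measurableSet_Ioo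

end IsDriven

end OUModel

/-! ### The law along a controlled path -/

lemma integral_id_gaussianLaw (m z : ℝ) : ∫ x, x ∂(gaussianLaw m z : Measure ℝ) = m :=
  integral_id_gaussianReal

lemma tendsto_gaussianLaw_meanFlow {θ b r t m z : ℝ} {a : ℝ → ℝ} (hrt : r < t)
    (ha : IntervalIntegrable a volume r t) :
    Tendsto (fun q => gaussianLaw (meanFlow θ a r q m) (ouVar θ b (q - r) z)) (𝓝[<] t)
      (𝓝 (gaussianLaw (meanFlow θ a r t m) (ouVar θ b (t - r) z))) := by
  rw [← nhdsWithin_Ioo_eq_nhdsLT hrt]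
  refine tendsto_gaussianLaw ?_ ?_
  · exact ((continuousOn_meanFlow hrt.le ha) t ⟨hrt.le, le_rfl⟩).mono Set.Ioo_subset_Icc_self
  · exact ((continuous_ouVar_left θ b z).comp
      (continuous_id.sub continuous_const)).continuousWithinAt

namespace OUModel

variable {n : ℕ} {Ω : Type*} (M : OUModel n Ω)

/-- The start of the `k`-th stage `[t_k, t_{k+1}]`, restricted to the times from `s` on. -/
def stageStart (s : ℝ) (k : ℕ) : ℝ := max s (M.timeNat k)

/-- The variance at the start of the `k`-th stage, for the variance `z₀` at time `s`. The Bayesian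
update changes the variance by an amount that does not depend on the observed value, so it is
deterministic. -/
noncomputable def postVar (s z₀ : ℝ) : ℕ → ℝ
  | 0 => z₀
  | k + 1 =>
    if s < M.timeNat (k + 1) then
      posteriorVar M.ε (ouVar M.θ M.b (M.timeNat (k + 1) - M.stageStart s k) (postVar s z₀ k))
    else z₀

/-- The variance just before the end of the `k`-th stage, for the variance `z₀` at time `s`. -/
noncomputable def preVar (s z₀ : ℝ) (k : ℕ) : ℝ :=
  ouVar M.θ M.b (M.timeNat (k + 1) - M.stageStart s k) (M.postVar s z₀ k)

/-- The conditional mean of the state at time `t`. -/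
noncomputable def condMean (μ : ℝ → Ω → ProbabilityMeasure ℝ) (t : ℝ) (ω : Ω) : ℝ :=
  ∫ x, x ∂(μ t ω : Measure ℝ)

/-- The conditional mean just before the end of the `k`-th stage. -/
noncomputable def preMean (s : ℝ) (α : ℝ → Ω → ℝ) (μ : ℝ → Ω → ProbabilityMeasure ℝ) (k : ℕ)
    (ω : Ω) : ℝ :=
  meanFlow M.θ (fun q => α q ω) (M.stageStart s k) (M.timeNat (k + 1))
    (condMean μ (M.stageStart s k) ω)

variable {M} {s z₀ : ℝ} {k : ℕ}

lemma le_stageStart : s ≤ M.stageStart s k := le_max_left _ _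

lemma timeNat_le_stageStart : M.timeNat k ≤ M.stageStart s k := le_max_right _ _

lemma stageStart_of_le (hs : M.timeNat k ≤ s) : M.stageStart s k = s := max_eq_left hs

lemma stageStart_of_lt (hs : s < M.timeNat k) : M.stageStart s k = M.timeNat k :=
  max_eq_right hs.le

lemma stageStart_lt (hmono : StrictMono M.time) (hk : k ≤ n) (hs : s < M.timeNat (k + 1)) :
    M.stageStart s k < M.timeNat (k + 1) :=
  max_lt hs (timeNat_lt_succ hmono hk)

lemma stageStart_obsTime (j : Fin n) (hs : s < M.obsTime j) :
    M.stageStart s (j + 1) = M.obsTime j := by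
  rw [obsTime_eq] at hs ⊢
  exact stageStart_of_lt hs

lemma postVar_of_le (hs : M.timeNat k ≤ s) : M.postVar s z₀ k = z₀ := by
  cases k with
  | zero => rw [postVar]
  | succ k => rw [postVar, if_neg hs.not_gt]

lemma postVar_succ (hs : s < M.timeNat (k + 1)) :
    M.postVar s z₀ (k + 1) = posteriorVar M.ε (M.preVar s z₀ k) := by
  rw [postVar, if_pos hs, preVar]

lemma postVar_nonneg (hmono : StrictMono M.time) (hz₀ : 0 ≤ z₀) :
    ∀ k, 0 ≤ M.postVar s z₀ k
  | 0 => by rwa [postVar]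
  | k + 1 => by
    rcases lt_or_ge s (M.timeNat (k + 1)) with hs | hs
    · rw [postVar_succ hs]
      exact posteriorVar_nonneg M.ε (ouVar_nonneg M.θ M.b
        (sub_nonneg.2 (max_le hs.le (timeNat_mono hmono k.le_succ))) (postVar_nonneg hmono hz₀ k))
    · rwa [postVar_of_le hs]

lemma preVar_nonneg (hmono : StrictMono M.time) (hz₀ : 0 ≤ z₀) (hs : s < M.timeNat (k + 1)) :
    0 ≤ M.preVar s z₀ k :=
  ouVar_nonneg M.θ M.b (sub_nonneg.2 (max_le hs.le (timeNat_mono hmono k.le_succ)))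
    (postVar_nonneg hmono hz₀ k)

lemma obsTime_notMem_Ioc (hmono : StrictMono M.time) {x y : ℝ} (hx : M.timeNat k ≤ x)
    (hy : y < M.timeNat (k + 1) ∨ n ≤ k) (j : Fin n) : M.obsTime j ∉ Set.Ioc x y := by
  rw [obsTime_eq]
  rintro ⟨hxj, hjy⟩
  have hkj : k < j + 1 := by
    by_contra! hjk
    exact ((timeNat_mono hmono hjk).trans hx).not_gt hxj
  rcases hy with hy | hy
  · exact (hy.trans_le (timeNat_mono hmono hkj)).not_ge hjy
  · omega

namespace IsControlledPath

variable {μ₀ : ProbabilityMeasure ℝ} {α : ℝ → Ω → ℝ} {μ : ℝ → Ω → ProbabilityMeasure ℝ}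
  {prior : Fin n → Ω → ProbabilityMeasure ℝ}

lemma intervalIntegrable (h : M.IsControlledPath s μ₀ α μ prior) {r t : ℝ} (hr : s ≤ r)
    (hrt : r ≤ t) (ht : t ≤ M.horizon) (ω : Ω) :
    IntervalIntegrable (fun q => α q ω) volume r t := by
  rw [intervalIntegrable_iff_integrableOn_Icc_of_le hrt]
  exact (h.integrable ω).mono_set (Set.Icc_subset_Icc hr ht)

lemma intervalIntegrable_stage (h : M.IsControlledPath s μ₀ α μ prior) (hmono : StrictMono M.time)
    (hs : s < M.timeNat (k + 1)) (ω : Ω) :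
    IntervalIntegrable (fun q => α q ω) volume (M.stageStart s k) (M.timeNat (k + 1)) :=
  h.intervalIntegrable le_stageStart (max_le hs.le (timeNat_mono hmono k.le_succ))
    (timeNat_le_horizon hmono _) ω

lemma solvesFokkerPlanck (h : M.IsControlledPath s μ₀ α μ prior) (hmono : StrictMono M.time)
    {q : ℝ} (hqT : q ≤ M.horizon) (hq : q < M.timeNat (k + 1) ∨ n ≤ k) (ω : Ω) :
    SolvesFokkerPlanck M.θ M.b (fun t => α t ω) (fun t => μ t ω) (M.stageStart s k) q :=
  fun f hf x y hx hxy hy => h.fokkerPlanck ω f hf.smooth hf.support x y (le_stageStart.trans hx)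
    hxy (hy.trans hqT) (obsTime_notMem_Ioc hmono (timeNat_le_stageStart.trans hx)
      (hq.imp_left hy.trans_lt))

variable {m v : ℝ} {ω : Ω}

lemma eq_gaussianLaw (h : M.IsControlledPath s μ₀ α μ prior) (hmono : StrictMono M.time) {q : ℝ}
    (hkq : M.stageStart s k ≤ q) (hqT : q ≤ M.horizon) (hq : q < M.timeNat (k + 1) ∨ n ≤ k)
    (hv : 0 ≤ v) (hμ : μ (M.stageStart s k) ω = gaussianLaw m v) :
    μ q ω = gaussianLaw (meanFlow M.θ (fun t => α t ω) (M.stageStart s k) q m)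
      (ouVar M.θ M.b (q - M.stageStart s k) v) :=
  (h.solvesFokkerPlanck hmono hqT hq ω).eq_gaussianLaw hkq
    (h.intervalIntegrable le_stageStart hkq hqT ω) hv hμ

lemma prior_eq_gaussianLaw_of_stageStart (h : M.IsControlledPath s μ₀ α μ prior)
    (hmono : StrictMono M.time) (j : Fin n) (hs : s < M.obsTime j) (hv : 0 ≤ v)
    (hμ : μ (M.stageStart s j) ω = gaussianLaw m v) :
    prior j ω = gaussianLaw
      (meanFlow M.θ (fun t => α t ω) (M.stageStart s j) (M.timeNat (j + 1)) m)
      (ouVar M.θ M.b (M.timeNat (j + 1) - M.stageStart s j) v) := by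
  have hleft := h.leftLimit ω j hs
  rw [obsTime_eq] at hleft hs
  have hlt := stageStart_lt hmono j.2.le hs
  refine tendsto_nhds_unique hleft
    ((tendsto_gaussianLaw_meanFlow hlt (h.intervalIntegrable_stage hmono hs ω)).congr' ?_)
  filter_upwards [Ioo_mem_nhdsLT hlt] with q hq
  exact (h.eq_gaussianLaw hmono hq.1.le (hq.2.le.trans (timeNat_le_horizon hmono _)) (Or.inl hq.2)
    hv hμ).symm

lemma stageStart_eq_gaussianLaw_of_prior (h : M.IsControlledPath s μ₀ α μ prior) (hε : 0 < M.ε)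
    (j : Fin n) (hs : s < M.obsTime j) (hv : 0 ≤ v) (hprior : prior j ω = gaussianLaw m v) :
    μ (M.stageStart s (j + 1)) ω =
      gaussianLaw (m + v / (v + M.ε ^ 2) * (M.observation prior j ω - m))
        (posteriorVar M.ε v) := by
  have hupdate := h.update ω j hs
  rw [hprior, bayesUpdate_gaussianLaw hε hv] at hupdate
  rw [stageStart_obsTime j hs]
  exact Subtype.ext hupdate

lemma law_stageStart {m₀ : ℝ} (h : M.IsControlledPath s (gaussianLaw m₀ z₀) α μ prior)
    (hε : 0 < M.ε) (hmono : StrictMono M.time) (hs : M.timeNat 0 ≤ s) (hz₀ : 0 ≤ z₀) (ω : Ω)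
    (hk : k ≤ n) : μ (M.stageStart s k) ω =
      gaussianLaw (condMean μ (M.stageStart s k) ω) (M.postVar s z₀ k) := by
  suffices ∃ m, μ (M.stageStart s k) ω = gaussianLaw m (M.postVar s z₀ k) by
    obtain ⟨m, hm⟩ := this
    rw [condMean, hm, integral_id_gaussianLaw]
  induction k with
  | zero => exact ⟨m₀, by rw [stageStart_of_le hs, postVar, h.initial]⟩
  | succ k ih =>
    obtain ⟨m, hm⟩ := ih (by omega)
    rcases lt_or_ge s (M.timeNat (k + 1)) with hlt | hge
    · have hj : s < M.obsTime ⟨k, hk⟩ := by rwa [obsTime_eq]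
      have hprior :=
        h.prior_eq_gaussianLaw_of_stageStart hmono ⟨k, hk⟩ hj (postVar_nonneg hmono hz₀ k) hm
      rw [postVar_succ hlt]
      exact ⟨_, h.stageStart_eq_gaussianLaw_of_prior hε ⟨k, hk⟩ hj
        (preVar_nonneg hmono hz₀ hlt) hprior⟩
    · exact ⟨m₀, by rw [stageStart_of_le hge, postVar_of_le hge, h.initial]⟩

lemma prior_eq_gaussianLaw {m₀ : ℝ} (h : M.IsControlledPath s (gaussianLaw m₀ z₀) α μ prior)
    (hε : 0 < M.ε) (hmono : StrictMono M.time) (hs : M.timeNat 0 ≤ s) (hz₀ : 0 ≤ z₀) (ω : Ω)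
    (j : Fin n) (hj : s < M.obsTime j) :
    prior j ω = gaussianLaw (M.preMean s α μ j ω) (M.preVar s z₀ j) :=
  h.prior_eq_gaussianLaw_of_stageStart hmono j hj (postVar_nonneg hmono hz₀ j)
    (h.law_stageStart hε hmono hs hz₀ ω j.2.le)

lemma condMean_obsTime {m₀ : ℝ} (h : M.IsControlledPath s (gaussianLaw m₀ z₀) α μ prior)
    (hε : 0 < M.ε) (hmono : StrictMono M.time) (hs : M.timeNat 0 ≤ s) (hz₀ : 0 ≤ z₀) (ω : Ω)
    (j : Fin n) (hj : s < M.obsTime j) :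
    condMean μ (M.stageStart s (j + 1)) ω = M.preMean s α μ j ω +
      M.preVar s z₀ j / (M.preVar s z₀ j + M.ε ^ 2) *
        (M.observation prior j ω - M.preMean s α μ j ω) := by
  rw [condMean, h.stageStart_eq_gaussianLaw_of_prior hε j hj
    (preVar_nonneg hmono hz₀ (by rwa [← obsTime_eq]))
    (h.prior_eq_gaussianLaw hε hmono hs hz₀ ω j hj), integral_id_gaussianLaw]

end IsControlledPath

end OUModel

namespace OUModel

variable {n : ℕ} {Ω : Type*} {M : OUModel n Ω} {s m₀ z₀ : ℝ} {k : ℕ}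
  {α : ℝ → Ω → ℝ} {μ : ℝ → Ω → ProbabilityMeasure ℝ} {prior : Fin n → Ω → ProbabilityMeasure ℝ}

namespace IsControlledPath

lemma measurable_preMean_of_past {μ₀ : ProbabilityMeasure ℝ} (h : M.IsControlledPath s μ₀ α μ prior)
    (hmono : StrictMono M.time) (hk : k ≤ n) (hs : s < M.timeNat (k + 1))
    (hmean : Measurable[M.drivingSigma k] (condMean μ (M.stageStart s k)))
    (hobs : ∀ j : Fin n, s < M.obsTime j → j < k →
      Measurable[M.drivingSigma k] (M.observation prior j)) :
    Measurable[M.drivingSigma k] (M.preMean s α μ k) := by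
  refine @measurable_meanFlow Ω (M.drivingSigma k) α M.θ s _ _ le_stageStart
    (stageStart_lt hmono hk hs) (fun q hq => ?_) (h.intervalIntegrable_stage hmono hs) _ hmean
  refine (h.adapted q ⟨le_stageStart.trans hq.1, hq.2.le.trans
    (timeNat_le_horizon hmono _)⟩).mono (sup_le_sup le_rfl (MeasurableSpace.comap_mono
      (obsSigma_le fun j hj hjq => hobs j hj ?_))) le_rfl
  by_contra! hkj
  rw [obsTime_eq] at hjq
  exact ((timeNat_mono hmono (Nat.succ_le_succ hkj)).trans hjq).not_gt hq.2

variable (h : M.IsControlledPath s (gaussianLaw m₀ z₀) α μ prior)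
include h

lemma observation_eq (hε : 0 < M.ε) (hmono : StrictMono M.time) (hs : M.timeNat 0 ≤ s)
    (hz₀ : 0 ≤ z₀) (j : Fin n) (hj : s < M.obsTime j) (ω : Ω) :
    M.observation prior j ω =
      quantile (gaussianLaw (M.preMean s α μ j ω) (M.preVar s z₀ j) : Measure ℝ) (M.U j ω) +
        M.ε * M.Z j ω := by
  rw [observation, h.prior_eq_gaussianLaw hε hmono hs hz₀ ω j hj]

lemma measurable_observation (hε : 0 < M.ε) (hmono : StrictMono M.time) (hs : M.timeNat 0 ≤ s)
    (hz₀ : 0 ≤ z₀) (j : Fin n) (hj : s < M.obsTime j)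
    (hpre : Measurable[M.drivingSigma j] (M.preMean s α μ j)) :
    Measurable[M.drivingSigma (j + 1)] (M.observation prior j) := by
  have hU : Measurable[M.drivingSigma (j + 1)] (M.U j) :=
    M.measurable_driving_iSup (S := {l | Sum.elim Fin.val Fin.val l < (j : ℕ) + 1})
      (l := Sum.inl j) (by simp)
  have hZ : Measurable[M.drivingSigma (j + 1)] (M.Z j) :=
    M.measurable_driving_iSup (S := {l | Sum.elim Fin.val Fin.val l < (j : ℕ) + 1})
      (l := Sum.inr j) (by simp)
  rw [funext (h.observation_eq hε hmono hs hz₀ j hj)]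
  exact ((measurable_quantile_gaussianLaw _).comp
    ((hpre.mono (M.drivingSigma_mono (Nat.le_succ _)) le_rfl).prodMk hU)).add (hZ.const_mul _)

lemma measurable_condMean_and_observation (hε : 0 < M.ε) (hmono : StrictMono M.time)
    (hs : M.timeNat 0 ≤ s) (hz₀ : 0 ≤ z₀) (hk : k ≤ n) :
    Measurable[M.drivingSigma k] (condMean μ (M.stageStart s k)) ∧
      ∀ j : Fin n, s < M.obsTime j → j < k →
        Measurable[M.drivingSigma k] (M.observation prior j) := by
  have hinitial : ∀ l, M.timeNat l ≤ s →
      Measurable[M.drivingSigma l] (condMean μ (M.stageStart s l)) := fun l hl => by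
    have hconst : condMean μ s = fun _ => ∫ x, x ∂(gaussianLaw m₀ z₀ : Measure ℝ) :=
      funext fun ω => by rw [condMean, h.initial]
    rw [stageStart_of_le hl, hconst]
    exact measurable_const
  induction k with
  | zero => exact ⟨hinitial 0 hs, fun j _ hj => absurd hj (Nat.not_lt_zero _)⟩
  | succ k ih =>
    obtain ⟨hmean, hobs⟩ := ih (by omega)
    have hle := M.drivingSigma_mono k.le_succ
    rcases lt_or_ge s (M.timeNat (k + 1)) with hlt | hge
    · have hj : s < M.obsTime ⟨k, hk⟩ := by rwa [obsTime_eq]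
      have hpre := h.measurable_preMean_of_past hmono (by omega) hlt hmean hobs
      have hobs_k := h.measurable_observation hε hmono hs hz₀ ⟨k, hk⟩ hj hpre
      refine ⟨?_, fun j hsj hjk => ?_⟩
      · rw [funext fun ω => h.condMean_obsTime hε hmono hs hz₀ ω ⟨k, hk⟩ hj]
        exact (hpre.mono hle le_rfl).add
          ((hobs_k.sub (hpre.mono hle le_rfl)).const_mul _)
      · rcases (Nat.lt_succ_iff_lt_or_eq.1 hjk) with hlt | heq
        · exact (hobs j hsj hlt).mono hle le_rfl
        · rwa [show j = ⟨k, hk⟩ from Fin.ext heq]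
    · refine ⟨hinitial _ hge, fun j hsj hjk => ?_⟩
      rw [obsTime_eq] at hsj
      exact absurd (hsj.trans_le ((timeNat_mono hmono hjk).trans hge)) (lt_irrefl s)

lemma measurable_preMean (hε : 0 < M.ε) (hmono : StrictMono M.time) (hs : M.timeNat 0 ≤ s)
    (hz₀ : 0 ≤ z₀) (hk : k ≤ n) (hsk : s < M.timeNat (k + 1)) :
    Measurable[M.drivingSigma k] (M.preMean s α μ k) :=
  have ⟨hmean, hobs⟩ := h.measurable_condMean_and_observation hε hmono hs hz₀ hk
  h.measurable_preMean_of_past hmono hk hsk hmean hobs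

lemma condMean_obsTime_ae [MeasurableSpace Ω] {P : Measure Ω} (hP : M.IsDriven P) (hε : 0 < M.ε)
    (hmono : StrictMono M.time) (hs : M.timeNat 0 ≤ s) (hz₀ : 0 ≤ z₀) (j : Fin n)
    (hj : s < M.obsTime j) :
    ∀ᵐ ω ∂P, condMean μ (M.stageStart s (j + 1)) ω = M.preMean s α μ j ω +
      M.preVar s z₀ j / (M.preVar s z₀ j + M.ε ^ 2) * M.innovation (M.preVar s z₀ j) j ω := by
  filter_upwards [hP.ae_U_mem_Ioo j] with ω hω
  rw [h.condMean_obsTime hε hmono hs hz₀ ω j hj, h.observation_eq hε hmono hs hz₀ j hj,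
    quantile_gaussianLaw _ _ (Ioo_subset_quantileDomain _ hω), innovation]
  ring

end IsControlledPath

/-! ### The cost of a controlled path -/

/-- The running cost at time `t`. -/
noncomputable def runningCost (M : OUModel n Ω) (α : ℝ → Ω → ℝ) (μ : ℝ → Ω → ProbabilityMeasure ℝ)
    (ω : Ω) (t : ℝ) : ℝ≥0∞ :=
  secondMoment (μ t ω : Measure ℝ) + ENNReal.ofReal (M.C * α t ω ^ 2)

/-- The feedback form of the optimal control of the linear quadratic problem. -/
def IsFeedback (M : OUModel n Ω) (s : ℝ) (α : ℝ → Ω → ℝ)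
    (μ : ℝ → Ω → ProbabilityMeasure ℝ) : Prop :=
  ∀ ω, ∀ t ∈ Set.Icc s M.horizon, α t ω =
    -(riccati M.θ M.C (M.horizon - t) * condMean μ t ω / M.C)

/-- The expected cost of a controlled path that is stopped at the start of the `k`-th stage against
the payment of the closed-form value. -/
noncomputable def costAfter [MeasurableSpace Ω] (M : OUModel n Ω) (P : Measure Ω) (s z₀ : ℝ)
    (α : ℝ → Ω → ℝ) (μ : ℝ → Ω → ProbabilityMeasure ℝ) (k : ℕ) : ℝ≥0∞ :=
  ∫⁻ ω, ((∫⁻ q in Set.Ioc s (M.stageStart s k), M.runningCost α μ ω q) +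
    ENNReal.ofReal (M.gaussCost k (M.stageStart s k) (condMean μ (M.stageStart s k) ω)
      (M.postVar s z₀ k))) ∂P

/-- The expected cost of a controlled path that is stopped just before the end of the `k`-th stage
against the payment of the closed-form value. -/
noncomputable def costBefore [MeasurableSpace Ω] (M : OUModel n Ω) (P : Measure Ω) (s z₀ : ℝ)
    (α : ℝ → Ω → ℝ) (μ : ℝ → Ω → ProbabilityMeasure ℝ) (k : ℕ) : ℝ≥0∞ :=
  ∫⁻ ω, ((∫⁻ q in Set.Ioc s (M.timeNat (k + 1)), M.runningCost α μ ω q) +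
    ENNReal.ofReal (riccati M.θ M.C (M.horizon - M.timeNat (k + 1)) * M.preMean s α μ k ω ^ 2 +
      M.priorCost (k + 1) (M.preVar s z₀ k))) ∂P

lemma lintegral_Ioc_add_Ioc (f : ℝ → ℝ≥0∞) {x y z : ℝ} (hxy : x ≤ y) (hyz : y ≤ z) :
    (∫⁻ q in Set.Ioc x y, f q) + ∫⁻ q in Set.Ioc y z, f q = ∫⁻ q in Set.Ioc x z, f q := by
  rw [← Set.Ioc_union_Ioc_eq_Ioc hxy hyz,
    lintegral_union measurableSet_Ioc (Set.Ioc_disjoint_Ioc_of_le le_rfl)]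

namespace IsControlledPath

section Pathwise

variable (h : M.IsControlledPath s (gaussianLaw m₀ z₀) α μ prior)
include h

lemma eq_gaussianLaw_of_mem_stage (hε : 0 < M.ε) (hmono : StrictMono M.time)
    (hs : M.timeNat 0 ≤ s) (hz₀ : 0 ≤ z₀) (hk : k ≤ n) {q : ℝ}
    (hq : q ∈ Set.Ioo (M.stageStart s k) (M.timeNat (k + 1))) (ω : Ω) :
    μ q ω = gaussianLaw (meanFlow M.θ (fun t => α t ω) (M.stageStart s k) q
      (condMean μ (M.stageStart s k) ω)) (ouVar M.θ M.b (q - M.stageStart s k)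
        (M.postVar s z₀ k)) :=
  h.eq_gaussianLaw hmono hq.1.le (hq.2.le.trans (timeNat_le_horizon hmono _)) (Or.inl hq.2)
    (postVar_nonneg hmono hz₀ k) (h.law_stageStart hε hmono hs hz₀ ω hk)

lemma lintegral_runningCost_stage (hC : 0 < M.C) (hε : 0 < M.ε) (hmono : StrictMono M.time)
    (hs : M.timeNat 0 ≤ s) (hz₀ : 0 ≤ z₀) (hk : k ≤ n) (ω : Ω) :
    ∫⁻ q in Set.Ioc (M.stageStart s k) (M.timeNat (k + 1)), M.runningCost α μ ω q =
      ∫⁻ q in Set.Ioc (M.stageStart s k) (M.timeNat (k + 1)),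
        ENNReal.ofReal (gaussRunningCost M.θ M.b M.C (fun q => α q ω) (M.stageStart s k)
          (condMean μ (M.stageStart s k) ω) (M.postVar s z₀ k) q) := by
  rw [← restrict_Ioo_eq_restrict_Ioc]
  refine setLIntegral_congr_fun measurableSet_Ioo fun q hq => ?_
  have hvar := ouVar_nonneg M.θ M.b (sub_nonneg.2 hq.1.le) (postVar_nonneg hmono hz₀ (s := s) k)
  rw [runningCost, h.eq_gaussianLaw_of_mem_stage hε hmono hs hz₀ hk hq,
    secondMoment_gaussianLaw _ hvar, ← ENNReal.ofReal_add (by positivity) (by positivity),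
    gaussRunningCost]

lemma gaussCost_stageStart_le (hC : 0 < M.C) (hε : 0 < M.ε) (hmono : StrictMono M.time)
    (hs : M.timeNat 0 ≤ s) (hz₀ : 0 ≤ z₀) (hk : k ≤ n) (hsk : s < M.timeNat (k + 1)) (ω : Ω) :
    ENNReal.ofReal (M.gaussCost k (M.stageStart s k) (condMean μ (M.stageStart s k) ω)
        (M.postVar s z₀ k)) ≤
      (∫⁻ q in Set.Ioc (M.stageStart s k) (M.timeNat (k + 1)), M.runningCost α μ ω q) +
        ENNReal.ofReal (riccati M.θ M.C (M.horizon - M.timeNat (k + 1)) *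
          M.preMean s α μ k ω ^ 2 + M.priorCost (k + 1) (M.preVar s z₀ k)) := by
  rw [h.lintegral_runningCost_stage hC hε hmono hs hz₀ hk]
  exact le_lintegral_gaussRunningCost_add hC (stageStart_lt hmono hk hsk).le
    (timeNat_le_horizon hmono _) (postVar_nonneg hmono hz₀ k) (priorCost_nonneg hC hmono _)
    (h.intervalIntegrable_stage hmono hsk ω)

lemma gaussCost_stageStart_eq (hC : 0 < M.C) (hε : 0 < M.ε) (hmono : StrictMono M.time)
    (hs : M.timeNat 0 ≤ s) (hz₀ : 0 ≤ z₀) (hk : k ≤ n) (hsk : s < M.timeNat (k + 1))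
    (hfb : M.IsFeedback s α μ) (ω : Ω) :
    ENNReal.ofReal (M.gaussCost k (M.stageStart s k) (condMean μ (M.stageStart s k) ω)
        (M.postVar s z₀ k)) =
      (∫⁻ q in Set.Ioc (M.stageStart s k) (M.timeNat (k + 1)), M.runningCost α μ ω q) +
        ENNReal.ofReal (riccati M.θ M.C (M.horizon - M.timeNat (k + 1)) *
          M.preMean s α μ k ω ^ 2 + M.priorCost (k + 1) (M.preVar s z₀ k)) := by
  rw [h.lintegral_runningCost_stage hC hε hmono hs hz₀ hk]
  refine (lintegral_gaussRunningCost_add_of_feedback hC (stageStart_lt hmono hk hsk).le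
    (timeNat_le_horizon hmono _) (postVar_nonneg hmono hz₀ k) (priorCost_nonneg hC hmono _)
    (h.intervalIntegrable_stage hmono hsk ω) fun q hq => ?_).symm
  rw [hfb ω q ⟨le_stageStart.trans hq.1.le, hq.2.le.trans (timeNat_le_horizon hmono _)⟩, condMean,
    h.eq_gaussianLaw_of_mem_stage hε hmono hs hz₀ hk hq, integral_id_gaussianLaw]

end Pathwise

variable [mΩ : MeasurableSpace Ω] {P : Measure Ω}
  (h : M.IsControlledPath s (gaussianLaw m₀ z₀) α μ prior)
include h

lemma costAfter_le_costBefore (hC : 0 < M.C) (hε : 0 < M.ε) (hmono : StrictMono M.time)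
    (hs : M.timeNat 0 ≤ s) (hz₀ : 0 ≤ z₀) (hk : k ≤ n) (hsk : s < M.timeNat (k + 1)) :
    M.costAfter P s z₀ α μ k ≤ M.costBefore P s z₀ α μ k := by
  refine lintegral_mono fun ω => ?_
  rw [← lintegral_Ioc_add_Ioc _ le_stageStart (stageStart_lt hmono hk hsk).le, add_assoc]
  gcongr
  exact h.gaussCost_stageStart_le hC hε hmono hs hz₀ hk hsk ω

lemma costAfter_eq_costBefore (hC : 0 < M.C) (hε : 0 < M.ε) (hmono : StrictMono M.time)
    (hs : M.timeNat 0 ≤ s) (hz₀ : 0 ≤ z₀) (hk : k ≤ n) (hsk : s < M.timeNat (k + 1))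
    (hfb : M.IsFeedback s α μ) :
    M.costAfter P s z₀ α μ k = M.costBefore P s z₀ α μ k := by
  refine lintegral_congr fun ω => ?_
  rw [← lintegral_Ioc_add_Ioc _ le_stageStart (stageStart_lt hmono hk hsk).le, add_assoc,
    h.gaussCost_stageStart_eq hC hε hmono hs hz₀ hk hsk hfb]

lemma costAfter_eq_of_mem_Ico [IsProbabilityMeasure P]
    (hs : s ∈ Set.Ico (M.timeNat k) (M.timeNat (k + 1))) :
    M.costAfter P s z₀ α μ k = ENNReal.ofReal (M.gaussCost k s m₀ z₀) := by
  have hmean : ∀ ω, condMean μ s ω = m₀ := fun ω => by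
    rw [condMean, h.initial, integral_id_gaussianLaw]
  simp [costAfter, stageStart_of_le hs.1, postVar_of_le hs.1, hmean]

-- The posterior mean is an affine function of an observation error that is independent of the
-- past, so an observation adds a deterministic amount to the expected squared mean.
lemma lintegral_gaussCost_obsTime [IsProbabilityMeasure P] (hP : M.IsDriven P) (hC : 0 < M.C)
    (hε : 0 < M.ε) (hmono : StrictMono M.time) (hs : M.timeNat 0 ≤ s) (hz₀ : 0 ≤ z₀) (j : Fin n)
    (hj : s < M.timeNat (j + 1)) :
    ∫⁻ ω, ENNReal.ofReal (M.gaussCost (j + 1) (M.timeNat (j + 1))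
        (condMean μ (M.timeNat (j + 1)) ω) (M.postVar s z₀ (j + 1))) ∂P =
      ∫⁻ ω, ENNReal.ofReal (riccati M.θ M.C (M.horizon - M.timeNat (j + 1)) *
        M.preMean s α μ j ω ^ 2 + M.priorCost (j + 1) (M.preVar s z₀ j)) ∂P := by
  have hv := preVar_nonneg hmono hz₀ hj
  set v := M.preVar s z₀ j
  have hobs := M.obsTime_eq j ▸ hj
  have hmeas := h.measurable_preMean hε hmono hs hz₀ j.2.le hj
  have hric := riccati_pos M.θ hC (sub_nonneg.2 (timeNat_le_horizon hmono (j + 1)))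
  have hvar := varCost_nonneg M.θ M.b (priorCost_nonneg hC hmono (j + 1 + 1))
    (sub_nonneg.2 (timeNat_mono hmono (Nat.le_succ (j + 1)))) (posteriorVar_nonneg M.ε hv)
  have hgain : (v / (v + M.ε ^ 2)) ^ 2 * ((v + M.ε ^ 2).toNNReal : ℝ) = v ^ 2 / (v + M.ε ^ 2) := by
    rw [Real.coe_toNNReal _ (by positivity)]
    field_simp
  have hae := h.condMean_obsTime_ae hP hε hmono hs hz₀ j hobs
  rw [stageStart_obsTime j hobs, obsTime_eq] at hae
  rw [priorCost_eq M (k := j + 1) j.2, ← hgain, ← lintegral_quadratic_of_indepFun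
    (hmeas.mono (hP.drivingSigma_le j) le_rfl)
    (M.measurable_innovation (hP.measurable_U j) (hP.measurable_Z j) v)
    (hP.indepFun_innovation v j hmeas) (hP.map_innovation hv j) hric.le hvar]
  refine lintegral_congr_ae ?_
  filter_upwards [hae] with ω hω
  rw [gaussCost, hω, postVar_succ hj]

lemma costAfter_succ [IsProbabilityMeasure P] (hP : M.IsDriven P) (hC : 0 < M.C) (hε : 0 < M.ε)
    (hmono : StrictMono M.time) (hs : M.timeNat 0 ≤ s) (hz₀ : 0 ≤ z₀) (hk : k < n)
    (hsk : s < M.timeNat (k + 1)) :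
    M.costAfter P s z₀ α μ (k + 1) = M.costBefore P s z₀ α μ k := by
  have hmean : Measurable (condMean μ (M.timeNat (k + 1))) :=
    stageStart_of_lt hsk ▸ (h.measurable_condMean_and_observation hε hmono hs hz₀ hk).1.mono
      (hP.drivingSigma_le _) le_rfl
  have hpre : Measurable (M.preMean s α μ k) :=
    (h.measurable_preMean hε hmono hs hz₀ hk.le hsk).mono (hP.drivingSigma_le _) le_rfl
  rw [costAfter, costBefore, stageStart_of_lt hsk,
    lintegral_add_right _ (by unfold gaussCost; fun_prop), lintegral_add_right _ (by fun_prop),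
    h.lintegral_gaussCost_obsTime hP hC hε hmono hs hz₀ ⟨k, hk⟩ hsk]

lemma costBefore_last (hε : 0 < M.ε) (hmono : StrictMono M.time) (hs : M.timeNat 0 ≤ s)
    (hsT : s < M.horizon) (hz₀ : 0 ≤ z₀) : M.costBefore P s z₀ α μ n = M.cost P s α μ := by
  rw [horizon_eq] at hsT
  refine lintegral_congr fun ω => ?_
  rw [restrict_Ioc_eq_restrict_Icc, priorCost_last, horizon_eq, sub_self, riccati_zero, one_mul,
    h.eq_gaussianLaw hmono (stageStart_lt hmono le_rfl hsT).le M.horizon_eq.ge (Or.inr le_rfl)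
      (postVar_nonneg hmono hz₀ n) (h.law_stageStart hε hmono hs hz₀ ω le_rfl),
    ← preVar, ← preMean, secondMoment_gaussianLaw _ (preVar_nonneg hmono hz₀ hsT)]
  rfl

lemma costAfter_le_cost [IsProbabilityMeasure P] (hP : M.IsDriven P) (hC : 0 < M.C) (hε : 0 < M.ε)
    (hmono : StrictMono M.time) (hs : M.timeNat 0 ≤ s) (hz₀ : 0 ≤ z₀) (hk : k ≤ n)
    (hsk : s < M.timeNat (k + 1)) : M.costAfter P s z₀ α μ k ≤ M.cost P s α μ := by
  induction hk using Nat.decreasingInduction with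
  | self =>
    rw [← h.costBefore_last hε hmono hs (M.horizon_eq.symm ▸ hsk) hz₀]
    exact h.costAfter_le_costBefore hC hε hmono hs hz₀ le_rfl hsk
  | of_succ _ hk ih =>
    refine le_trans ?_ (ih (hsk.trans_le (timeNat_mono hmono (Nat.le_succ _))))
    calc M.costAfter P s z₀ α μ _
      _ ≤ M.costBefore P s z₀ α μ _ := h.costAfter_le_costBefore hC hε hmono hs hz₀ hk.le hsk
      _ = M.costAfter P s z₀ α μ _ := (h.costAfter_succ hP hC hε hmono hs hz₀ hk hsk).symm

lemma costAfter_eq_cost [IsProbabilityMeasure P] (hP : M.IsDriven P) (hC : 0 < M.C) (hε : 0 < M.ε)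
    (hmono : StrictMono M.time) (hs : M.timeNat 0 ≤ s) (hz₀ : 0 ≤ z₀) (hk : k ≤ n)
    (hsk : s < M.timeNat (k + 1)) (hfb : M.IsFeedback s α μ) :
    M.costAfter P s z₀ α μ k = M.cost P s α μ := by
  induction hk using Nat.decreasingInduction with
  | self =>
    rw [← h.costBefore_last hε hmono hs (M.horizon_eq.symm ▸ hsk) hz₀]
    exact h.costAfter_eq_costBefore hC hε hmono hs hz₀ le_rfl hsk hfb
  | of_succ _ hk ih =>
    rw [h.costAfter_eq_costBefore hC hε hmono hs hz₀ hk.le hsk hfb,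
      ← h.costAfter_succ hP hC hε hmono hs hz₀ hk hsk]
    exact ih (hsk.trans_le (timeNat_mono hmono (Nat.le_succ _)))

lemma cost_horizon [IsProbabilityMeasure P] (hs : s = M.horizon) (hz₀ : 0 ≤ z₀) :
    M.cost P s α μ = ENNReal.ofReal (m₀ ^ 2 + z₀) := by
  subst hs
  simp [cost, h.initial, secondMoment_gaussianLaw _ hz₀]

end IsControlledPath

end OUModel

/-! ### The optimal controlled path -/

section ClosedLoop

variable {θ C T r t m : ℝ}

/-- The solution at time `t` of the mean equation `x' = -θx + a` under the optimal feedback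
`a = -p(T - t)x / C`, with value `m` at time `r`; here `p` is the Riccati solution, and `D` in
`p = N / D` is what makes the equation explicitly solvable. -/
noncomputable def closedLoopMean (θ C T r t m : ℝ) : ℝ :=
  m / riccatiDen θ C (T - r) * riccatiDen θ C (T - t)

lemma closedLoopMean_self (hC : 0 < C) (hr : r ≤ T) : closedLoopMean θ C T r r m = m :=
  div_mul_cancel₀ m (riccatiDen_pos θ hC (sub_nonneg.2 hr)).ne'

lemma continuous_closedLoopMean (hC : 0 < C) : Continuous fun t => closedLoopMean θ C T r t m :=
  continuous_const.mul <| continuous_iff_continuousAt.2 fun t =>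
    ((hasDerivAt_riccatiDen θ hC (T - t)).comp_const_sub T t).continuousAt

lemma hasDerivAt_closedLoopMean (hC : 0 < C) (ht : t ≤ T) :
    HasDerivAt (fun t => closedLoopMean θ C T r t m)
      (-θ * closedLoopMean θ C T r t m +
        -(riccati θ C (T - t) * closedLoopMean θ C T r t m / C)) t := by
  have hD : riccatiDen θ C (T - t) ≠ 0 := (riccatiDen_pos θ hC (sub_nonneg.2 ht)).ne'
  refine (((hasDerivAt_riccatiDen θ hC (T - t)).comp_const_sub T t).const_mul
    (m / riccatiDen θ C (T - r))).congr_deriv ?_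
  unfold closedLoopMean riccati
  field_simp
  ring

lemma closedLoop_solvesFokkerPlanck {b z : ℝ} (hC : 0 < C) (hz : 0 ≤ z) (ht : t ≤ T) :
    SolvesFokkerPlanck θ b (fun q => -(riccati θ C (T - q) * closedLoopMean θ C T r q m / C))
      (fun q => gaussianLaw (closedLoopMean θ C T r q m) (ouVar θ b (q - r) z)) r t := by
  have hmean := continuous_closedLoopMean (θ := θ) (T := T) (r := r) (m := m) hC
  refine gaussianLaw_solvesFokkerPlanck hz ?_ hmean.continuousOn fun q hq =>
    hasDerivAt_closedLoopMean hC (hq.2.le.trans ht)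
  have hric := (continuousOn_riccati_sub (θ := θ) (T := T) hC).mono fun q (hq : q ∈ Set.Icc r t) =>
    hq.2.trans ht
  exact ((hric.mul hmean.continuousOn).div_const C).neg

end ClosedLoop

namespace OUModel

variable {n : ℕ} {Ω : Type*} (M : OUModel n Ω)

/-- The mean of the optimal path at the start of the `k`-th stage, for the initial law `𝒩(m₀, z₀)`
at time `s`. The law before the observation is already known to be Gaussian when the observation is
sampled, so that the path can be constructed stage by stage. -/
noncomputable def stageMean (s m₀ z₀ : ℝ) : ℕ → Ω → ℝ
  | 0, _ => m₀
  | k + 1, ω =>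
    if h : k < n ∧ s < M.timeNat (k + 1) then
      let x := closedLoopMean M.θ M.C M.horizon (M.stageStart s k) (M.timeNat (k + 1))
        (stageMean s m₀ z₀ k ω)
      x + M.preVar s z₀ k / (M.preVar s z₀ k + M.ε ^ 2) *
        (quantile (gaussianLaw x (M.preVar s z₀ k) : Measure ℝ) (M.U ⟨k, h.1⟩ ω) +
          M.ε * M.Z ⟨k, h.1⟩ ω - x)
    else m₀

/-- The mean at time `t` of the optimal path during the `k`-th stage. -/
noncomputable def optMean (s m₀ z₀ : ℝ) (k : ℕ) (t : ℝ) (ω : Ω) : ℝ :=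
  closedLoopMean M.θ M.C M.horizon (M.stageStart s k) t (M.stageMean s m₀ z₀ k ω)

/-- The optimal control, for the initial law `𝒩(m₀, z₀)` at time `s`. -/
noncomputable def optControl (s m₀ z₀ t : ℝ) (ω : Ω) : ℝ :=
  -(riccati M.θ M.C (M.horizon - t) * M.optMean s m₀ z₀ (M.obsIndex t) t ω / M.C)

/-- The conditional law of the state under the optimal control. -/
noncomputable def optLaw (s m₀ z₀ t : ℝ) (ω : Ω) : ProbabilityMeasure ℝ :=
  gaussianLaw (M.optMean s m₀ z₀ (M.obsIndex t) t ω)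
    (ouVar M.θ M.b (t - M.stageStart s (M.obsIndex t)) (M.postVar s z₀ (M.obsIndex t)))

/-- The conditional law under the optimal control just before the observation `j`. -/
noncomputable def optPrior (s m₀ z₀ : ℝ) (j : Fin n) (ω : Ω) : ProbabilityMeasure ℝ :=
  gaussianLaw (M.optMean s m₀ z₀ j (M.timeNat (j + 1)) ω) (M.preVar s z₀ j)

variable {M} {s m₀ z₀ : ℝ}

lemma stageMean_of_le {k : ℕ} (hs : M.timeNat k ≤ s) (ω : Ω) : M.stageMean s m₀ z₀ k ω = m₀ := by
  cases k with
  | zero => rw [stageMean]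
  | succ k => rw [stageMean, dif_neg fun h => hs.not_gt h.2]

lemma stageMean_succ {j : Fin n} (hs : s < M.timeNat (j + 1)) (ω : Ω) :
    M.stageMean s m₀ z₀ (j + 1) ω = M.optMean s m₀ z₀ j (M.timeNat (j + 1)) ω +
      M.preVar s z₀ j / (M.preVar s z₀ j + M.ε ^ 2) *
        (M.observation (M.optPrior s m₀ z₀) j ω -
          M.optMean s m₀ z₀ j (M.timeNat (j + 1)) ω) := by
  rw [stageMean, dif_pos ⟨j.2, hs⟩]
  rfl

lemma measurable_stageMean (hmono : StrictMono M.time) {t : ℝ} :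
    ∀ k ≤ n, M.timeNat k ≤ t →
      Measurable[M.obsSigma (M.optPrior s m₀ z₀) s t] (M.stageMean s m₀ z₀ k)
  | 0, _, _ => by
    rw [show M.stageMean s m₀ z₀ 0 = fun _ => m₀ from funext fun ω => by rw [stageMean]]
    exact measurable_const
  | k + 1, hk, ht => by
    rcases lt_or_ge s (M.timeNat (k + 1)) with hs | hs
    · have hmean : Measurable[M.obsSigma (M.optPrior s m₀ z₀) s t]
          (M.optMean s m₀ z₀ k (M.timeNat (k + 1))) :=
        ((measurable_stageMean hmono k (by omega)
          ((timeNat_mono hmono k.le_succ).trans ht)).div_const _).mul_const _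
      have hobs : Measurable[M.obsSigma (M.optPrior s m₀ z₀) s t]
          (M.observation (M.optPrior s m₀ z₀) ⟨k, hk⟩) :=
        measurable_observation_obsSigma _ (by rwa [obsTime_eq]) (by rwa [obsTime_eq])
      rw [show M.stageMean s m₀ z₀ (k + 1) = _ from funext (stageMean_succ (j := ⟨k, hk⟩) hs)]
      exact hmean.add ((hobs.sub hmean).const_mul _)
    · rw [show M.stageMean s m₀ z₀ (k + 1) = fun _ => m₀ from funext (stageMean_of_le hs)]
      exact measurable_const

lemma obsIndex_eq_of_forall_notMem_Ioc (hmono : StrictMono M.time) {r t : ℝ}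
    (hr : M.timeNat 0 ≤ r) (hrt : r ≤ t) (hobs : ∀ j, M.obsTime j ∉ Set.Ioc r t) :
    M.obsIndex t = M.obsIndex r := by
  refine le_antisymm ?_ (M.obsIndex_mono hrt)
  by_contra! hlt
  have hn : M.obsIndex r < n := hlt.trans_le (M.obsIndex_le t)
  refine hobs ⟨M.obsIndex r, hn⟩ ?_
  rw [obsTime_eq]
  exact ⟨lt_timeNat_obsIndex_succ_of_lt hn,
    (timeNat_mono hmono hlt).trans (timeNat_obsIndex_le (hr.trans hrt))⟩

lemma optControl_adapted (hmono : StrictMono M.time) {t : ℝ} (ht : M.timeNat 0 ≤ t) :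
    Measurable[MeasurableSpace.prod inferInstance (M.obsSigma (M.optPrior s m₀ z₀) s t)]
      fun p : Set.Icc s t × Ω => M.optControl s m₀ z₀ p.1 p.2 := by
  set 𝒜 := M.obsSigma (M.optPrior s m₀ z₀) s t
  have hcoeff : Measurable[MeasurableSpace.prod inferInstance 𝒜] fun p : Set.Icc s t × Ω =>
      M.stageMean s m₀ z₀ (M.obsIndex p.1) p.2 /
        riccatiDen M.θ M.C (M.horizon - M.stageStart s (M.obsIndex p.1)) :=
    @measurable_comp_monotone Ω 𝒜 M.obsIndex M.obsIndex_mono s t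
      (fun k ω => M.stageMean s m₀ z₀ k ω / riccatiDen M.θ M.C (M.horizon - M.stageStart s k))
      fun k hk => (measurable_stageMean hmono k (hk.trans (M.obsIndex_le t))
        ((timeNat_mono hmono hk).trans (timeNat_obsIndex_le ht))).div_const _
  have htime : Measurable[MeasurableSpace.prod inferInstance 𝒜] fun p : Set.Icc s t × Ω =>
      (p.1 : ℝ) := measurable_subtype_coe.comp (@measurable_fst _ _ _ 𝒜)
  have hden : Measurable fun t => riccatiDen M.θ M.C (M.horizon - t) := by
    unfold riccatiDen
    fun_prop
  have hric : Measurable fun t => riccati M.θ M.C (M.horizon - t) := by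
    unfold riccati riccatiNum riccatiDen
    fun_prop
  exact (((hric.comp htime).mul (hcoeff.mul (hden.comp htime))).div_const _).neg

lemma integrableOn_optControl (hC : 0 < M.C) (ω : Ω) :
    IntegrableOn (fun t => M.optControl s m₀ z₀ t ω) (Set.Icc s M.horizon) := by
  set c : ℕ → ℝ := fun k => M.stageMean s m₀ z₀ k ω /
    riccatiDen M.θ M.C (M.horizon - M.stageStart s k)
  have hmeas : Measurable fun t => c (M.obsIndex t) :=
    (measurable_from_nat (f := c)).comp M.obsIndex_mono.measurable
  have hbound : ∀ t, ‖c (M.obsIndex t)‖ ≤ ∑ k ∈ Finset.range (n + 1), ‖c k‖ := fun t =>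
    Finset.single_le_sum (f := fun k => ‖c k‖) (fun _ _ => norm_nonneg _)
      (Finset.mem_range_succ_iff.2 (M.obsIndex_le t))
  have hcont : ContinuousOn (fun t => riccati M.θ M.C (M.horizon - t) *
      riccatiDen M.θ M.C (M.horizon - t)) (Set.Icc s M.horizon) :=
    ((continuousOn_riccati_sub hC).mono fun t ht => ht.2).mul
      (Continuous.continuousOn (by unfold riccatiDen; fun_prop))
  have hint := Integrable.bdd_mul (hcont.integrableOn_Icc (μ := volume)) hmeas.aestronglyMeasurable
    (Eventually.of_forall hbound)
  refine (hint.div_const M.C).neg.congr (Eventually.of_forall fun t => ?_)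
  simp only [optControl, optMean, closedLoopMean, c, Pi.neg_apply]
  ring

lemma optLaw_initial (hC : 0 < M.C) (hs : M.timeNat 0 ≤ s) (hsT : s ≤ M.horizon) (ω : Ω) :
    M.optLaw s m₀ z₀ s ω = gaussianLaw m₀ z₀ := by
  have hle := timeNat_obsIndex_le hs
  rw [optLaw, optMean, postVar_of_le hle, stageMean_of_le hle, stageStart_of_le hle,
    closedLoopMean_self hC hsT, sub_self, ouVar_zero]

lemma optLaw_solvesFokkerPlanck (hC : 0 < M.C) (hmono : StrictMono M.time)
    (hs : M.timeNat 0 ≤ s) (hz₀ : 0 ≤ z₀) {r t : ℝ} (hsr : s ≤ r) (ht : t ≤ M.horizon)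
    (hobs : ∀ j, M.obsTime j ∉ Set.Ioc r t) (ω : Ω) :
    SolvesFokkerPlanck M.θ M.b (fun q => M.optControl s m₀ z₀ q ω)
      (fun q => M.optLaw s m₀ z₀ q ω) r t := by
  have hindex : ∀ q ∈ Set.Icc r t, M.obsIndex q = M.obsIndex r := fun q hq =>
    obsIndex_eq_of_forall_notMem_Ioc hmono (hs.trans hsr) hq.1 fun j hj =>
      hobs j ⟨hj.1, hj.2.trans hq.2⟩
  have hstart : M.stageStart s (M.obsIndex r) ≤ r :=
    max_le hsr (timeNat_obsIndex_le (hs.trans hsr))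
  have hstage : SolvesFokkerPlanck M.θ M.b
      (fun q => -(riccati M.θ M.C (M.horizon - q) * M.optMean s m₀ z₀ (M.obsIndex r) q ω / M.C))
      (fun q => gaussianLaw (M.optMean s m₀ z₀ (M.obsIndex r) q ω)
        (ouVar M.θ M.b (q - M.stageStart s (M.obsIndex r)) (M.postVar s z₀ (M.obsIndex r)))) r t :=
    fun f hf x y hx => closedLoop_solvesFokkerPlanck hC (postVar_nonneg hmono hz₀ _) ht f hf x y
      (hstart.trans hx)
  exact hstage.congr (fun q hq => by rw [optControl, hindex q hq])
    fun q hq => by rw [optLaw, hindex q hq]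

lemma tendsto_optLaw (hC : 0 < M.C) (hmono : StrictMono M.time) (j : Fin n)
    (hj : s < M.obsTime j) (ω : Ω) :
    Tendsto (fun t => M.optLaw s m₀ z₀ t ω) (𝓝[<] M.obsTime j) (𝓝 (M.optPrior s m₀ z₀ j ω)) := by
  rw [obsTime_eq] at hj ⊢
  have hmean : Tendsto (fun q => M.optMean s m₀ z₀ j q ω) (𝓝[<] M.timeNat (j + 1))
      (𝓝 (M.optMean s m₀ z₀ j (M.timeNat (j + 1)) ω)) :=
    ((continuous_closedLoopMean hC).tendsto _).mono_left nhdsWithin_le_nhds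
  have hvar : Tendsto (fun q => ouVar M.θ M.b (q - M.stageStart s j) (M.postVar s z₀ j))
      (𝓝[<] M.timeNat (j + 1)) (𝓝 (M.preVar s z₀ j)) :=
    (((continuous_ouVar_left _ _ _).comp (continuous_sub_right _)).tendsto _).mono_left
      nhdsWithin_le_nhds
  refine (tendsto_gaussianLaw hmean hvar).congr' ?_
  filter_upwards [Ioo_mem_nhdsLT (stageStart_lt hmono j.2.le hj)] with q hq
  rw [optLaw, obsIndex_eq hmono j.2.le ⟨timeNat_le_stageStart.trans hq.1.le, hq.2⟩]

lemma optLaw_obsTime (hC : 0 < M.C) (hε : 0 < M.ε) (hmono : StrictMono M.time) (hz₀ : 0 ≤ z₀)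
    (j : Fin n) (hj : s < M.obsTime j) (ω : Ω) :
    (M.optLaw s m₀ z₀ (M.obsTime j) ω : Measure ℝ) =
      bayesUpdate M.ε (M.optPrior s m₀ z₀ j ω : Measure ℝ)
        (M.observation (M.optPrior s m₀ z₀) j ω) := by
  have hindex : M.obsIndex (M.obsTime j) = j + 1 := by
    rw [obsTime_eq]
    exact obsIndex_eq hmono j.2 ⟨le_rfl, timeNat_lt_succ hmono j.2⟩
  have hlt : s < M.timeNat (j + 1) := by rwa [← obsTime_eq]
  rw [optLaw, hindex, optMean, stageStart_obsTime j hj, sub_self, ouVar_zero, postVar_succ hlt,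
    closedLoopMean_self hC (obsTime_eq M j ▸ timeNat_le_horizon hmono _), stageMean_succ hlt,
    ← bayesUpdate_gaussianLaw hε (preVar_nonneg hmono hz₀ hlt), optPrior]

lemma isControlledPath_opt (hC : 0 < M.C) (hε : 0 < M.ε) (hmono : StrictMono M.time)
    (hs : M.timeNat 0 ≤ s) (hsT : s ≤ M.horizon) (hz₀ : 0 ≤ z₀) :
    M.IsControlledPath s (gaussianLaw m₀ z₀) (M.optControl s m₀ z₀) (M.optLaw s m₀ z₀)
      (M.optPrior s m₀ z₀) where
  adapted _ ht := optControl_adapted hmono (hs.trans ht.1)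
  integrable := integrableOn_optControl hC
  initial := optLaw_initial hC hs hsT
  fokkerPlanck ω f hf hf' r t hsr hrt htT hobs :=
    optLaw_solvesFokkerPlanck hC hmono hs hz₀ hsr htT hobs ω f ⟨hf, hf'⟩ r t le_rfl hrt le_rfl
  leftLimit ω j hj := tendsto_optLaw hC hmono j hj ω
  update ω j hj := optLaw_obsTime hC hε hmono hz₀ j hj ω

lemma isFeedback_opt : M.IsFeedback s (M.optControl s m₀ z₀) (M.optLaw s m₀ z₀) := fun ω t _ => by
  rw [condMean, optLaw, integral_id_gaussianLaw, optControl]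

end OUModel

/-! ### The value at Gaussian laws -/

namespace OUModel

section Value

variable {n : ℕ} {Ω : Type*} [MeasurableSpace Ω] {P : Measure Ω} [IsProbabilityMeasure P]
  {M : OUModel n Ω} {k : ℕ} {t z : ℝ}

lemma value_gaussianLaw (hP : M.IsDriven P) (hC : 0 < M.C) (hε : 0 < M.ε)
    (hmono : StrictMono M.time) (hk : k ≤ n)
    (ht : t ∈ Set.Ico (M.timeNat k) (M.timeNat (k + 1))) (m : ℝ) (hz : 0 ≤ z) :
    M.value P t (gaussianLaw m z) = ENNReal.ofReal (M.gaussCost k t m z) := by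
  have h0 : M.timeNat 0 ≤ t := (timeNat_mono hmono k.zero_le).trans ht.1
  have hT : t ≤ M.horizon := ht.2.le.trans (timeNat_le_horizon hmono _)
  have hopt := isControlledPath_opt (m₀ := m) hC hε hmono h0 hT hz
  apply le_antisymm
  · refine (iInf₂_le_of_le _ _ (iInf₂_le_of_le _ hopt le_rfl)).trans_eq ?_
    rw [← hopt.costAfter_eq_cost hP hC hε hmono h0 hz hk ht.2 isFeedback_opt,
      hopt.costAfter_eq_of_mem_Ico ht]
  · refine le_iInf₂ fun α μ => le_iInf₂ fun prior h => ?_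
    rw [← h.costAfter_eq_of_mem_Ico (P := P) ht]
    exact h.costAfter_le_cost hP hC hε hmono h0 hz hk ht.2

lemma value_horizon (hC : 0 < M.C) (hε : 0 < M.ε) (hmono : StrictMono M.time) (m : ℝ)
    (hz : 0 ≤ z) : M.value P M.horizon (gaussianLaw m z) = ENNReal.ofReal (m ^ 2 + z) := by
  have hopt := isControlledPath_opt (m₀ := m) hC hε hmono (timeNat_le_horizon hmono 0) le_rfl hz
  apply le_antisymm
  · exact (iInf₂_le_of_le _ _ (iInf₂_le_of_le _ hopt le_rfl)).trans_eq (hopt.cost_horizon rfl hz)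
  · exact le_iInf₂ fun α μ => le_iInf₂ fun prior h => (h.cost_horizon rfl hz).ge

lemma value_gaussianLaw_ne_top (hP : M.IsDriven P) (hC : 0 < M.C) (hε : 0 < M.ε)
    (hmono : StrictMono M.time) (ht : t ∈ Set.Icc (M.time 0) M.horizon) (m : ℝ) (hz : 0 ≤ z) :
    M.value P t (gaussianLaw m z) ≠ ⊤ := by
  rcases ht.2.eq_or_lt with rfl | htT
  · rw [value_horizon hC hε hmono m hz]
    exact ENNReal.ofReal_ne_top
  · rw [value_gaussianLaw hP hC hε hmono (M.obsIndex_le t) (mem_Ico_obsIndex ⟨ht.1, htT⟩) m hz]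
    exact ENNReal.ofReal_ne_top

lemma gaussValue_eq (hP : M.IsDriven P) (hC : 0 < M.C) (hε : 0 < M.ε) (hmono : StrictMono M.time)
    (hk : k ≤ n) (ht : t ∈ Set.Ico (M.timeNat k) (M.timeNat (k + 1))) (m : ℝ) (hz : 0 ≤ z) :
    M.gaussValue P t m z = M.gaussCost k t m z := by
  rw [gaussValue, value_gaussianLaw hP hC hε hmono hk ht m hz,
    ENNReal.toReal_ofReal (gaussCost_nonneg hC hmono ht.2.le m hz)]

lemma gaussValue_horizon (hC : 0 < M.C) (hε : 0 < M.ε) (hmono : StrictMono M.time) (m : ℝ)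
    (hz : 0 ≤ z) : M.gaussValue P M.horizon m z = m ^ 2 + z := by
  rw [gaussValue, value_horizon hC hε hmono m hz, ENNReal.toReal_ofReal (by positivity)]

lemma tendsto_gaussValue (hP : M.IsDriven P) (hC : 0 < M.C) (hε : 0 < M.ε)
    (hmono : StrictMono M.time) (hk : k ≤ n) (m : ℝ) (hz : 0 ≤ z) :
    Tendsto (fun t => M.gaussValue P t m z) (𝓝[<] M.timeNat (k + 1))
      (𝓝 (riccati M.θ M.C (M.horizon - M.timeNat (k + 1)) * m ^ 2 + M.priorCost (k + 1) z)) := by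
  refine (tendsto_gaussCost hC hε hmono k m hz).congr' ?_
  filter_upwards [Ioo_mem_nhdsLT (timeNat_lt_succ hmono hk)] with t ht
  exact (gaussValue_eq hP hC hε hmono hk ⟨ht.1.le, ht.2⟩ m hz).symm

lemma tendsto_gaussValue_horizon (hP : M.IsDriven P) (hC : 0 < M.C) (hε : 0 < M.ε)
    (hmono : StrictMono M.time) (m : ℝ) (hz : 0 ≤ z) :
    Tendsto (fun t => M.gaussValue P t m z) (𝓝[<] M.horizon) (𝓝 (m ^ 2 + z)) := by
  have hlim := tendsto_gaussValue hP hC hε hmono le_rfl m hz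
  rwa [← horizon_eq, sub_self, riccati_zero, one_mul, priorCost_last] at hlim

lemma gaussValue_hjb (hP : M.IsDriven P) (hC : 0 < M.C) (hε : 0 < M.ε)
    (hmono : StrictMono M.time) (hk : k ≤ n)
    (ht : t ∈ Set.Ico (M.timeNat k) (M.timeNat (k + 1))) (m : ℝ) (hz : 0 ≤ z) :
    ∃ Ut Um Uz : ℝ,
      HasDerivWithinAt (fun r => M.gaussValue P r m z) Ut
        (Set.Ico (M.timeNat k) (M.timeNat (k + 1))) t ∧
      HasDerivAt (fun x => M.gaussValue P t x z) Um m ∧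
      HasDerivWithinAt (fun y => M.gaussValue P t m y) Uz (Set.Ici 0) z ∧
      Ut + z + m ^ 2 - M.θ * m * Um + (M.b ^ 2 - 2 * M.θ * z) * Uz
        - 1 / (4 * M.C) * Um ^ 2 = 0 := by
  obtain ⟨Ut, Um, Uz, htime, hmean, hvar, heq⟩ := gaussCost_hjb hC hε hmono ht m hz
  refine ⟨Ut, Um, Uz, ?_, ?_, ?_, heq⟩
  · exact htime.congr_of_mem (fun r hr => gaussValue_eq hP hC hε hmono hk hr m hz) ht
  · exact hmean.congr_of_eventuallyEq <| Eventually.of_forall fun x =>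
      gaussValue_eq hP hC hε hmono hk ht x hz
  · exact hvar.congr_of_mem (fun y hy => gaussValue_eq hP hC hε hmono hk ht m hy) hz

lemma gaussValue_obsTime (hP : M.IsDriven P) (hC : 0 < M.C) (hε : 0 < M.ε)
    (hmono : StrictMono M.time) (j : Fin n) (m : ℝ) (hz : 0 ≤ z) :
    Integrable (fun w => M.gaussValue P (M.obsTime j) (m + z / √(z + M.ε ^ 2) * w)
      (posteriorVar M.ε z) * gaussianPDFReal 0 1 w) ∧
    Tendsto (fun t => M.gaussValue P t m z) (𝓝[<] M.obsTime j)
      (𝓝 (∫ w, M.gaussValue P (M.obsTime j) (m + z / √(z + M.ε ^ 2) * w)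
        (posteriorVar M.ε z) * gaussianPDFReal 0 1 w)) := by
  have hval : ∀ x, M.gaussValue P (M.obsTime j) x (posteriorVar M.ε z) =
      M.gaussCost (j + 1) (M.timeNat (j + 1)) x (posteriorVar M.ε z) := fun x => by
    rw [obsTime_eq]
    exact gaussValue_eq hP hC hε hmono j.2 ⟨le_rfl, timeNat_lt_succ hmono j.2⟩ x
      (posteriorVar_nonneg M.ε hz)
  simp_rw [hval]
  refine ⟨integrable_gaussCost _ _, ?_⟩
  rw [obsTime_eq, integral_gaussCost j.2 m hz]
  exact tendsto_gaussValue hP hC hε hmono j.2.le m hz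

end Value

end OUModel

theorem lemma4p3 {n : ℕ} {Ω : Type*} [MeasurableSpace Ω] (P : Measure Ω) [IsProbabilityMeasure P]
    (M : OUModel n Ω) (hC : 0 < M.C) (hε : 0 < M.ε)
    (htime : StrictMono M.time) (htime_zero : M.time 0 = 0)
    (hU : ∀ j, Measurable (M.U j)) (hZ : ∀ j, Measurable (M.Z j))
    (hU_law : ∀ j, P.map (M.U j) = volume.restrict (Set.Icc (0 : ℝ) 1))
    (hZ_law : ∀ j, P.map (M.Z j) = gaussianReal 0 1)
    (h_indep : iIndepFun (Sum.elim M.U M.Z : Fin n ⊕ Fin n → Ω → ℝ) P) :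
    -- the value function is finite at Gaussian laws
    (∀ t ∈ Set.Icc 0 M.horizon, ∀ m z : ℝ, 0 ≤ z → M.value P t (gaussianLaw m z) ≠ ⊤) ∧
    -- the equation on `[t_i, t_{i+1})`, `i = 0, …, n`
    (∀ i : Fin (n + 1), ∀ t ∈ Set.Ico (M.time i.castSucc) (M.time i.succ),
      ∀ m z : ℝ, 0 ≤ z → ∃ Ut Um Uz : ℝ,
        HasDerivWithinAt (fun r => M.gaussValue P r m z) Ut
          (Set.Ico (M.time i.castSucc) (M.time i.succ)) t ∧
        HasDerivAt (fun x => M.gaussValue P t x z) Um m ∧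
        HasDerivWithinAt (fun y => M.gaussValue P t m y) Uz (Set.Ici 0) z ∧
        Ut + z + m ^ 2 - M.θ * m * Um + (M.b ^ 2 - 2 * M.θ * z) * Uz
          - 1 / (4 * M.C) * Um ^ 2 = 0) ∧
    -- the condition at the observation times
    (∀ j : Fin n, ∀ m z : ℝ, 0 ≤ z →
      Integrable (fun w => M.gaussValue P (M.obsTime j) (m + z / √(z + M.ε ^ 2) * w)
        (z * M.ε ^ 2 / (z + M.ε ^ 2)) * gaussianPDFReal 0 1 w) ∧
      Tendsto (fun t => M.gaussValue P t m z) (𝓝[<] M.obsTime j)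
        (𝓝 (∫ w, M.gaussValue P (M.obsTime j) (m + z / √(z + M.ε ^ 2) * w)
          (z * M.ε ^ 2 / (z + M.ε ^ 2)) * gaussianPDFReal 0 1 w))) ∧
    -- the terminal condition, which is attained continuously
    (∀ m z : ℝ, 0 ≤ z → M.gaussValue P M.horizon m z = m ^ 2 + z ∧
      Tendsto (fun t => M.gaussValue P t m z) (𝓝[<] M.horizon) (𝓝 (m ^ 2 + z))) := by
  have hP : M.IsDriven P := ⟨hU, hZ, hU_law, hZ_law, h_indep⟩
  refine ⟨fun t ht m z hz => ?_, fun i t ht m z hz => ?_, fun j m z hz => ?_, fun m z hz => ?_⟩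
  · exact OUModel.value_gaussianLaw_ne_top hP hC hε htime (htime_zero.symm ▸ ht) m hz
  · rw [M.time_eq_timeNat, M.time_eq_timeNat, Fin.val_castSucc, Fin.val_succ] at ht ⊢
    exact OUModel.gaussValue_hjb hP hC hε htime i.is_le ht m hz
  · exact OUModel.gaussValue_obsTime hP hC hε htime j m hz
  · exact ⟨OUModel.gaussValue_horizon hC hε htime m hz,
      OUModel.tendsto_gaussValue_horizon hP hC hε htime m hz⟩
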